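/- Let $\mathbb D=\{z\in\mathbb C:|z|<1\}$, let $n\ge1$, let $F=\{\sigma_1,\dots,\sigma_n\}$ consist of $n$ pairwise distinct points of $\partial\mathbb D$, and let $\Lambda=(\lambda_1,\dots,\lambda_n)\in(-\infty,0)^n$. A one-parameter semigroup $(\phi_t)_{t\ge0}$ is a family of holomorphic self-maps of $\mathbb D$ with $\phi_0=\mathrm{id}$, $\phi_{s+t}=\phi_s\circ\phi_t$ and $\phi_t(z)\to z$ as $t\to0^+$ for all $z\in\mathbb D$; its infinitesimal generator is the holomorphic function $G$ on $\mathbb D$ with $\frac{d}{dt}\phi_t(z)=G(\phi_t(z))$. A point $\sigma\in\partial\mathbb D$ is a boundary regular fixed point (BRFP) of a holomorphic $\varphi:\mathbb D\to\mathbb D$ if $\varphi$ has angular limit $\sigma$ at $\sigma$ and the angular derivative $\varphi'(\sigma)=\angle\lim_{z\to\sigma}\frac{\varphi(z)-\sigma}{z-\sigma}$ exists finitely. The Denjoy–Wolff point $\tau\in\overline{\mathbb D}$ of $\varphi\ne\mathrm{id}$ is its fixed point in $\mathbb D$ if there is one, and otherwise its unique BRFP with $\varphi'(\tau)\le1$;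 the Denjoy–Wolff point of a non-trivial semigroup is the common one of all $\phi_t\neq\mathrm{id}$. The spectral value of $(\phi_t)$ at $p$, where $p$ is its Denjoy–Wolff point or a BRFP of all $\phi_t$, is the number $\lambda$ with $\phi_t'(p)=e^{-\lambda t}$ for all $t\ge0$. For $\tau\in\overline{\mathbb D}\setminus F$ let $\mathrm{Gen}_\tau(F,\Lambda)$ be the class of all infinitesimal generators $G$ such that either $G\equiv0$ or the semigroup generated by $G$ has Denjoy–Wolff point $\tau$, and such that this semigroup has BRFPs at $\sigma_1,\dots,\sigma_n$ with spectral values $\lambda_k'$ satisfying $\lambda_k\le\lambda_k'\le0$, $k=1,\dots,n$. Let $\lambda(G)$ be the spectral value at $\tau$ of the semigroup generated by $G$ (so $\lambda(0)=0$). Put $$r:=\Big(\sum_{k=1}^n|\lambda_k|^{-1}\Big)^{-1},\qquad \alpha_k:=\frac{|\tau-\sigma_k|^2}{2|\lambda_k|},\qquad p_0(z):=\sum_{k=1}^n\alpha_k\frac{\sigma_k+z}{\sigma_k-z},$$ $$G_{\max}(z):=\frac{(\tau-z)(1-\overline\tau z)}{p_0(z)-i\sum_{k=1}^n|\lambda_k|^{-1}\operatorname{Im}(\overline{\sigma_k}\tau)},\qquad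 z\in\mathbb D.$$ Then $\lambda(G)$ is well defined on $\mathrm{Gen}_\tau(F,\Lambda)$, and the following holds. (A) If $\tau\in\mathbb D$, then the range of $G\mapsto\lambda(G)$ on $\mathrm{Gen}_\tau(F,\Lambda)$ is the closed disk $\Omega=\{\omega:|\omega-r|\le r\}$, and each boundary point of $\Omega$ is delivered by exactly one $G\in\mathrm{Gen}_\tau(F,\Lambda)$. If $\tau\ne0$, the family of all these extremal generators coincides with $\{G_\zeta:\zeta\in\partial Z\}$, where $$Z:=\Big\{\zeta\in\mathbb C:\Big|\Big(2\tau^{-1}\sum_{k=1}^n\alpha_k\Big)\zeta-1\Big|\le1\Big\},$$ $G_0\equiv0$ and $$G_\zeta(z):=\frac{(\tau-z)(1-\overline\tau z)}{i\operatorname{Im}\ell_\zeta+p_0(z)},\qquad \ell_\zeta:=\frac\tau\zeta-\sum_{k=1}^n\alpha_k,\qquad \zeta\in\partial Z\setminus\{0\}.$$ If $\tau=0$, the unique generator $G$ with $\lambda(G)=\omega$, for $\omega\in\partial\Omega\setminus\{0\}$, is $$\widehat G_\omega(z):=\frac{-z}{i\operatorname{Im}\big(\frac1\omega-\frac12\sum_{k=1}^n|\lambda_k|^{-1}\big)+p_0(z)},$$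 and for $\omega=0$ it is $\widehat G_0\equiv0$. (A$'$) In particular, if $\tau\in\mathbb D$, then $\operatorname{Re}\lambda(G)\le2r$ for all $G\in\mathrm{Gen}_\tau(F,\Lambda)$. The estimate is sharp: equality holds for $G=G_{\max}$, which belongs to the class and satisfies $\lambda(G_{\max})=2r$, and only for it. (B) If $\tau\in\partial\mathbb D\setminus F$, then $\lambda(G)$ is real and $\lambda(G)\le r$ for all $G\in\mathrm{Gen}_\tau(F,\Lambda)$. The estimate is sharp: equality holds for $G=G_{\max}$, which belongs to the class, and only for it. -/

import Mathlib

open Set Filter Topology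

namespace DiskSemigroup

/-- The open unit disk. Functions on the disk are represented by functions `ℂ → ℂ` of which only
the restriction to `disk` matters; equality of such functions is `Set.EqOn _ _ disk`. -/
abbrev disk : Set ℂ := Metric.ball (0 : ℂ) 1

/-- The Stolz region of aperture `M` with vertex `σ` (it is empty if `‖σ‖ = 1` and `M < 1`). -/
def stolz (σ : ℂ) (M : ℝ) : Set ℂ := {z | z ∈ disk ∧ ‖z - σ‖ ≤ M * (1 - ‖z‖)}

/-- The angular (non-tangential) limit of `f` at the boundary point `σ` exists and equals `L`. -/
def HasAngularLimit (f : ℂ → ℂ) (σ L : ℂ) : Prop :=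
  ∀ M : ℝ, Tendsto f (𝓝[stolz σ M] σ) (𝓝 L)

/-- `σ` is a boundary regular fixed point of `f`, with (finite) angular derivative `d`. -/
structure IsBRFPWith (f : ℂ → ℂ) (σ d : ℂ) : Prop where
  norm_eq_one : ‖σ‖ = 1
  fixed : HasAngularLimit f σ σ
  angular_deriv : HasAngularLimit (fun z => (f z - σ) / (z - σ)) σ d

/-- `τ` is the Denjoy-Wolff point of the holomorphic self-map `f ≠ id` of the disk: either `τ` is a
fixed point in the disk (necessarily unique, with `‖f' τ‖ ≤ 1`, by the Schwarz lemma), or `f` has no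
fixed point in the disk and `τ` is a boundary regular fixed point with `f' τ ≤ 1`. -/
def IsDWPoint (f : ℂ → ℂ) (τ : ℂ) : Prop :=
  ¬ EqOn f id disk ∧
    ((τ ∈ disk ∧ f τ = τ) ∨
      ((∀ z ∈ disk, f z ≠ z) ∧ ∃ d : ℝ, d ≤ 1 ∧ IsBRFPWith f τ (d : ℂ)))

/-- `(φ t)`, `t ≥ 0`, is a one-parameter semigroup of holomorphic self-maps of the disk.
The values of `φ t` for `t < 0` are irrelevant. -/
structure IsSemigroup (φ : ℝ → ℂ → ℂ) : Prop where
  holo : ∀ t : ℝ, 0 ≤ t → DifferentiableOn ℂ (φ t) disk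
  mapsTo : ∀ t : ℝ, 0 ≤ t → MapsTo (φ t) disk disk
  zero : ∀ z ∈ disk, φ 0 z = z
  add : ∀ s t : ℝ, 0 ≤ s → 0 ≤ t → ∀ z ∈ disk, φ (s + t) z = φ s (φ t z)
  cont : ∀ z ∈ disk, Tendsto (fun t => φ t z) (𝓝[>] 0) (𝓝 z)

/-- `(φ t)` is a one-parameter semigroup and `G` is its infinitesimal generator. -/
structure Generates (G : ℂ → ℂ) (φ : ℝ → ℂ → ℂ) : Prop where
  semigroup : IsSemigroup φ
  holo : DifferentiableOn ℂ G disk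
  flow : ∀ z ∈ disk, ∀ t : ℝ, 0 ≤ t →
    HasDerivWithinAt (fun s : ℝ => φ s z) (G (φ t z)) (Ici 0) t

/-- The semigroup `(φ t)` is non-trivial and `τ` is its Denjoy-Wolff point, i.e. the Denjoy-Wolff
point of each of its elements different from the identity. -/
def IsDWPointOf (φ : ℝ → ℂ → ℂ) (τ : ℂ) : Prop :=
  (∃ t : ℝ, 0 ≤ t ∧ ¬ EqOn (φ t) id disk) ∧
    ∀ t : ℝ, 0 ≤ t → ¬ EqOn (φ t) id disk → IsDWPoint (φ t) τ

/-- `p` is a fixed point of `f` with derivative `d` there: an ordinary fixed point and ordinary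
derivative if `p` is in the disk, a boundary regular fixed point and angular derivative if `p` is on
the unit circle. -/
def HasMultiplier (f : ℂ → ℂ) (p d : ℂ) : Prop :=
  (p ∈ disk ∧ f p = p ∧ HasDerivAt f d p) ∨ IsBRFPWith f p d

/-- `ω` is the spectral value of the semigroup `(φ t)` at its (interior or boundary regular) fixed
point `p`: `φ_t'(p) = exp (-ω t)` for all `t ≥ 0`. -/
def HasSpectralValue (φ : ℝ → ℂ → ℂ) (p ω : ℂ) : Prop :=
  ∀ t : ℝ, 0 ≤ t → HasMultiplier (φ t) p (Complex.exp (-ω * t))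

/-- The class of all infinitesimal generators `G` which vanish identically or whose semigroup has
Denjoy-Wolff point `τ`, and whose semigroup has boundary regular fixed points at the `σ k`, with
spectral values between `lam k` and `0`. -/
def Gen {n : ℕ} (τ : ℂ) (σ : Fin n → ℂ) (lam : Fin n → ℝ) : Set (ℂ → ℂ) :=
  {G | ∃ φ : ℝ → ℂ → ℂ, Generates G φ ∧ (EqOn G 0 disk ∨ IsDWPointOf φ τ) ∧
    ∀ k, ‖σ k‖ = 1 ∧ ∃ l : ℝ, lam k ≤ l ∧ l ≤ 0 ∧ HasSpectralValue φ (σ k) (l : ℂ)}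

/-- `ω = λ(G)`: the spectral value at `τ` of the semigroup generated by `G`. -/
def IsSpectralValue (G : ℂ → ℂ) (τ ω : ℂ) : Prop :=
  ∃ φ : ℝ → ℂ → ℂ, Generates G φ ∧ HasSpectralValue φ τ ω

/-- `r = (∑ 1 / |λ_k|)⁻¹`. -/
noncomputable def radius {n : ℕ} (lam : Fin n → ℝ) : ℝ := (∑ k, |lam k|⁻¹)⁻¹

/-- `α_k = |τ - σ_k|² / (2 |λ_k|)`. -/
noncomputable def alpha {n : ℕ} (τ : ℂ) (σ : Fin n → ℂ) (lam : Fin n → ℝ) (k : Fin n) : ℝ :=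
  ‖τ - σ k‖ ^ 2 / (2 * |lam k|)

/-- `p₀(z) = ∑ α_k (σ_k + z) / (σ_k - z)`. -/
noncomputable def pZero {n : ℕ} (τ : ℂ) (σ : Fin n → ℂ) (lam : Fin n → ℝ) (z : ℂ) : ℂ :=
  ∑ k, (alpha τ σ lam k : ℂ) * ((σ k + z) / (σ k - z))

/-- The function `z ↦ (τ - z) (1 - τ̄ z) / (i c + p₀(z))`. -/
noncomputable def genOf {n : ℕ} (τ : ℂ) (σ : Fin n → ℂ) (lam : Fin n → ℝ) (c : ℝ) (z : ℂ) : ℂ :=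
  (τ - z) * (1 - (starRingEnd ℂ) τ * z) / (Complex.I * c + pZero τ σ lam z)

/-- The disk `Z` of all `ζ` with `|(2 τ⁻¹ ∑ α_k) ζ - 1| ≤ 1` (for `τ ≠ 0`). -/
def Z {n : ℕ} (τ : ℂ) (σ : Fin n → ℂ) (lam : Fin n → ℝ) : Set ℂ :=
  {ζ | ‖(2 * τ⁻¹ * ∑ k, (alpha τ σ lam k : ℂ)) * ζ - 1‖ ≤ 1}

/-- `ℓ_ζ = τ / ζ - ∑ α_k` (for `ζ ≠ 0`). -/
noncomputable def ell {n : ℕ} (τ : ℂ) (σ : Fin n → ℂ) (lam : Fin n → ℝ) (ζ : ℂ) : ℂ :=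
  τ / ζ - ∑ k, (alpha τ σ lam k : ℂ)

open Classical in
/-- The extremal generators `G_ζ`, `ζ ∈ ∂Z`, for `τ ≠ 0`; here `G_0 ≡ 0`. -/
noncomputable def GZeta {n : ℕ} (τ : ℂ) (σ : Fin n → ℂ) (lam : Fin n → ℝ) (ζ : ℂ) : ℂ → ℂ :=
  if ζ = 0 then 0 else genOf τ σ lam (ell τ σ lam ζ).im

open Classical in
/-- The extremal generators `z ↦ -z / (i Im (1 / ω - ½ ∑ 1 / |λ_k|) + p₀(z))` for `τ = 0`, which are
indexed by the boundary points `ω` of the disk `|ω - r| ≤ r`; for `ω = 0` it is `0`. -/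
noncomputable def GHat {n : ℕ} (σ : Fin n → ℂ) (lam : Fin n → ℝ) (ω : ℂ) : ℂ → ℂ :=
  if ω = 0 then 0
  else fun z => -z /
    (Complex.I * ((1 / ω - (1 / 2 : ℂ) * ∑ k, ((|lam k|⁻¹ : ℝ) : ℂ)).im : ℝ) + pZero 0 σ lam z)

/-- The extremal generator
`z ↦ (τ - z) (1 - τ̄ z) / (p₀(z) - i ∑ |λ_k|⁻¹ Im (σ̄_k τ))`. -/
noncomputable def GMax {n : ℕ} (τ : ℂ) (σ : Fin n → ℂ) (lam : Fin n → ℝ) (z : ℂ) : ℂ :=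
  (τ - z) * (1 - (starRingEnd ℂ) τ * z) /
    (pZero τ σ lam z
      - Complex.I * ((∑ k, |lam k|⁻¹ * ((starRingEnd ℂ) (σ k) * τ).im : ℝ) : ℂ))

end DiskSemigroup

/-! ### Half-plane functions on the disk: Schwarz–Pick, Harnack, Julia's lemma and point masses. -/

namespace DiskSemigroup

open Complex ComplexConjugate

/-! Everything rests on one inequality. A generator of the class factors as G = (τ - z)(1 - τ̄z) q,
and Re p₀ · |q|² ≤ Re q; where q ≠ 0 this says that 1/q - p₀ has nonnegative real part. To get it,
attach to φ_t the function H with H (z - φ_t) = (z - τ)(1 - τ̄φ_t) + (φ_t - τ)(1 - τ̄z). By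
Schwarz–Pick or Julia, Re H ≥ 0, and H has point mass |σ_k - τ|²/(φ_t'(σ_k) - 1) at each σ_k
(`exists_halfPlane`, `halfPlane_mass`). Re H dominates the sum of its point masses
(`re_ge_sum_of_tendsto_radius`). Multiplying by t and letting t → 0⁺ gives the inequality
(`re_ge_of_generates`), without any Herglotz measure.

For τ inside the disk, λ(G) = (1 - |τ|²) q(τ) and Re p₀(τ) = (1 - |τ|²)/(2r), so the inequality at τ
reads |λ|² ≤ 2r Re λ, which is the disk Ω. For λ on its boundary, either q ≡ 0, or 1/q - p₀ has
vanishing real part at τ and is therefore an imaginary constant: this is uniqueness together with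
the list of extremals (`spectralValue_interior`).

For τ on the circle, Julia's lemma for the flow bounds |1/q| near τ by (1 - ρ)/λ to first order,
while Re p₀ decays like (1 - ρ)/r; hence λ ≤ r, and in the equality case Harnack makes 1/q - p₀
constant (`spectralValue_boundary`).

Conversely, each q = 1/(a + p₀) with Re a ≥ 0 gives a field that cannot push trajectories out of the
disk too fast, so its flow is global. Linearizing the flow along a curve gives both its holomorphy
and its multipliers at boundary zeros (`IsFlow.tendsto_ratio`). -/

lemma mem_disk {z : ℂ} : z ∈ disk ↔ ‖z‖ < 1 := by simp [disk]

lemma isOpen_disk : IsOpen disk := Metric.isOpen_ball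

lemma zero_mem_disk : (0 : ℂ) ∈ disk := by simp [disk]

lemma disk_mem_nhds {z : ℂ} (hz : z ∈ disk) : disk ∈ 𝓝 z := isOpen_disk.mem_nhds hz

lemma norm_sq_eq (z : ℂ) : ‖z‖ ^ 2 = z.re ^ 2 + z.im ^ 2 := by
  rw [← Complex.normSq_eq_norm_sq, Complex.normSq_apply]; ring

lemma norm_sq_lt_one {z : ℂ} (hz : z ∈ disk) : ‖z‖ ^ 2 < 1 := by
  have := mem_disk.1 hz
  nlinarith [norm_nonneg z]

lemma norm_one_sub_conj_mul_sq (w z : ℂ) :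
    ‖1 - conj w * z‖ ^ 2 = ‖z - w‖ ^ 2 + (1 - ‖z‖ ^ 2) * (1 - ‖w‖ ^ 2) := by
  simp only [norm_sq_eq, sub_re, sub_im, mul_re, mul_im, conj_re, conj_im, one_re, one_im]
  ring

lemma norm_add_conj_sq (a b : ℂ) : ‖a + conj b‖ ^ 2 = ‖a - b‖ ^ 2 + 4 * a.re * b.re := by
  simp only [norm_sq_eq, sub_re, sub_im, add_re, add_im, conj_re, conj_im]
  ring

lemma one_sub_conj_mul_ne_zero {w z : ℂ} (hw : ‖w‖ ≤ 1) (hz : ‖z‖ < 1) :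
    1 - conj w * z ≠ 0 := by
  intro h
  have h1 : conj w * z = 1 := (sub_eq_zero.1 h).symm
  have h2 : ‖conj w * z‖ < 1 := by
    rw [norm_mul, RCLike.norm_conj]
    nlinarith [norm_nonneg w, norm_nonneg z]
  rw [h1] at h2
  simp at h2

lemma mobius_mem_disk {w z : ℂ} (hw : w ∈ disk) (hz : z ∈ disk) :
    (z - w) / (1 - conj w * z) ∈ disk := by
  rw [mem_disk] at *
  have h0 : 0 < ‖1 - conj w * z‖ := norm_pos_iff.2 (one_sub_conj_mul_ne_zero hw.le hz)
  rw [norm_div, div_lt_one h0]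
  have h := norm_one_sub_conj_mul_sq w z
  have h1 : 0 < (1 - ‖z‖ ^ 2) * (1 - ‖w‖ ^ 2) :=
    mul_pos (by nlinarith [norm_nonneg z]) (by nlinarith [norm_nonneg w])
  nlinarith [norm_nonneg (z - w)]

/-- The Schwarz-Pick inequality. -/
lemma schwarz_pick {f : ℂ → ℂ} (hf : DifferentiableOn ℂ f disk) (hm : MapsTo f disk disk)
    {z w : ℂ} (hz : z ∈ disk) (hw : w ∈ disk) :
    ‖f z - f w‖ * ‖1 - conj w * z‖ ≤ ‖z - w‖ * ‖1 - conj (f w) * f z‖ := by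
  have hnw : -w ∈ disk := by simpa [mem_disk] using mem_disk.1 hw
  set M : ℂ → ℂ := fun ζ => (ζ - -w) / (1 - conj (-w) * ζ) with hM
  have hMd : DifferentiableOn ℂ M disk := by
    refine DifferentiableOn.div (by fun_prop) (by fun_prop) fun ζ hζ => ?_
    exact one_sub_conj_mul_ne_zero (mem_disk.1 hnw).le (mem_disk.1 hζ)
  have hMm : MapsTo M disk disk := fun ζ hζ => mobius_mem_disk hnw hζ
  set C : ℂ → ℂ := fun η => (η - f w) / (1 - conj (f w) * η) with hC
  have hCd : DifferentiableOn ℂ C disk := by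
    refine DifferentiableOn.div (by fun_prop) (by fun_prop) fun ζ hζ => ?_
    exact one_sub_conj_mul_ne_zero (mem_disk.1 (hm hw)).le (mem_disk.1 hζ)
  have hCm : MapsTo C disk disk := fun ζ hζ => mobius_mem_disk (hm hw) hζ
  have hF : DifferentiableOn ℂ (C ∘ f ∘ M) disk := hCd.comp (hf.comp hMd hMm) (hm.comp hMm)
  have hFm : MapsTo (C ∘ f ∘ M) disk disk := hCm.comp (hm.comp hMm)
  have hM0 : M 0 = w := by simp [hM]
  have hF0 : (C ∘ f ∘ M) 0 = 0 := by simp [hM0, hC]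
  have hd1 := one_sub_conj_mul_ne_zero (mem_disk.1 hw).le (mem_disk.1 hz)
  have hd2 := one_sub_conj_mul_ne_zero (mem_disk.1 (hm hw)).le (mem_disk.1 (hm hz))
  set ζ := (z - w) / (1 - conj w * z) with hζ
  have hζd : ζ ∈ disk := mobius_mem_disk hw hz
  have hMζ : M ζ = z := by
    have h4 : 1 - conj (-w) * ζ ≠ 0 :=
      one_sub_conj_mul_ne_zero (mem_disk.1 hnw).le (mem_disk.1 hζd)
    rw [hM]
    simp only
    have h5 : ζ * (1 - conj w * z) = z - w := div_mul_cancel₀ _ hd1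
    rw [div_eq_iff h4, map_neg]
    linear_combination h5
  have := Complex.norm_le_norm_of_mapsTo_ball (R := 1) hF
    (hFm.mono_right Metric.ball_subset_closedBall) hF0 (mem_disk.1 hζd)
  simp only [Function.comp_apply, hMζ, hC] at this
  rw [hζ, norm_div, norm_div, div_le_div_iff₀ (norm_pos_iff.2 hd2) (norm_pos_iff.2 hd1)] at this
  exact this

/-- The Cayley transform carries Schwarz–Pick from the disk to the right half-plane. As `h` may
touch the imaginary axis, it is first shifted by ε > 0, and ε → 0 at the end. -/
lemma schwarz_pick_halfPlane {h : ℂ → ℂ} (hh : DifferentiableOn ℂ h disk)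
    (hre : ∀ z ∈ disk, 0 ≤ (h z).re) {z w : ℂ} (hz : z ∈ disk) (hw : w ∈ disk) :
    ‖h z - h w‖ * ‖1 - conj w * z‖ ≤ ‖z - w‖ * ‖h z + conj (h w)‖ := by
  have key : ∀ ε : ℝ, 0 < ε →
      ‖h z - h w‖ * ‖1 - conj w * z‖ ≤ ‖z - w‖ * ‖h z + ε + conj (h w + ε)‖ := by
    intro ε hε
    have hne : ∀ x ∈ disk, h x + ε + 1 ≠ 0 := fun x hx h0 => by
      have h1 := congrArg Complex.re h0
      have h2 := hre x hx
      simp at h1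
      linarith
    set f : ℂ → ℂ := fun x => (h x + ε - 1) / (h x + ε + 1) with hf
    have hfd : DifferentiableOn ℂ f disk :=
      DifferentiableOn.div (by fun_prop) (by fun_prop) hne
    have hfm : MapsTo f disk disk := by
      intro x hx
      rw [mem_disk, hf]
      simp only
      rw [norm_div, div_lt_one (norm_pos_iff.2 (hne x hx))]
      have h2 := hre x hx
      refine lt_of_pow_lt_pow_left₀ 2 (norm_nonneg _) ?_
      simp only [norm_sq_eq, sub_re, sub_im, add_re, add_im, ofReal_re, ofReal_im, one_re, one_im]
      nlinarith
    have := schwarz_pick hfd hfm hz hw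
    have hz' := hne z hz
    have hw' := hne w hw
    have hcw : conj (h w + ε + 1) ≠ 0 := by simpa using (map_ne_zero conj).2 hw'
    have e1 : f z - f w = 2 * (h z - h w) / ((h z + ε + 1) * (h w + ε + 1)) := by
      rw [hf]; field_simp; ring
    have e2 : 1 - conj (f w) * f z =
        2 * (h z + ε + conj (h w + ε)) / ((h z + ε + 1) * conj (h w + ε + 1)) := by
      rw [hf]
      simp only [map_div₀, map_add, map_sub, map_one] at hcw ⊢
      field_simp
      ring
    rw [e1, e2] at this
    simp only [norm_div, norm_mul, RCLike.norm_conj] at this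
    have hp : 0 < ‖h z + ε + 1‖ * ‖h w + ε + 1‖ :=
      mul_pos (norm_pos_iff.2 hz') (norm_pos_iff.2 hw')
    rw [div_mul_eq_mul_div, mul_div_assoc', div_le_div_iff_of_pos_right hp] at this
    simp only [Complex.norm_ofNat] at this
    linarith
  have hlim : Tendsto (fun ε : ℝ => ‖z - w‖ * ‖h z + ε + conj (h w + ε)‖) (𝓝[>] 0)
      (𝓝 (‖z - w‖ * ‖h z + (0 : ℝ) + conj (h w + (0 : ℝ))‖)) := by
    refine Tendsto.mono_left (Continuous.tendsto ?_ _) nhdsWithin_le_nhds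
    fun_prop
  have := ge_of_tendsto hlim (eventually_nhdsWithin_of_forall fun ε hε => key ε hε)
  simpa using this

lemma schwarz_pick_halfPlane_sq {h : ℂ → ℂ} (hh : DifferentiableOn ℂ h disk)
    (hre : ∀ z ∈ disk, 0 ≤ (h z).re) {z w : ℂ} (hz : z ∈ disk) (hw : w ∈ disk) :
    (1 - ‖z‖ ^ 2) * (1 - ‖w‖ ^ 2) * ‖h z + conj (h w)‖ ^ 2 ≤
      4 * ‖1 - conj w * z‖ ^ 2 * (h z).re * (h w).re := by
  have h1 := pow_le_pow_left₀ (by positivity) (schwarz_pick_halfPlane hh hre hz hw) 2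
  rw [mul_pow, mul_pow] at h1
  have h2 := norm_one_sub_conj_mul_sq w z
  have h3 := norm_add_conj_sq (h z) (h w)
  have h4 : ‖h z - h w‖ ^ 2 = ‖h z + conj (h w)‖ ^ 2 - 4 * (h z).re * (h w).re := by linarith
  have h5 : ‖z - w‖ ^ 2 = ‖1 - conj w * z‖ ^ 2 - (1 - ‖z‖ ^ 2) * (1 - ‖w‖ ^ 2) := by linarith
  rw [h4, h5] at h1
  linarith

/-- Follows from the squared Schwarz–Pick inequality by `|h z + conj (h w)| ≥ Re h w` and division
by `Re h w`. The factor 4 is the right one for Julia's lemma: for the kernel of `σ` both sides agree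
in the limit `w → σ`. -/
lemma harnack {h : ℂ → ℂ} (hh : DifferentiableOn ℂ h disk)
    (hre : ∀ z ∈ disk, 0 ≤ (h z).re) {z w : ℂ} (hz : z ∈ disk) (hw : w ∈ disk) :
    (1 - ‖z‖ ^ 2) * (1 - ‖w‖ ^ 2) * (h w).re ≤ 4 * ‖1 - conj w * z‖ ^ 2 * (h z).re := by
  have h1 := schwarz_pick_halfPlane_sq hh hre hz hw
  have hz' := norm_sq_lt_one hz
  have hw' := norm_sq_lt_one hw
  have hE : 0 < (1 - ‖z‖ ^ 2) * (1 - ‖w‖ ^ 2) := mul_pos (by linarith) (by linarith)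
  rcases (hre w hw).eq_or_lt with h0 | h0
  · rw [← h0, mul_zero]
    have := hre z hz
    positivity
  · have h2 : (h w).re ^ 2 ≤ ‖h z + conj (h w)‖ ^ 2 := by
      rw [norm_sq_eq]
      simp only [add_re, conj_re]
      have := hre z hz
      nlinarith [sq_nonneg (h z + conj (h w)).im]
    have h3 := mul_le_mul_of_nonneg_left h2 hE.le
    refine le_of_mul_le_mul_right ?_ h0
    nlinarith

/-- Growth of functions with nonnegative real part. -/
lemma norm_le_of_re_nonneg {h : ℂ → ℂ} (hh : DifferentiableOn ℂ h disk)
    (hre : ∀ z ∈ disk, 0 ≤ (h z).re) {z : ℂ} (hz : z ∈ disk) :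
    (1 - ‖z‖) * ‖h z‖ ≤ 2 * ‖h 0‖ := by
  have h1 := schwarz_pick_halfPlane hh hre hz zero_mem_disk
  simp only [map_zero, zero_mul, sub_zero, norm_one, mul_one] at h1
  have h2 : ‖h z‖ ≤ ‖h z - h 0‖ + ‖h 0‖ := by
    simpa using norm_add_le (h z - h 0) (h 0)
  have h3 : ‖h z + conj (h 0)‖ ≤ ‖h z‖ + ‖h 0‖ := by
    simpa using norm_add_le (h z) (conj (h 0))
  have h4 := mul_le_mul_of_nonneg_left h3 (norm_nonneg z)
  have h5 := mem_disk.1 hz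
  nlinarith [norm_nonneg (h 0)]

/-- The right side of Schwarz–Pick vanishes, so `h z = -conj (h w) = h w`. This rigidity underlies
all uniqueness statements. -/
lemma eqOn_const_of_re_eq_zero {h : ℂ → ℂ} (hh : DifferentiableOn ℂ h disk)
    (hre : ∀ z ∈ disk, 0 ≤ (h z).re) {w : ℂ} (hw : w ∈ disk) (h0 : (h w).re = 0) :
    ∀ z ∈ disk, h z = h w := by
  intro z hz
  have h1 := schwarz_pick_halfPlane_sq hh hre hz hw
  have hz' := norm_sq_lt_one hz
  have hw' := norm_sq_lt_one hw
  have hE : 0 < (1 - ‖z‖ ^ 2) * (1 - ‖w‖ ^ 2) := mul_pos (by linarith) (by linarith)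
  rw [h0, mul_zero] at h1
  have h2 : ‖h z + conj (h w)‖ ^ 2 ≤ 0 := by
    by_contra hc
    push Not at hc
    have := mul_pos hE hc
    linarith
  have h3 : h z + conj (h w) = 0 := by
    have : ‖h z + conj (h w)‖ = 0 := by nlinarith [norm_nonneg (h z + conj (h w))]
    exact norm_eq_zero.1 this
  have h4 : conj (h w) = - h w := by
    apply Complex.ext <;> simp [h0]
  rw [h4] at h3
  linear_combination h3

/-- The Herglotz kernel `z ↦ (σ + z) / (σ - z)`. -/
noncomputable def cayley (σ z : ℂ) : ℂ := (σ + z) / (σ - z)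

lemma sub_ne_zero_of_norm_eq_one {σ z : ℂ} (hσ : ‖σ‖ = 1) (hz : z ∈ disk) : σ - z ≠ 0 := by
  intro h
  rw [sub_eq_zero.1 h] at hσ
  exact (mem_disk.1 hz).ne hσ

lemma sub_ne_zero_of_norm_eq_one' {σ z : ℂ} (hσ : ‖σ‖ = 1) (hz : z ∈ disk) : z - σ ≠ 0 := by
  rw [← neg_sub]
  exact neg_ne_zero.2 (sub_ne_zero_of_norm_eq_one hσ hz)

lemma differentiableOn_cayley {σ : ℂ} (hσ : ‖σ‖ = 1) : DifferentiableOn ℂ (cayley σ) disk :=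
  DifferentiableOn.div (by fun_prop) (by fun_prop) fun _ hz => sub_ne_zero_of_norm_eq_one hσ hz

lemma cayley_re (σ z : ℂ) : (cayley σ z).re = (‖σ‖ ^ 2 - ‖z‖ ^ 2) / ‖σ - z‖ ^ 2 := by
  rw [cayley, Complex.div_re, Complex.normSq_eq_norm_sq, ← add_div]
  simp only [norm_sq_eq, sub_re, sub_im, add_re, add_im]
  ring

lemma cayley_re' {σ : ℂ} (hσ : ‖σ‖ = 1) (z : ℂ) :
    (cayley σ z).re = (1 - ‖z‖ ^ 2) / ‖σ - z‖ ^ 2 := by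
  rw [cayley_re, hσ, one_pow]

lemma cayley_re_pos {σ z : ℂ} (hσ : ‖σ‖ = 1) (hz : z ∈ disk) : 0 < (cayley σ z).re := by
  rw [cayley_re' hσ]
  have := norm_sq_lt_one hz
  have := norm_pos_iff.2 (sub_ne_zero_of_norm_eq_one hσ hz)
  exact div_pos (by linarith) (by positivity)

lemma norm_ofReal_mul {σ : ℂ} (hσ : ‖σ‖ = 1) {ρ : ℝ} (h0 : 0 ≤ ρ) : ‖(ρ : ℂ) * σ‖ = ρ := by
  rw [norm_mul, hσ, mul_one, Complex.norm_real, Real.norm_of_nonneg h0]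

lemma radius_mem_disk {σ : ℂ} (hσ : ‖σ‖ = 1) {ρ : ℝ} (h : ρ ∈ Ioo (0 : ℝ) 1) :
    (ρ : ℂ) * σ ∈ disk := by
  rw [mem_disk, norm_ofReal_mul hσ h.1.le]
  exact h.2

lemma Ioo_mem_nhdsLT_one : Ioo (0 : ℝ) 1 ∈ 𝓝[<] (1 : ℝ) := Ioo_mem_nhdsLT zero_lt_one

lemma tendsto_radius (σ : ℂ) : Tendsto (fun ρ : ℝ => (ρ : ℂ) * σ) (𝓝[<] 1) (𝓝 σ) := by
  have : Tendsto (fun ρ : ℝ => (ρ : ℂ) * σ) (𝓝 1) (𝓝 (((1 : ℝ) : ℂ) * σ)) :=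
    Continuous.tendsto (by fun_prop) _
  simp only [ofReal_one, one_mul] at this
  exact this.mono_left nhdsWithin_le_nhds

/-- Julia's lemma: a function with nonnegative real part dominates its point mass at `σ`. -/
lemma re_ge_of_tendsto_radius {h : ℂ → ℂ} (hh : DifferentiableOn ℂ h disk)
    (hre : ∀ z ∈ disk, 0 ≤ (h z).re) {σ : ℂ} (hσ : ‖σ‖ = 1) {α : ℝ}
    (hlim : Tendsto (fun ρ : ℝ => (1 - ρ) * (h (ρ * σ)).re) (𝓝[<] 1) (𝓝 (2 * α)))
    {z : ℂ} (hz : z ∈ disk) : α * (cayley σ z).re ≤ (h z).re := by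
  -- Harnack with `w = ρσ`. For the kernel of `σ` itself, `(1 - ρ)` times the real part is `1 + ρ →
  -- 2`, whence the normalization `2 * α` of a mass `α`.
  have h1 : ∀ᶠ ρ : ℝ in 𝓝[<] 1, (1 - ‖z‖ ^ 2) * ((1 + ρ) * ((1 - ρ) * (h (ρ * σ)).re)) ≤
      4 * ‖1 - conj (ρ * σ) * z‖ ^ 2 * (h z).re := by
    filter_upwards [Ioo_mem_nhdsLT_one] with ρ hρ
    have := harnack hh hre hz (radius_mem_disk hσ hρ)
    rw [norm_ofReal_mul hσ hρ.1.le] at this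
    refine le_trans (le_of_eq ?_) this
    ring
  have h2 : Tendsto (fun ρ : ℝ => (1 - ‖z‖ ^ 2) * ((1 + ρ) * ((1 - ρ) * (h (ρ * σ)).re))) (𝓝[<] 1)
      (𝓝 ((1 - ‖z‖ ^ 2) * ((1 + 1) * (2 * α)))) := by
    refine Tendsto.const_mul _ (Tendsto.mul ?_ hlim)
    exact (Continuous.tendsto (by fun_prop) _).mono_left nhdsWithin_le_nhds
  have h3 : Tendsto (fun ρ : ℝ => 4 * ‖1 - conj (ρ * σ) * z‖ ^ 2 * (h z).re) (𝓝[<] 1)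
      (𝓝 (4 * ‖1 - conj σ * z‖ ^ 2 * (h z).re)) := by
    have : Continuous fun w : ℂ => 4 * ‖1 - conj w * z‖ ^ 2 * (h z).re := by fun_prop
    exact (this.tendsto σ).comp (tendsto_radius σ)
  have h4 := le_of_tendsto_of_tendsto h2 h3 h1
  have h5 : ‖1 - conj σ * z‖ ^ 2 = ‖σ - z‖ ^ 2 := by
    rw [norm_one_sub_conj_mul_sq, hσ, norm_sub_rev]; ring
  rw [h5] at h4
  have h6 : 0 < ‖σ - z‖ := norm_pos_iff.2 (sub_ne_zero_of_norm_eq_one hσ hz)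
  rw [cayley_re' hσ, mul_div_assoc', div_le_iff₀ (by positivity)]
  linarith

lemma tendsto_mul_cayley_of_ne {σ s : ℂ} (hne : s ≠ σ) :
    Tendsto (fun ρ : ℝ => (1 - ρ) * (cayley s (ρ * σ)).re) (𝓝[<] 1) (𝓝 0) := by
  have h1 : ContinuousAt (fun z => (cayley s z).re) σ := by
    refine Complex.continuous_re.continuousAt.comp ?_
    exact ContinuousAt.div (by fun_prop) (by fun_prop) (sub_ne_zero.2 hne)
  have h2 : Tendsto (fun ρ : ℝ => (cayley s (ρ * σ)).re) (𝓝[<] 1) (𝓝 (cayley s σ).re) :=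
    h1.tendsto.comp (tendsto_radius σ)
  have h0 : Tendsto (fun ρ : ℝ => 1 - ρ) (𝓝[<] 1) (𝓝 (1 - 1)) :=
    (Continuous.tendsto (by fun_prop) _).mono_left nhdsWithin_le_nhds
  simpa using h0.mul h2

/-- A function with nonnegative real part dominates the sum of its point masses. -/
lemma re_ge_sum_of_tendsto_radius {ι : Type*} {h : ℂ → ℂ} (hh : DifferentiableOn ℂ h disk)
    (hre : ∀ z ∈ disk, 0 ≤ (h z).re) {σ : ι → ℂ} (hσ : ∀ k, ‖σ k‖ = 1)
    (hinj : Function.Injective σ) {α : ι → ℝ} (s : Finset ι)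
    (hlim : ∀ k ∈ s, Tendsto (fun ρ : ℝ => (1 - ρ) * (h (ρ * σ k)).re) (𝓝[<] 1) (𝓝 (2 * α k)))
    {z : ℂ} (hz : z ∈ disk) : ∑ k ∈ s, α k * (cayley (σ k) z).re ≤ (h z).re := by
  classical
  induction s using Finset.induction_on generalizing z with
  | empty => simpa using hre z hz
  | insert j s hj ih =>
    have ih' := fun z hz => ih (fun k hk => hlim k (Finset.mem_insert_of_mem hk)) (z := z) hz
    -- Subtract the masses already treated. The real part stays nonnegative by induction, and the
    -- mass at `σ j` is unchanged since the other kernels are bounded near `σ j`.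
    set g : ℂ → ℂ := fun z => h z - ∑ k ∈ s, (α k : ℂ) * cayley (σ k) z with hg
    have hgre : ∀ z, (g z).re = (h z).re - ∑ k ∈ s, α k * (cayley (σ k) z).re := by
      intro z
      simp [hg]
    have hgd : DifferentiableOn ℂ g disk := by
      refine hh.sub (DifferentiableOn.fun_sum fun k _ => ?_)
      exact (differentiableOn_cayley (hσ k)).const_mul _
    have h1 := re_ge_of_tendsto_radius hgd (fun z hz => by rw [hgre]; linarith [ih' z hz]) (hσ j)
      (α := α j) ?_ hz
    · rw [hgre] at h1
      rw [Finset.sum_insert hj]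
      linarith
    · have h2 := hlim j (Finset.mem_insert_self _ _)
      have h3 : Tendsto (fun ρ : ℝ => ∑ k ∈ s, α k * ((1 - ρ) * (cayley (σ k) (ρ * σ j)).re))
          (𝓝[<] 1) (𝓝 (∑ k ∈ s, α k * 0)) := by
        refine tendsto_finsetSum _ fun k hk => Tendsto.const_mul _ (tendsto_mul_cayley_of_ne ?_)
        intro he
        rw [hinj he] at hk
        exact hj hk
      have h4 := h2.sub h3
      simp only [mul_zero, Finset.sum_const_zero, sub_zero] at h4
      refine h4.congr fun ρ => ?_
      rw [hgre, mul_sub, Finset.mul_sum]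
      congr 1
      exact Finset.sum_congr rfl fun k _ => by ring

end DiskSemigroup

/-! ### Existence and uniqueness of trajectories in the disk. -/

namespace DiskSemigroup

open Complex ComplexConjugate
open scoped NNReal

/-- Multiplication by a bump function equal to 1 on the ball makes the field globally Lipschitz and
bounded, as wanted for Picard–Lindelöf and for uniqueness. -/
lemma exists_lipschitz_cutoff {G : ℂ → ℂ} (hG : DifferentiableOn ℂ G disk) {R : ℝ} (hR : R < 1) :
    ∃ g : ℂ → ℂ, EqOn g G (Metric.closedBall 0 R) ∧ (∃ K : ℝ≥0, LipschitzWith K g) ∧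
      ∃ L : ℝ≥0, ∀ x, ‖g x‖ ≤ L := by
  -- The maximum only ensures a positive inner radius for the bump, since `R` may be nonpositive.
  set R₁ : ℝ := max R (1 / 2) with hR₁
  have hR₁0 : 0 < R₁ := lt_of_lt_of_le (by norm_num) (le_max_right _ _)
  have hR₁1 : R₁ < 1 := max_lt hR (by norm_num)
  let χ : ContDiffBump (0 : ℂ) := ⟨R₁, (R₁ + 1) / 2, hR₁0, by linarith⟩
  set g : ℂ → ℂ := fun z => (χ z : ℝ) • G z with hg
  have hGc : ContDiffOn ℝ 1 G disk := (hG.contDiffOn isOpen_disk).restrict_scalars ℝ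
  have hsupp : HasCompactSupport g := χ.hasCompactSupport.smul_right
  have hgd : ContDiff ℝ 1 g := by
    rw [contDiff_iff_contDiffAt]
    intro z
    by_cases hz : z ∈ disk
    · exact χ.contDiffAt.smul (hGc.contDiffAt (disk_mem_nhds hz))
    · have hz' : z ∉ tsupport g := by
        intro hz'
        have h1 : z ∈ tsupport χ := tsupport_smul_subset_left _ _ hz'
        rw [χ.tsupport_eq, mem_closedBall_zero_iff] at h1
        refine hz (mem_disk.2 (h1.trans_lt ?_))
        change (R₁ + 1) / 2 < 1
        linarith
      have : g =ᶠ[𝓝 z] 0 := notMem_tsupport_iff_eventuallyEq.1 hz'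
      exact contDiffAt_const.congr_of_eventuallyEq this
  refine ⟨g, fun z hz => ?_, hgd.lipschitzWith_of_hasCompactSupport hsupp one_ne_zero, ?_⟩
  · have : χ z = 1 := χ.one_of_mem_closedBall
      (Metric.closedBall_subset_closedBall (le_max_left _ _) hz)
    simp [hg, this]
  · obtain ⟨C, hC⟩ := hgd.continuous.bounded_above_of_compact_support hsupp
    exact ⟨⟨max C 0, le_max_right _ _⟩, fun x => (hC x).trans (le_max_left _ _)⟩

/-- `γ` solves `γ' = G(γ)` in the disk on the interval `[0, T]`. -/
def IsTrajOn (G : ℂ → ℂ) (γ : ℝ → ℂ) (T : ℝ) : Prop :=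
  ∀ t ∈ Icc 0 T, γ t ∈ disk ∧ HasDerivWithinAt γ (G (γ t)) (Icc 0 T) t

/-- `γ` solves `γ' = G(γ)` in the disk on `[0, ∞)`. -/
def IsTraj (G : ℂ → ℂ) (γ : ℝ → ℂ) : Prop :=
  ∀ t, 0 ≤ t → γ t ∈ disk ∧ HasDerivWithinAt γ (G (γ t)) (Ici 0) t

lemma IsTraj.isTrajOn {G : ℂ → ℂ} {γ : ℝ → ℂ} (h : IsTraj G γ) (T : ℝ) : IsTrajOn G γ T :=
  fun t ht => ⟨(h t ht.1).1, (h t ht.1).2.mono Icc_subset_Ici_self⟩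

lemma IsTrajOn.mono {G : ℂ → ℂ} {γ : ℝ → ℂ} {T S : ℝ} (h : IsTrajOn G γ T) (hS : S ≤ T) :
    IsTrajOn G γ S :=
  fun t ht => ⟨(h t ⟨ht.1, ht.2.trans hS⟩).1,
    (h t ⟨ht.1, ht.2.trans hS⟩).2.mono (Icc_subset_Icc_right hS)⟩

lemma IsTrajOn.continuousOn {G : ℂ → ℂ} {γ : ℝ → ℂ} {T : ℝ} (h : IsTrajOn G γ T) :
    ContinuousOn γ (Icc 0 T) := fun t ht => (h t ht).2.continuousWithinAt

lemma IsTrajOn.hasDerivWithinAt_Ici {G : ℂ → ℂ} {γ : ℝ → ℂ} {T t : ℝ} (h : IsTrajOn G γ T)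
    (ht : t ∈ Ico 0 T) : HasDerivWithinAt γ (G (γ t)) (Ici t) t :=
  (h t (Ico_subset_Icc_self ht)).2.mono_of_mem_nhdsWithin (Icc_mem_nhdsGE_of_mem ht)

lemma exists_closedBall_of_isCompact {s : Set ℂ} (hs : IsCompact s) (hd : s ⊆ disk) :
    ∃ R, 0 ≤ R ∧ R < 1 ∧ s ⊆ Metric.closedBall 0 R := by
  rcases s.eq_empty_or_nonempty with rfl | hne
  · exact ⟨0, le_rfl, zero_lt_one, empty_subset _⟩
  · obtain ⟨x, hx, hmax⟩ := hs.exists_isMaxOn hne continuous_norm.continuousOn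
    exact ⟨‖x‖, norm_nonneg _, mem_disk.1 (hd hx), fun y hy => mem_closedBall_zero_iff.2 (hmax hy)⟩

lemma IsTrajOn.exists_closedBall {G : ℂ → ℂ} {γ : ℝ → ℂ} {T : ℝ} (h : IsTrajOn G γ T) :
    ∃ R, 0 ≤ R ∧ R < 1 ∧ ∀ t ∈ Icc 0 T, γ t ∈ Metric.closedBall (0 : ℂ) R := by
  obtain ⟨R, hR0, hR, hs⟩ := exists_closedBall_of_isCompact (isCompact_Icc.image_of_continuousOn
    h.continuousOn) (image_subset_iff.2 fun t ht => (h t ht).1)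
  exact ⟨R, hR0, hR, fun t ht => hs (mem_image_of_mem _ ht)⟩

lemma IsTrajOn.eqOn {G : ℂ → ℂ} (hG : DifferentiableOn ℂ G disk) {γ₁ γ₂ : ℝ → ℂ} {T : ℝ}
    (h₁ : IsTrajOn G γ₁ T) (h₂ : IsTrajOn G γ₂ T) (h0 : γ₁ 0 = γ₂ 0) : EqOn γ₁ γ₂ (Icc 0 T) := by
  obtain ⟨R₁, _, hR₁, hm₁⟩ := h₁.exists_closedBall
  obtain ⟨R₂, _, hR₂, hm₂⟩ := h₂.exists_closedBall
  obtain ⟨g, hgG, ⟨K, hK⟩, -⟩ := exists_lipschitz_cutoff hG (max_lt hR₁ hR₂)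
  refine ODE_solution_unique (v := fun _ => g) (K := K) (fun _ => hK) h₁.continuousOn
    (fun t ht => ?_) h₂.continuousOn (fun t ht => ?_) h0
  · have := h₁.hasDerivWithinAt_Ici ht
    rwa [← hgG (Metric.closedBall_subset_closedBall (le_max_left _ _)
      (hm₁ t (Ico_subset_Icc_self ht)))] at this
  · have := h₂.hasDerivWithinAt_Ici ht
    rwa [← hgG (Metric.closedBall_subset_closedBall (le_max_right _ _)
      (hm₂ t (Ico_subset_Icc_self ht)))] at this

lemma IsTraj.eq {G : ℂ → ℂ} (hG : DifferentiableOn ℂ G disk) {γ₁ γ₂ : ℝ → ℂ}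
    (h₁ : IsTraj G γ₁) (h₂ : IsTraj G γ₂) (h0 : γ₁ 0 = γ₂ 0) {t : ℝ} (ht : 0 ≤ t) :
    γ₁ t = γ₂ t :=
  (h₁.isTrajOn t).eqOn hG (h₂.isTrajOn t) h0 ⟨ht, le_rfl⟩

lemma hasDerivAt_exp_barrier (a c t : ℝ) :
    HasDerivAt (fun t => 1 - a * Real.exp (-c * t)) (c * (a * Real.exp (-c * t))) t := by
  have h1 : HasDerivAt (fun t : ℝ => -c * t) (-c) t := by
    simpa using (hasDerivAt_id t).const_mul (-c)
  have := (h1.exp.const_mul a).const_sub 1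
  exact this.congr_deriv (by ring)

/-- Solutions exist on every interval `[0, T]` if the vector field does not push too fast towards
the boundary. -/
lemma exists_isTrajOn {G : ℂ → ℂ} (hG : DifferentiableOn ℂ G disk) {C : ℝ}
    (hC : ∀ z ∈ disk, (conj z * G z).re ≤ C * (1 - ‖z‖ ^ 2)) {z₀ : ℂ} (hz₀ : z₀ ∈ disk) {T : ℝ}
    (hT : 0 ≤ T) : ∃ γ : ℝ → ℂ, γ 0 = z₀ ∧ IsTrajOn G γ T := by
  -- The barrier `b` solves `b' = c (1 - b)` with `b 0 = ‖z₀‖ ^ 2`. As `c > 2C`, it grows strictly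
  -- faster than `‖γ‖ ^ 2` wherever the two touch, so `‖γ‖ ^ 2 ≤ b ≤ b T < 1` on `[0, T]`.
  set c : ℝ := 2 * (max C 0 + 1) with hc
  have hc0 : 0 < c := by have := le_max_right C 0; positivity
  have hcC : 2 * C < c := by have := le_max_left C 0; linarith
  set a : ℝ := 1 - ‖z₀‖ ^ 2 with ha
  have ha0 : 0 < a := by have := norm_sq_lt_one hz₀; linarith
  set b : ℝ → ℝ := fun t => 1 - a * Real.exp (-c * t) with hb
  have hb1 : ∀ t, b t < 1 := fun t => by
    have := mul_pos ha0 (Real.exp_pos (-c * t))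
    simp only [hb]; linarith
  have hbmono : ∀ t ∈ Icc 0 T, b t ≤ b T := fun t ht => by
    have : Real.exp (-c * T) ≤ Real.exp (-c * t) :=
      Real.exp_le_exp.2 (by nlinarith [ht.2])
    simp only [hb]
    nlinarith
  have hb0 : b 0 = ‖z₀‖ ^ 2 := by simp [hb, ha]
  have hbT : 0 ≤ b T := by
    have := hbmono 0 ⟨le_rfl, hT⟩
    rw [hb0] at this
    exact le_trans (sq_nonneg _) this
  have hR : Real.sqrt (b T) < 1 := by
    rw [Real.sqrt_lt' one_pos]; simpa using hb1 T
  obtain ⟨g, hgG, ⟨K, hK⟩, L, hL⟩ := exists_lipschitz_cutoff hG hR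
  -- The bound `L` on `g` is global, so a ball of radius `L * T` serves the whole interval and no
  -- continuation argument is needed.
  have hPL : IsPicardLindelof (fun _ : ℝ => g) (⟨0, le_rfl, hT⟩ : Icc (0 : ℝ) T) z₀
      (L * ⟨T, hT⟩) 0 L K := by
    refine ⟨fun _ _ => hK.lipschitzOnWith, fun _ _ => continuousOn_const, fun _ _ x _ => hL x, ?_⟩
    simp only [sub_zero, sub_self, NNReal.coe_zero, max_eq_left hT]
    exact le_rfl
  obtain ⟨γ, hγ0, hγ⟩ := hPL.exists_eq_forall_mem_Icc_hasDerivWithinAt₀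
  have hγ0 : γ 0 = z₀ := hγ0
  have hright : ∀ t ∈ Ico 0 T, HasDerivWithinAt γ (g (γ t)) (Ici t) t := fun t ht =>
    (hγ t (Ico_subset_Icc_self ht)).mono_of_mem_nhdsWithin (Icc_mem_nhdsGE_of_mem ht)
  have hcont : ContinuousOn γ (Icc 0 T) := fun t ht => (hγ t ht).continuousWithinAt
  have hball : ∀ t ∈ Icc 0 T, ‖γ t‖ ^ 2 ≤ b t → γ t ∈ Metric.closedBall (0 : ℂ) (√(b T)) := by
    intro t ht h
    rw [mem_closedBall_zero_iff]
    exact Real.le_sqrt_of_sq_le (h.trans (hbmono t ht))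
  have hbound : ∀ ⦃t⦄, t ∈ Icc 0 T → ‖γ t‖ ^ 2 ≤ b t := by
    refine image_le_of_deriv_right_lt_deriv_boundary (f := fun t => ‖γ t‖ ^ 2)
      (f' := fun t => 2 * inner ℝ (γ t) (g (γ t))) (hcont.norm.pow 2)
      (fun t ht => (hright t ht).norm_sq) (by rw [hγ0, hb0])
      (fun t => hasDerivAt_exp_barrier a c t) ?_
    intro t ht heq
    have hmem := hball t (Ico_subset_Icc_self ht) heq.le
    have hlt : ‖γ t‖ ^ 2 < 1 := by rw [heq]; exact hb1 t
    have hd : γ t ∈ disk := mem_disk.2 (by nlinarith [norm_nonneg (γ t)])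
    have h1 := hC _ hd
    rw [Complex.inner, hgG hmem, mul_comm (G (γ t))]
    have h2 : a * Real.exp (-c * t) = 1 - ‖γ t‖ ^ 2 := by rw [heq]; simp only [hb]; ring
    rw [h2]
    nlinarith
  refine ⟨γ, hγ0, fun t ht => ?_⟩
  have hmem := hball t ht (hbound ht)
  refine ⟨mem_disk.2 ((mem_closedBall_zero_iff.1 hmem).trans_lt hR), ?_⟩
  have := hγ t ht
  rwa [hgG hmem] at this

/-- A flow of `G` on the disk. -/
def IsFlow (G : ℂ → ℂ) (φ : ℝ → ℂ → ℂ) : Prop :=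
  ∀ z ∈ disk, φ 0 z = z ∧ IsTraj G fun t => φ t z

lemma exists_isFlow {G : ℂ → ℂ} (hG : DifferentiableOn ℂ G disk) {C : ℝ}
    (hC : ∀ z ∈ disk, (conj z * G z).re ≤ C * (1 - ‖z‖ ^ 2)) : ∃ φ, IsFlow G φ := by
  have hex : ∀ z : ℂ, ∀ T : ℝ, ∃ γ : ℝ → ℂ, z ∈ disk → 0 ≤ T → γ 0 = z ∧ IsTrajOn G γ T := by
    intro z T
    by_cases h : z ∈ disk ∧ 0 ≤ T
    · obtain ⟨γ, h1, h2⟩ := exists_isTrajOn hG hC h.1 h.2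
      exact ⟨γ, fun _ _ => ⟨h1, h2⟩⟩
    · exact ⟨fun _ => 0, fun h1 h2 => absurd ⟨h1, h2⟩ h⟩
  choose γ hγ using hex
  -- One solution is chosen for each horizon. Horizon `t + 1` leaves room to the right of `t`, and
  -- uniqueness identifies the solutions of different horizons on their common interval.
  refine ⟨fun t z => γ z (t + 1) t, fun z hz => ⟨(hγ z (0 + 1) hz (by norm_num)).1, ?_⟩⟩
  intro t ht
  have ht1 := hγ z (t + 1) hz (by linarith)
  have heq : ∀ s ∈ Icc 0 (t + 1), γ z (s + 1) s = γ z (t + 1) s := by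
    intro s hs
    have hs1 := hγ z (s + 1) hz (by linarith [hs.1])
    exact (hs1.2.mono (by linarith)).eqOn hG (ht1.2.mono hs.2) (hs1.1.trans ht1.1.symm)
      (T := s) ⟨hs.1, le_rfl⟩
  have htm : t ∈ Icc 0 (t + 1) := ⟨ht, by linarith⟩
  refine ⟨(ht1.2 t htm).1, ?_⟩
  have h1 := (ht1.2 t htm).2.congr heq (heq t htm)
  refine h1.mono_of_mem_nhdsWithin ?_
  filter_upwards [self_mem_nhdsWithin, nhdsWithin_le_nhds (Iio_mem_nhds (lt_add_one t))] with s h1 h2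
  exact ⟨h1, le_of_lt h2⟩

end DiskSemigroup

/-! ### Linearization of the flow, its holomorphy, and Berkson–Porta fields. -/

namespace DiskSemigroup

open Complex ComplexConjugate
open scoped NNReal

/-- If the vector field is, uniformly along the curve `p`, to first order
`p' t + κ t * (z - p t)`, then the flow expands at `p` by the factor `exp (∫ κ)`. -/
lemma IsFlow.tendsto_ratio {G : ℂ → ℂ} {φ : ℝ → ℂ → ℂ} (hφ : IsFlow G φ) {T : ℝ} (hT : 0 ≤ T)
    {p p' κ : ℝ → ℂ} (hp : ∀ t ∈ Icc 0 T, HasDerivWithinAt p (p' t) (Icc 0 T) t)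
    (hκ : Continuous κ)
    (hG : ∀ ε > 0, ∃ δ > 0, ∀ t ∈ Icc 0 T, ∀ z ∈ disk, ‖z - p t‖ < δ →
      ‖G z - p' t - κ t * (z - p t)‖ ≤ ε * ‖z - p t‖) :
    Tendsto (fun z => (φ T z - p T) / (z - p 0)) (𝓝[disk \ {p 0}] (p 0))
      (𝓝 (Complex.exp (∫ s in (0 : ℝ)..T, κ s))) := by
  set I : ℝ → ℂ := fun t => ∫ s in (0 : ℝ)..t, κ s with hI
  have hId : ∀ t, HasDerivAt I (κ t) t := fun t =>
    intervalIntegral.integral_hasDerivAt_right (hκ.intervalIntegrable _ _)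
      (hκ.stronglyMeasurableAtFilter _ _) hκ.continuousAt
  have hIc : Continuous I := continuous_iff_continuousAt.2 fun t => (hId t).continuousAt
  obtain ⟨A, hA⟩ := isCompact_Icc.exists_bound_of_continuousOn (s := Icc 0 T) hκ.continuousOn
  obtain ⟨B, hB⟩ := isCompact_Icc.exists_bound_of_continuousOn (s := Icc 0 T)
    (f := fun t => Complex.exp (-I t)) (by fun_prop)
  have hA0 : 0 ≤ A := (norm_nonneg _).trans (hA 0 ⟨le_rfl, hT⟩)
  have hB0 : 0 ≤ B := (norm_nonneg _).trans (hB 0 ⟨le_rfl, hT⟩)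
  -- The deviation `d` from the curve satisfies `‖d'‖ ≤ (A + ε) ‖d‖` with `ε ≤ 1`; one more unit
  -- makes the comparison strict.
  set M : ℝ := A + 2 with hM
  set E : ℝ := Real.exp (M * T) with hE
  have hE1 : 0 < E := Real.exp_pos _
  set D : ℝ := ‖Complex.exp (I T)‖ * (E * B * T) with hD
  have hD0 : 0 ≤ D := by positivity
  rw [Metric.tendsto_nhdsWithin_nhds]
  intro ε' hε'
  set ε : ℝ := min 1 (ε' / (2 * (D + 1))) with hε
  have hε0 : 0 < ε := lt_min one_pos (by positivity)
  have hε1 : ε ≤ 1 := min_le_left _ _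
  have hεD : D * ε < ε' := by
    have h1 : ε ≤ ε' / (2 * (D + 1)) := min_le_right _ _
    rw [le_div_iff₀ (by positivity)] at h1
    nlinarith
  obtain ⟨δ, hδ, hGδ⟩ := hG ε hε0
  refine ⟨δ / E, by positivity, fun z hz hdist => ?_⟩
  obtain ⟨hz, hzne⟩ := hz
  have hne : z - p 0 ≠ 0 := sub_ne_zero.2 hzne
  set η : ℝ := ‖z - p 0‖ with hη
  have hη0 : 0 < η := norm_pos_iff.2 hne
  have hηδ : η * E < δ := by rw [dist_eq_norm, lt_div_iff₀ hE1] at hdist; exact hdist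
  obtain ⟨hφ0, hφt⟩ := hφ z hz
  have htr := hφt.isTrajOn T
  have hgrow : ∀ t ∈ Icc 0 T, η * Real.exp (M * t) ≤ η * E := fun t ht => by
    have hM0 : 0 ≤ M := by linarith
    exact mul_le_mul_of_nonneg_left (Real.exp_le_exp.2 (mul_le_mul_of_nonneg_left ht.2 hM0)) hη0.le
  set d : ℝ → ℂ := fun t => φ t z - p t with hd
  have hdd : ∀ t ∈ Icc 0 T, HasDerivWithinAt d (G (φ t z) - p' t) (Icc 0 T) t := fun t ht =>
    (htr t ht).2.sub (hp t ht)
  have hdc : ContinuousOn d (Icc 0 T) := fun t ht => (hdd t ht).continuousWithinAt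
  -- A bootstrap: while this bound holds, `‖d t‖ ≤ η * E < δ`, so the first-order expansion of `G`
  -- applies and keeps the bound.
  have hbound : ∀ ⦃t⦄, t ∈ Icc 0 T → ‖d t‖ ≤ η * Real.exp (M * t) := by
    refine image_norm_le_of_norm_deriv_right_lt_deriv_boundary
      (f' := fun t => G (φ t z) - p' t) (B' := fun t => M * (η * Real.exp (M * t))) hdc
      (fun t ht => (hdd t (Ico_subset_Icc_self ht)).mono_of_mem_nhdsWithin
        (Icc_mem_nhdsGE_of_mem ht)) ?_ (fun t => ?_) ?_
    · simp [hd, hφ0, hη]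
    · have h1 : HasDerivAt (fun t : ℝ => M * t) M t := by
        simpa using (hasDerivAt_id t).const_mul M
      exact (h1.exp.const_mul η).congr_deriv (by ring)
    · intro t ht heq
      have ht' := Ico_subset_Icc_self ht
      have h1 : ‖φ t z - p t‖ < δ := by
        change ‖d t‖ < δ
        rw [heq]
        exact (hgrow t ht').trans_lt hηδ
      have h2 := hGδ t ht' _ (htr t ht').1 h1
      have h3 : ‖κ t * d t‖ ≤ A * ‖d t‖ := by
        rw [norm_mul]; exact mul_le_mul_of_nonneg_right (hA t ht') (norm_nonneg _)
      have h4 : ‖G (φ t z) - p' t‖ ≤ ‖G (φ t z) - p' t - κ t * d t‖ + ‖κ t * d t‖ := by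
        simpa using norm_add_le (G (φ t z) - p' t - κ t * d t) (κ t * d t)
      have h5 : 0 < ‖d t‖ := by rw [heq]; positivity
      rw [← heq]
      change ‖G (φ t z) - p' t - κ t * d t‖ ≤ ε * ‖d t‖ at h2
      nlinarith
  -- The integrating factor `exp (-I)` removes the linear term; what remains has size at most `ε *
  -- (η * E) * B`, which is small compared with `η`.
  have hEd : ∀ t ∈ Icc 0 T, HasDerivWithinAt (fun t => d t * Complex.exp (-I t))
      ((G (φ t z) - p' t - κ t * d t) * Complex.exp (-I t)) (Icc 0 T) t := by
    intro t ht
    have := (hdd t ht).mul (hId t).neg.cexp.hasDerivWithinAt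
    exact this.congr_deriv (by simp only [Pi.neg_apply]; ring)
  have hmv := norm_image_sub_le_of_norm_deriv_le_segment' (C := ε * (η * E) * B) hEd
    (fun t ht => by
      have ht' := Ico_subset_Icc_self ht
      have h1 := (hbound ht').trans (hgrow t ht')
      have h2 := hGδ t ht' _ (htr t ht').1 (h1.trans_lt hηδ)
      rw [norm_mul]
      refine mul_le_mul (h2.trans ?_) (hB t ht') (norm_nonneg _) (by positivity)
      exact mul_le_mul_of_nonneg_left h1 hε0.le) T ⟨hT, le_rfl⟩
  have hI0 : I 0 = 0 := by simp [hI]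
  have hd0 : d 0 = z - p 0 := by simp [hd, hφ0]
  simp only [hI0, neg_zero, Complex.exp_zero, mul_one, sub_zero, hd0] at hmv
  have hid : (φ T z - p T) / (z - p 0) - Complex.exp (I T) =
      Complex.exp (I T) * (d T * Complex.exp (-I T) - (z - p 0)) / (z - p 0) := by
    have h1 : Complex.exp (I T) * Complex.exp (-I T) = 1 := by rw [← Complex.exp_add]; simp
    have h2 : d T = φ T z - p T := rfl
    rw [div_sub' hne, h2]
    congr 1
    linear_combination -(φ T z - p T) * h1
  rw [dist_eq_norm]
  change ‖(φ T z - p T) / (z - p 0) - Complex.exp (I T)‖ < ε'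
  rw [hid, norm_div, norm_mul]
  rw [div_lt_iff₀ hη0]
  calc ‖Complex.exp (I T)‖ * ‖d T * Complex.exp (-I T) - (z - p 0)‖
      ≤ ‖Complex.exp (I T)‖ * (ε * (η * E) * B * T) := by gcongr
    _ = D * ε * η := by rw [hD]; ring
    _ < ε' * η := by gcongr

/-- The flow near a (possibly boundary) zero `p` of `G`. -/
lemma IsFlow.tendsto_ratio_of_tendsto {G : ℂ → ℂ} {φ : ℝ → ℂ → ℂ} (hφ : IsFlow G φ) {p κ : ℂ}
    (hp : p ∈ disk → G p = 0)
    (hG : Tendsto (fun z => G z / (z - p)) (𝓝[disk \ {p}] p) (𝓝 κ)) {T : ℝ} (hT : 0 ≤ T) :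
    Tendsto (fun z => (φ T z - p) / (z - p)) (𝓝[disk \ {p}] p) (𝓝 (Complex.exp (κ * T))) := by
  have := hφ.tendsto_ratio hT (p := fun _ => p) (p' := fun _ => 0) (κ := fun _ => κ)
    (fun t _ => hasDerivWithinAt_const _ _ _) continuous_const ?_
  · simpa [mul_comm κ] using this
  · intro ε hε
    rw [Metric.tendsto_nhdsWithin_nhds] at hG
    obtain ⟨δ, hδ, h⟩ := hG ε hε
    refine ⟨δ, hδ, fun t _ z hz hzδ => ?_⟩
    by_cases hzp : z = p
    · subst hzp; simp [hp hz]
    · have h1 := h ⟨hz, hzp⟩ (by rwa [dist_eq_norm])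
      have hne : z - p ≠ 0 := sub_ne_zero.2 hzp
      rw [dist_eq_norm, div_sub' hne, norm_div, div_lt_iff₀ (norm_pos_iff.2 hne)] at h1
      rw [sub_zero, mul_comm κ]
      exact h1.le

/-- A holomorphic function is uniformly differentiable on compact subsets of the disk. -/
lemma uniform_differentiability {G : ℂ → ℂ} (hG : DifferentiableOn ℂ G disk) {R : ℝ}
    (hR : R < 1) {ε : ℝ} (hε : 0 < ε) : ∃ δ > 0, ∀ w ∈ Metric.closedBall (0 : ℂ) R, ∀ z,
      ‖z - w‖ < δ → ‖G z - G w - deriv G w * (z - w)‖ ≤ ε * ‖z - w‖ := by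
  set R' : ℝ := (R + 1) / 2 with hR'
  have hsub : Metric.closedBall (0 : ℂ) R' ⊆ disk := fun z hz => by
    rw [mem_closedBall_zero_iff] at hz
    exact mem_disk.2 (hz.trans_lt (by linarith))
  have huc := (isCompact_closedBall (0 : ℂ) R').uniformContinuousOn_of_continuous
    ((hG.deriv isOpen_disk).continuousOn.mono hsub)
  rw [Metric.uniformContinuousOn_iff] at huc
  obtain ⟨δ, hδ, h⟩ := huc ε hε
  refine ⟨min δ (R' - R), lt_min hδ (by linarith), fun w hw z hz => ?_⟩
  have hwR := mem_closedBall_zero_iff.1 hw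
  have hball : ∀ x ∈ Metric.ball w (min δ (R' - R)), x ∈ Metric.closedBall (0 : ℂ) R' := by
    intro x hx
    rw [Metric.mem_ball, dist_eq_norm] at hx
    have h1 : ‖x‖ ≤ ‖x - w‖ + ‖w‖ := by simpa using norm_add_le (x - w) w
    have h2 := hx.trans_le (min_le_right _ _)
    rw [mem_closedBall_zero_iff]
    linarith
  have hw' : w ∈ Metric.ball w (min δ (R' - R)) :=
    Metric.mem_ball_self (lt_min hδ (by linarith))
  have hz' : z ∈ Metric.ball w (min δ (R' - R)) := by rwa [Metric.mem_ball, dist_eq_norm]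
  -- Mean value inequality for `x ↦ G x - G'(w) x`, whose derivative is small by uniform continuity
  -- of `G'` on a slightly larger closed ball.
  have := (convex_ball w (min δ (R' - R))).norm_image_sub_le_of_norm_hasDerivWithin_le
    (f := fun x => G x - deriv G w * x) (f' := fun x => deriv G x - deriv G w) (C := ε)
    (fun x hx => ?_) (fun x hx => ?_) hw' hz'
  · refine le_trans (le_of_eq ?_) this
    congr 1; ring
  · have h1 := (hG.differentiableAt (disk_mem_nhds (hsub (hball x hx)))).hasDerivAt
    have h2 : HasDerivAt (fun x => deriv G w * x) (deriv G w) x := by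
      simpa using (hasDerivAt_id x).const_mul (deriv G w)
    exact (h1.sub h2).hasDerivWithinAt
  · have h1 := h x (hball x hx) w (hball w hw')
      ((Metric.mem_ball.1 hx).trans_le (min_le_left _ _))
    rw [dist_eq_norm] at h1
    exact h1.le

/-- Linearizing along the orbit of `z₀` shows that the derivative of `φ T` at `z₀` is the
exponential of the integral of `G'` along the orbit. -/
lemma IsFlow.differentiableOn {G : ℂ → ℂ} (hG : DifferentiableOn ℂ G disk) {φ : ℝ → ℂ → ℂ}
    (hφ : IsFlow G φ) {T : ℝ} (hT : 0 ≤ T) : DifferentiableOn ℂ (φ T) disk := by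
  intro z₀ hz₀
  obtain ⟨h0, htr⟩ := hφ z₀ hz₀
  have htr' := htr.isTrajOn T
  obtain ⟨R, -, hR, hm⟩ := htr'.exists_closedBall
  -- The coefficient `κ` has to be continuous on all of `ℝ`, while the flow is controlled only for
  -- `t ≥ 0`; hence `max t 0`.
  have hc : Continuous fun t : ℝ => deriv G (φ (max t 0) z₀) := by
    have h1 : ContinuousOn (fun t : ℝ => φ t z₀) (Ici 0) := fun t ht =>
      (htr t ht).2.continuousWithinAt
    have h2 : Continuous fun t : ℝ => φ (max t 0) z₀ :=
      h1.comp_continuous (by fun_prop) fun t => mem_Ici.2 (le_max_right _ _)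
    exact (hG.deriv isOpen_disk).continuousOn.comp_continuous h2
      fun t => (htr _ (le_max_right _ _)).1
  have := hφ.tendsto_ratio hT (p := fun t => φ t z₀) (p' := fun t => G (φ t z₀))
    (κ := fun t => deriv G (φ (max t 0) z₀)) (fun t ht => (htr' t ht).2) hc ?_
  · have h2 : HasDerivWithinAt (φ T) (Complex.exp (∫ s in (0 : ℝ)..T, deriv G (φ (max s 0) z₀)))
        disk z₀ := by
      rw [hasDerivWithinAt_iff_tendsto_slope]
      simp only [h0] at this
      refine this.congr fun z => ?_
      rw [slope_def_field]
    exact h2.differentiableWithinAt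
  · intro ε hε
    obtain ⟨δ, hδ, h⟩ := uniform_differentiability hG hR hε
    refine ⟨δ, hδ, fun t ht z _ hz => ?_⟩
    rw [max_eq_left ht.1]
    exact h _ (hm t ht) z hz

lemma IsFlow.generates {G : ℂ → ℂ} (hG : DifferentiableOn ℂ G disk) {φ : ℝ → ℂ → ℂ}
    (hφ : IsFlow G φ) : Generates G φ where
  holo := hG
  flow z hz t ht := ((hφ z hz).2 t ht).2
  semigroup :=
    { holo := fun t ht => hφ.differentiableOn hG ht
      mapsTo := fun t ht z hz => ((hφ z hz).2 t ht).1
      zero := fun z hz => (hφ z hz).1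
      add := by
        intro s t hs ht z hz
        have hw := ((hφ z hz).2 t ht).1
        -- The semigroup law is uniqueness for the autonomous equation: the time-shifted trajectory
        -- is again a trajectory.
        have h1 : IsTraj G fun s => φ (s + t) z := by
          intro s hs
          have h2 := (hφ z hz).2 (s + t) (by linarith)
          refine ⟨h2.1, ?_⟩
          have h3 : HasDerivWithinAt (fun s : ℝ => s + t) 1 (Ici 0) s :=
            ((hasDerivAt_id s).add_const t).hasDerivWithinAt
          have h4 := h2.2.scomp s h3 (fun x hx => by simp only [mem_Ici] at *; linarith)
          simpa using! h4
        exact h1.eq hG (hφ _ hw).2 (by simp [(hφ _ hw).1]) hs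
      cont := by
        intro z hz
        have h1 := ((hφ z hz).2 0 le_rfl).2.continuousWithinAt.tendsto
        simp only [(hφ z hz).1] at h1
        exact h1.mono_left (nhdsWithin_mono _ Ioi_subset_Ici_self) }

lemma Generates.isFlow {G : ℂ → ℂ} {φ : ℝ → ℂ → ℂ} (h : Generates G φ) : IsFlow G φ :=
  fun z hz => ⟨h.semigroup.zero z hz, fun t ht => ⟨h.semigroup.mapsTo t ht hz, h.flow z hz t ht⟩⟩

lemma IsFlow.eqOn {G : ℂ → ℂ} (hG : DifferentiableOn ℂ G disk) {φ ψ : ℝ → ℂ → ℂ}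
    (hφ : IsFlow G φ) (hψ : IsFlow G ψ) {t : ℝ} (ht : 0 ≤ t) : EqOn (φ t) (ψ t) disk :=
  fun z hz => (hφ z hz).2.eq hG (hψ z hz).2 ((hφ z hz).1.trans (hψ z hz).1.symm) ht

lemma IsFlow.apply_eq_self {G : ℂ → ℂ} (hG : DifferentiableOn ℂ G disk) {φ : ℝ → ℂ → ℂ}
    (hφ : IsFlow G φ) {z : ℂ} (hz : z ∈ disk) (h0 : G z = 0) {t : ℝ} (ht : 0 ≤ t) : φ t z = z := by
  refine (hφ z hz).2.eq hG (γ₂ := fun _ => z) (fun s _ => ⟨hz, ?_⟩) (hφ z hz).1 ht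
  rw [h0]
  exact hasDerivWithinAt_const _ _ _

lemma IsFlow.eq_zero {G : ℂ → ℂ} {φ : ℝ → ℂ → ℂ} (hφ : IsFlow G φ) {z : ℂ} (hz : z ∈ disk)
    (h : ∀ t, 0 ≤ t → φ t z = z) : G z = 0 := by
  have h1 := ((hφ z hz).2 0 le_rfl).2
  have h2 : HasDerivWithinAt (fun t => φ t z) 0 (Ici 0) 0 :=
    (hasDerivWithinAt_const (0 : ℝ) (Ici 0) z).congr (fun t ht => h t ht) (h 0 le_rfl)
  have h3 := (uniqueDiffOn_Ici (0 : ℝ) 0 self_mem_Ici).eq_deriv _ h1 h2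
  simpa only [(hφ z hz).1] using h3

/-- Vector fields of Berkson-Porta form do not push too fast towards the boundary. -/
lemma exists_re_conj_mul_le {τ : ℂ} (hτ : ‖τ‖ ≤ 1) {q : ℂ → ℂ} (hq : DifferentiableOn ℂ q disk)
    (hre : ∀ z ∈ disk, 0 ≤ (q z).re) : ∃ C : ℝ, ∀ z ∈ disk,
      (conj z * ((τ - z) * (1 - conj τ * z) * q z)).re ≤ C * (1 - ‖z‖ ^ 2) := by
  -- In the notation below, the terms `e * s * X` and `e * y * (Y - Y0)` each cost at most `A * X /
  -- 2 + 2 * e * X0`. The two halves of `A * X` are absorbed by `-A * X`, and `e * y * Y0` costs `e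
  -- * |Y0|`.
  refine ⟨4 * (q 0).re + |(q 0).im|, fun z hz => ?_⟩
  have hX0 := hre 0 zero_mem_disk
  have hX := hre z hz
  have hz1 := norm_sq_lt_one hz
  have hτ1 : ‖τ‖ ^ 2 ≤ 1 := by nlinarith [norm_nonneg τ]
  have hsp := schwarz_pick_halfPlane_sq hq hre hz zero_mem_disk
  have hh := harnack hq hre zero_mem_disk hz
  simp only [map_zero, zero_mul, mul_zero, sub_zero, norm_one, norm_zero, one_pow, mul_one, ne_eq,
    OfNat.ofNat_ne_zero, not_false_eq_true, zero_pow, one_mul] at hsp hh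
  set e : ℝ := 1 - ‖z‖ ^ 2 with he
  set X := (q z).re
  set Y := (q z).im
  set X0 := (q 0).re
  set Y0 := (q 0).im
  set A : ℝ := ‖z - τ‖ ^ 2 with hA
  set y : ℝ := (conj τ * z).im with hy
  have he0 : 0 < e := by linarith
  have hA0 : 0 ≤ A := by positivity
  have hYY : e * (Y - Y0) ^ 2 ≤ 4 * X * X0 := by
    refine le_trans ?_ hsp
    refine mul_le_mul_of_nonneg_left ?_ he0.le
    rw [norm_sq_eq]
    simp only [add_re, add_im, conj_re, conj_im]
    change (Y - Y0) ^ 2 ≤ (X + X0) ^ 2 + (Y + -Y0) ^ 2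
    nlinarith [sq_nonneg (X + X0)]
  have hyA : y ^ 2 ≤ A := by
    have h1 : y = (conj τ * (z - τ)).im := by
      simp only [hy, mul_im, sub_re, sub_im, conj_re, conj_im]; ring
    have h2 : |y| ≤ ‖conj τ * (z - τ)‖ := by rw [h1]; exact Complex.abs_im_le_norm _
    rw [norm_mul, RCLike.norm_conj] at h2
    have h3 : |y| ^ 2 ≤ (‖τ‖ * ‖z - τ‖) ^ 2 := pow_le_pow_left₀ (abs_nonneg _) h2 2
    rw [sq_abs, mul_pow] at h3
    nlinarith
  have hy1 : |y| ≤ 1 := by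
    refine (Complex.abs_im_le_norm _).trans ?_
    rw [norm_mul, RCLike.norm_conj]
    nlinarith [norm_nonneg τ, norm_nonneg z, (mem_disk.1 hz)]
  set s : ℝ := ‖τ‖ ^ 2 - (conj τ * z).re with hs
  have hid : (conj z * ((τ - z) * (1 - conj τ * z) * q z)).re = (-A + e * s) * X + e * y * Y := by
    simp only [hs, hA, he, hy, norm_sq_eq, X, Y, sub_re, sub_im, mul_re, mul_im, conj_re, conj_im,
      one_re, one_im]
    ring
  have hsA : s ≤ (e + A) / 2 := by
    have : A = ‖z‖ ^ 2 + ‖τ‖ ^ 2 - 2 * (conj τ * z).re := by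
      simp only [hA, norm_sq_eq, sub_re, sub_im, mul_re, conj_re, conj_im]
      ring
    linarith
  -- AM–GM, after bounding the oscillation of `Im q` by Schwarz–Pick and `y ^ 2` by `A`.
  have hv : e * y * (Y - Y0) ≤ A * X / 2 + 2 * e * X0 := by
    refine le_trans (le_abs_self _) (abs_le_of_sq_le_sq ?_ (by positivity))
    have h1 : (e * y * (Y - Y0)) ^ 2 = (e * y ^ 2) * (e * (Y - Y0) ^ 2) := by ring
    have h2 : (e * y ^ 2) * (e * (Y - Y0) ^ 2) ≤ (e * A) * (4 * X * X0) := by gcongr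
    rw [h1]
    nlinarith [sq_nonneg (A * X / 2 - 2 * e * X0)]
  have hyY : e * y * Y0 ≤ e * |Y0| := by
    have : y * Y0 ≤ |Y0| := by
      refine (le_abs_self _).trans ?_
      rw [abs_mul]
      nlinarith [abs_nonneg Y0]
    nlinarith
  rw [hid]
  have h1 : e * s * X ≤ e * ((e + A) / 2) * X := by gcongr
  have h2 : e * (e * X) ≤ e * (4 * X0) := by gcongr
  have h3 : e * (A * X) ≤ 1 * (A * X) := by
    refine mul_le_mul_of_nonneg_right ?_ (by positivity)
    have := sq_nonneg ‖z‖
    linarith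
  nlinarith

end DiskSemigroup

/-! ### Boundary fixed points of self-maps and the half-plane function of a self-map. -/

namespace DiskSemigroup

open Complex ComplexConjugate

lemma radius_mem_stolz {σ : ℂ} (hσ : ‖σ‖ = 1) {ρ : ℝ} (h : ρ ∈ Ioo (0 : ℝ) 1) :
    (ρ : ℂ) * σ ∈ stolz σ 1 := by
  refine ⟨radius_mem_disk hσ h, ?_⟩
  have h1 : (ρ : ℂ) * σ - σ = ((ρ - 1 : ℝ) : ℂ) * σ := by push_cast; ring
  rw [norm_ofReal_mul hσ h.1.le, h1, norm_mul, hσ, Complex.norm_real, Real.norm_eq_abs, one_mul,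
    mul_one, abs_of_nonpos (by linarith [h.2])]
  linarith

lemma tendsto_radius_stolz {σ : ℂ} (hσ : ‖σ‖ = 1) :
    Tendsto (fun ρ : ℝ => (ρ : ℂ) * σ) (𝓝[<] 1) (𝓝[stolz σ 1] σ) := by
  refine tendsto_nhdsWithin_iff.2 ⟨tendsto_radius σ, ?_⟩
  filter_upwards [Ioo_mem_nhdsLT_one] with ρ hρ using radius_mem_stolz hσ hρ

lemma HasAngularLimit.radius {f : ℂ → ℂ} {σ L : ℂ} (h : HasAngularLimit f σ L) (hσ : ‖σ‖ = 1) :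
    Tendsto (fun ρ : ℝ => f (ρ * σ)) (𝓝[<] 1) (𝓝 L) :=
  (h 1).comp (tendsto_radius_stolz hσ)

lemma HasAngularLimit.of_tendsto {f : ℂ → ℂ} {σ L : ℂ} (h : Tendsto f (𝓝[disk] σ) (𝓝 L)) :
    HasAngularLimit f σ L :=
  fun _ => h.mono_left (nhdsWithin_mono _ fun _ hz => hz.1)

lemma HasMultiplier.isBRFPWith {f : ℂ → ℂ} {σ d : ℂ} (hσ : ‖σ‖ = 1) (h : HasMultiplier f σ d) :
    IsBRFPWith f σ d := by
  rcases h with h | h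
  · exact absurd hσ (mem_disk.1 h.1).ne
  · exact h

lemma ofReal_sub_one_mul {ρ : ℝ} (σ : ℂ) : (ρ : ℂ) * σ - σ = -((1 - ρ : ℝ) * σ) := by
  push_cast; ring

lemma mul_conj_of_norm_eq_one {σ : ℂ} (hσ : ‖σ‖ = 1) : σ * conj σ = 1 := by
  rw [Complex.mul_conj, Complex.normSq_eq_norm_sq, hσ]; simp

lemma ne_zero_of_norm_eq_one {σ : ℂ} (hσ : ‖σ‖ = 1) : σ ≠ 0 := by rintro rfl; simp at hσ

lemma IsBRFPWith.tendsto_sub_div {f : ℂ → ℂ} {σ d : ℂ} (h : IsBRFPWith f σ d) :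
    Tendsto (fun ρ : ℝ => (σ - f (ρ * σ)) / (1 - ρ : ℝ)) (𝓝[<] 1) (𝓝 (σ * d)) := by
  have h1 := (h.angular_deriv.radius h.norm_eq_one).const_mul σ
  refine h1.congr' ?_
  filter_upwards [Ioo_mem_nhdsLT_one] with ρ hρ
  have h2 : ((1 - ρ : ℝ) : ℂ) ≠ 0 := by
    rw [Complex.ofReal_ne_zero]; linarith [hρ.2]
  have h3 := ne_zero_of_norm_eq_one h.norm_eq_one
  rw [ofReal_sub_one_mul]
  field_simp
  ring

lemma tendsto_mul_cayley_comp {f : ℂ → ℂ} {σ d : ℂ} (h : IsBRFPWith f σ d) (hd : d ≠ 0) :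
    Tendsto (fun ρ : ℝ => ((1 - ρ : ℝ) : ℂ) * cayley σ (f (ρ * σ))) (𝓝[<] 1) (𝓝 (2 / d)) := by
  have hσ0 := ne_zero_of_norm_eq_one h.norm_eq_one
  have h1 := (h.fixed.radius h.norm_eq_one).const_add σ
  have h2 := h1.div h.tendsto_sub_div (mul_ne_zero hσ0 hd)
  have h3 : (σ + σ) / (σ * d) = 2 / d := by field_simp; ring
  rw [h3] at h2
  refine h2.congr fun ρ => ?_
  rw [Pi.div_apply, cayley, div_div_eq_mul_div, mul_comm, mul_div_assoc]

lemma differentiableOn_cayley_comp {f : ℂ → ℂ} {σ : ℂ} (hσ : ‖σ‖ = 1)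
    (hf : DifferentiableOn ℂ f disk) (hm : MapsTo f disk disk) :
    DifferentiableOn ℂ (fun z => cayley σ (f z)) disk :=
  (differentiableOn_cayley hσ).comp hf hm

/-- Julia's lemma at a boundary regular fixed point. -/
lemma julia {f : ℂ → ℂ} (hf : DifferentiableOn ℂ f disk) (hm : MapsTo f disk disk) {σ : ℂ} {d : ℝ}
    (h : IsBRFPWith f σ d) :
    0 < d ∧ ∀ z ∈ disk, (cayley σ z).re ≤ d * (cayley σ (f z)).re := by
  have hσ := h.norm_eq_one
  have hu := differentiableOn_cayley_comp hσ hf hm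
  have hre : ∀ z ∈ disk, 0 ≤ (cayley σ (f z)).re := fun z hz => (cayley_re_pos hσ (hm hz)).le
  -- If `d = 0`, the growth bound for `cayley σ ∘ f` bounds `‖σ + f (ρ * σ)‖` by a quantity tending
  -- to 0, whereas it tends to 2.
  have hd0 : d ≠ 0 := by
    rintro rfl
    have h1 : ∀ᶠ ρ : ℝ in 𝓝[<] 1, ‖σ + f (ρ * σ)‖ ≤
        2 * ‖cayley σ (f 0)‖ * ‖(σ - f (ρ * σ)) / (1 - ρ : ℝ)‖ := by
      filter_upwards [Ioo_mem_nhdsLT_one] with ρ hρ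
      have h2 := norm_le_of_re_nonneg hu hre (radius_mem_disk hσ hρ)
      have h3 := norm_pos_iff.2 (sub_ne_zero_of_norm_eq_one hσ (hm (radius_mem_disk hσ hρ)))
      have h4 : 0 < 1 - ρ := by linarith [hρ.2]
      rw [norm_ofReal_mul hσ hρ.1.le, cayley, norm_div, mul_div_assoc', div_le_iff₀ h3] at h2
      rw [norm_div, Complex.norm_real, Real.norm_of_nonneg h4.le, mul_div_assoc', le_div_iff₀ h4]
      linarith
    have h2 := le_of_tendsto_of_tendsto ((h.fixed.radius hσ).const_add σ).norm
      (h.tendsto_sub_div.norm.const_mul _) h1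
    rw [← two_mul, norm_mul, hσ] at h2
    norm_num at h2
  -- The function `cayley σ ∘ f` has point mass `d⁻¹` at `σ`.
  have hlim : Tendsto (fun ρ : ℝ => (1 - ρ) * (cayley σ (f (ρ * σ))).re) (𝓝[<] 1)
      (𝓝 (2 * d⁻¹)) := by
    have h1 := (Complex.continuous_re.tendsto _).comp
      (tendsto_mul_cayley_comp h (Complex.ofReal_ne_zero.2 hd0))
    have h2 : (2 / (d : ℂ)).re = 2 * d⁻¹ := by
      rw [← div_eq_mul_inv, ← Complex.ofReal_ofNat, ← Complex.ofReal_div, Complex.ofReal_re]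
    rw [h2] at h1
    refine h1.congr fun ρ => ?_
    simp only [Function.comp_apply, Complex.re_ofReal_mul]
  have hdpos : 0 < d := by
    have h1 : 0 ≤ 2 * d⁻¹ := by
      refine ge_of_tendsto hlim ?_
      filter_upwards [Ioo_mem_nhdsLT_one] with ρ hρ
      exact mul_nonneg (by linarith [hρ.2]) (hre _ (radius_mem_disk hσ hρ))
    have h2 : 0 ≤ d⁻¹ := by linarith
    exact lt_of_le_of_ne (inv_nonneg.1 h2) hd0.symm
  refine ⟨hdpos, fun z hz => ?_⟩
  have h1 := re_ge_of_tendsto_radius hu hre hσ hlim hz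
  rw [inv_mul_le_iff₀ hdpos] at h1
  exact h1

lemma re_inv_nonneg {z : ℂ} (h : 0 ≤ z.re) : 0 ≤ (z⁻¹).re := by
  rw [Complex.inv_re]
  exact div_nonneg h (Complex.normSq_nonneg _)

lemma one_sub_norm_sq_eq (τ : ℂ) : ((1 - ‖τ‖ ^ 2 : ℝ) : ℂ) = 1 - conj τ * τ := by
  rw [mul_comm, Complex.mul_conj, Complex.normSq_eq_norm_sq]; push_cast; rfl

/-- Dividing the Möbius image of `f z` by that of `z`, both centred at `τ`, gives `g` with `|g| ≤ 1`
by Schwarz–Pick, and `H = (1 - |τ|²)(1 + g)/(1 - g)`. By rigidity `g = 1` at one point would force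
`f = id`. -/
lemma exists_halfPlane_of_fixed {f : ℂ → ℂ} (hf : DifferentiableOn ℂ f disk)
    (hm : MapsTo f disk disk) {τ : ℂ} (hτ : τ ∈ disk) (hfix : f τ = τ) (hid : ¬ EqOn f id disk) :
    ∃ H : ℂ → ℂ, DifferentiableOn ℂ H disk ∧ (∀ z ∈ disk, 0 ≤ (H z).re) ∧
      ∀ z ∈ disk, H z * (z - f z) = (z - τ) * (1 - conj τ * f z) + (f z - τ) * (1 - conj τ * z) := by
  set D : ℂ → ℂ := dslope f τ with hD
  have hDd : DifferentiableOn ℂ D disk :=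
    (Complex.differentiableOn_dslope (disk_mem_nhds hτ)).2 hf
  have hDf : ∀ z, (z - τ) * D z = f z - τ := fun z => by
    simpa [hfix] using sub_smul_dslope f τ z
  have hA0 : ∀ z ∈ disk, 1 - conj τ * f z ≠ 0 := fun z hz =>
    one_sub_conj_mul_ne_zero (mem_disk.1 hτ).le (mem_disk.1 (hm hz))
  have hcont : ContinuousOn (fun z => ‖D z * (1 - conj τ * z)‖) disk := by
    have := hDd.continuousOn
    fun_prop
  have hcont' : ContinuousOn (fun z => ‖1 - conj τ * f z‖) disk := by
    have := hf.continuousOn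
    fun_prop
  have hne : ∀ z ∈ disk, z ≠ τ → ‖D z * (1 - conj τ * z)‖ ≤ ‖1 - conj τ * f z‖ := by
    intro z hz hzτ
    have h1 := schwarz_pick hf hm hz hτ
    rw [hfix, ← hDf z, norm_mul, mul_assoc] at h1
    rw [norm_mul]
    exact le_of_mul_le_mul_left h1 (norm_pos_iff.2 (sub_ne_zero.2 hzτ))
  -- At `z = τ` the factor `z - τ` cannot be cancelled; the inequality passes there by continuity.
  have hle : ∀ z ∈ disk, ‖D z * (1 - conj τ * z)‖ ≤ ‖1 - conj τ * f z‖ := by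
    intro z hz
    by_cases hzτ : z = τ
    · subst hzτ
      have hnhds := disk_mem_nhds hz
      refine le_of_tendsto_of_tendsto (b := 𝓝[≠] z)
        ((hcont.continuousAt hnhds).tendsto.mono_left nhdsWithin_le_nhds)
        ((hcont'.continuousAt hnhds).tendsto.mono_left nhdsWithin_le_nhds) ?_
      filter_upwards [self_mem_nhdsWithin, nhdsWithin_le_nhds hnhds] with x hx hxd
        using hne x hxd hx
    · exact hne z hz hzτ
  set g : ℂ → ℂ := fun z => D z * (1 - conj τ * z) / (1 - conj τ * f z) with hg
  have hgd : DifferentiableOn ℂ g disk := DifferentiableOn.div (by fun_prop) (by fun_prop) hA0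
  have hg1 : ∀ z ∈ disk, ‖g z‖ ≤ 1 := fun z hz => by
    rw [hg]
    simp only
    rw [norm_div, div_le_one (norm_pos_iff.2 (hA0 z hz))]
    exact hle z hz
  have hAB : ∀ z ∈ disk, (1 - g z) * (1 - conj τ * f z) = (1 - D z) * (1 - conj τ * τ) := by
    intro z hz
    have h1 : g z * (1 - conj τ * f z) = D z * (1 - conj τ * z) := div_mul_cancel₀ _ (hA0 z hz)
    linear_combination -h1 + conj τ * hDf z
  have hττ : 1 - conj τ * τ ≠ 0 := one_sub_conj_mul_ne_zero (mem_disk.1 hτ).le (mem_disk.1 hτ)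
  have hgne : ∀ z ∈ disk, 1 - g z ≠ 0 := by
    intro z₀ hz₀ h0
    refine hid fun z hz => ?_
    have h1 := eqOn_const_of_re_eq_zero (h := fun z => 1 - g z) (by fun_prop)
      (fun z hz => by
        have := (Complex.re_le_norm (g z)).trans (hg1 z hz)
        simpa using this) hz₀ (by simp [h0]) z hz
    have h2 := hAB z hz
    simp only [h0] at h1
    rw [h1, zero_mul] at h2
    have h3 : 1 - D z = 0 := (mul_eq_zero.1 h2.symm).resolve_right hττ
    have h4 := hDf z
    rw [← sub_eq_zero.1 h3, mul_one] at h4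
    exact (sub_left_inj.1 h4).symm
  refine ⟨fun z => (1 - conj τ * τ) * cayley 1 (g z), ?_, fun z hz => ?_, fun z hz => ?_⟩
  · refine DifferentiableOn.const_mul ?_ _
    exact DifferentiableOn.div (by fun_prop) (by fun_prop) hgne
  · rw [← one_sub_norm_sq_eq, Complex.re_ofReal_mul, cayley_re]
    have := norm_sq_lt_one hτ
    have := hg1 z hz
    refine mul_nonneg (by linarith) (div_nonneg ?_ (sq_nonneg _))
    rw [norm_one]
    nlinarith [norm_nonneg (g z)]
  · have h1 : g z * (1 - conj τ * f z) = D z * (1 - conj τ * z) := div_mul_cancel₀ _ (hA0 z hz)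
    have h2 := hAB z hz
    change (1 - conj τ * τ) * ((1 + g z) / (1 - g z)) * (z - f z) = _
    rw [mul_div_assoc', div_mul_eq_mul_div, div_eq_iff (hgne z hz)]
    have h3 : z - f z = (z - τ) * (1 - D z) := by linear_combination hDf z
    rw [h3]
    linear_combination (z - τ) * (1 + g z) * (-h2) + (z - τ) * (1 - g z) * h1 +
      (1 - conj τ * z) * (1 - g z) * hDf z

/-- With `d ≤ 1`, Julia's lemma says that `f` does not decrease `Re (cayley τ)`, so the increment
`W` has nonnegative real part. It has no zeros because `f` has no fixed points, and `H = 4 / W`. -/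
lemma exists_halfPlane_of_boundary {f : ℂ → ℂ} (hf : DifferentiableOn ℂ f disk)
    (hm : MapsTo f disk disk) {τ : ℂ} (hne : ∀ z ∈ disk, f z ≠ z) {d : ℝ} (hd : d ≤ 1)
    (h : IsBRFPWith f τ d) :
    ∃ H : ℂ → ℂ, DifferentiableOn ℂ H disk ∧ (∀ z ∈ disk, 0 ≤ (H z).re) ∧
      ∀ z ∈ disk, H z * (z - f z) = (z - τ) * (1 - conj τ * f z) + (f z - τ) * (1 - conj τ * z) := by
  have hτ := h.norm_eq_one
  obtain ⟨hd0, hj⟩ := julia hf hm h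
  have hττ := mul_conj_of_norm_eq_one hτ
  have hτ0 := ne_zero_of_norm_eq_one hτ
  set W : ℂ → ℂ := fun z => cayley τ (f z) - cayley τ z with hW
  have hWd : DifferentiableOn ℂ W disk :=
    (differentiableOn_cayley_comp hτ hf hm).sub (differentiableOn_cayley hτ)
  have hWre : ∀ z ∈ disk, 0 ≤ (W z).re := fun z hz => by
    have h1 := hj z hz
    have h2 := cayley_re_pos hτ (hm hz)
    simp only [hW, sub_re]
    nlinarith
  have hWeq : ∀ z ∈ disk, W z * ((τ - f z) * (τ - z)) = 2 * τ * (f z - z) := fun z hz => by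
    have h1 := sub_ne_zero_of_norm_eq_one hτ hz
    have h2 := sub_ne_zero_of_norm_eq_one hτ (hm hz)
    simp only [hW, cayley]
    field_simp
    ring
  have hWne : ∀ z ∈ disk, W z ≠ 0 := fun z hz h0 => by
    have h1 := hWeq z hz
    rw [h0, zero_mul] at h1
    have := mul_ne_zero (mul_ne_zero two_ne_zero hτ0) (sub_ne_zero.2 (hne z hz))
    exact this h1.symm
  refine ⟨fun z => 4 * (W z)⁻¹, ?_, fun z hz => ?_, fun z hz => ?_⟩
  · exact (hWd.inv hWne).const_mul _
  · have h1 := re_inv_nonneg (hWre z hz)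
    have h2 : (4 * (W z)⁻¹).re = 4 * ((W z)⁻¹).re := by
      rw [← Complex.ofReal_ofNat, Complex.re_ofReal_mul]
    rw [h2]
    positivity
  · have h1 := hWeq z hz
    have h2 := hWne z hz
    have h3 : (z - τ) * (1 - conj τ * f z) + (f z - τ) * (1 - conj τ * z) =
        -(2 * conj τ * ((τ - f z) * (τ - z))) := by
      linear_combination (2 * τ - z - f z) * hττ
    have h4 : 4 * (W z)⁻¹ * (z - f z) = 4 * (z - f z) / W z := by ring
    rw [h3, h4, div_eq_iff h2]
    linear_combination 2 * conj τ * h1 + 4 * (f z - z) * hττ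

/-- The Berkson-Porta type half-plane function of a self-map with Denjoy-Wolff point `τ`. -/
lemma exists_halfPlane {f : ℂ → ℂ} (hf : DifferentiableOn ℂ f disk)
    (hm : MapsTo f disk disk) {τ : ℂ} (h : IsDWPoint f τ) :
    ∃ H : ℂ → ℂ, DifferentiableOn ℂ H disk ∧ (∀ z ∈ disk, 0 ≤ (H z).re) ∧
      ∀ z ∈ disk, H z * (z - f z) = (z - τ) * (1 - conj τ * f z) + (f z - τ) * (1 - conj τ * z) := by
  obtain ⟨hid, ⟨hτ, hfix⟩ | ⟨hne, d, hd, hb⟩⟩ := h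
  · exact exists_halfPlane_of_fixed hf hm hτ hfix hid
  · exact exists_halfPlane_of_boundary hf hm hne hd hb

lemma sub_mul_one_sub_conj {σ : ℂ} (hσ : ‖σ‖ = 1) (τ : ℂ) :
    (σ - τ) * (1 - conj τ * σ) = σ * ((‖σ - τ‖ ^ 2 : ℝ) : ℂ) := by
  have h1 : ((‖σ - τ‖ ^ 2 : ℝ) : ℂ) = (σ - τ) * conj (σ - τ) := by
    rw [Complex.mul_conj, Complex.normSq_eq_norm_sq]
  rw [h1, map_sub]
  linear_combination -(σ - τ) * mul_conj_of_norm_eq_one hσ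

/-- The point mass of the half-plane function at a boundary regular fixed point. -/
lemma halfPlane_mass {f H : ℂ → ℂ} {τ σ : ℂ} (hH : DifferentiableOn ℂ H disk)
    (hre : ∀ z ∈ disk, 0 ≤ (H z).re)
    (heq : ∀ z ∈ disk, H z * (z - f z) =
      (z - τ) * (1 - conj τ * f z) + (f z - τ) * (1 - conj τ * z))
    (hne : σ ≠ τ) {d : ℝ} (h : IsBRFPWith f σ d) :
    d ≠ 1 ∧ Tendsto (fun ρ : ℝ => (1 - ρ) * (H (ρ * σ)).re) (𝓝[<] 1)
      (𝓝 (2 * (‖σ - τ‖ ^ 2 / (d - 1)))) := by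
  have hσ := h.norm_eq_one
  have hσ0 := ne_zero_of_norm_eq_one hσ
  have hz := tendsto_radius σ
  have hf := h.fixed.radius hσ
  have hN : Tendsto (fun ρ : ℝ => (ρ * σ - τ) * (1 - conj τ * f (ρ * σ)) +
      (f (ρ * σ) - τ) * (1 - conj τ * (ρ * σ))) (𝓝[<] 1)
      (𝓝 ((σ - τ) * (1 - conj τ * σ) + (σ - τ) * (1 - conj τ * σ))) :=
    ((hz.sub_const τ).mul ((hf.const_mul _).const_sub 1)).add
      ((hf.sub_const τ).mul ((hz.const_mul _).const_sub 1))
  rw [sub_mul_one_sub_conj hσ] at hN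
  have hQ : Tendsto (fun ρ : ℝ => (ρ * σ - f (ρ * σ)) / (1 - ρ : ℝ)) (𝓝[<] 1)
      (𝓝 (σ * d - σ)) := by
    refine (h.tendsto_sub_div.sub_const σ).congr' ?_
    filter_upwards [Ioo_mem_nhdsLT_one] with ρ hρ
    have h2 : ((1 - ρ : ℝ) : ℂ) ≠ 0 := by
      rw [Complex.ofReal_ne_zero]; linarith [hρ.2]
    field_simp
    push_cast
    ring
  have hprod : ∀ᶠ ρ : ℝ in 𝓝[<] 1, (((1 - ρ : ℝ) : ℂ) * H (ρ * σ)) *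
      ((ρ * σ - f (ρ * σ)) / (1 - ρ : ℝ)) = (ρ * σ - τ) * (1 - conj τ * f (ρ * σ)) +
      (f (ρ * σ) - τ) * (1 - conj τ * (ρ * σ)) := by
    filter_upwards [Ioo_mem_nhdsLT_one] with ρ hρ
    have h2 : ((1 - ρ : ℝ) : ℂ) ≠ 0 := by
      rw [Complex.ofReal_ne_zero]; linarith [hρ.2]
    rw [← heq _ (radius_mem_disk hσ hρ)]
    field_simp
  -- If `d = 1`, then `(z - f z) / (1 - ρ) → 0` on the radius while the right side of `heq` tends to
  -- `2σ|σ - τ|² ≠ 0`; this contradicts the growth bound `(1 - ρ)|H| ≤ 2|H 0|`.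
  have hd1 : d ≠ 1 := by
    rintro rfl
    have h1 : ∀ᶠ ρ : ℝ in 𝓝[<] 1, ‖(ρ * σ - τ) * (1 - conj τ * f (ρ * σ)) +
        (f (ρ * σ) - τ) * (1 - conj τ * (ρ * σ))‖ ≤
        2 * ‖H 0‖ * ‖(ρ * σ - f (ρ * σ)) / (1 - ρ : ℝ)‖ := by
      filter_upwards [hprod, Ioo_mem_nhdsLT_one] with ρ hρ hρ'
      rw [← hρ, norm_mul]
      refine mul_le_mul_of_nonneg_right ?_ (norm_nonneg _)
      have h2 := norm_le_of_re_nonneg hH hre (radius_mem_disk hσ hρ')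
      rw [norm_ofReal_mul hσ hρ'.1.le] at h2
      rwa [norm_mul, Complex.norm_real, Real.norm_of_nonneg (by linarith [hρ'.2])]
    have h2 := le_of_tendsto_of_tendsto hN.norm (hQ.norm.const_mul _) h1
    rw [Complex.ofReal_one, mul_one, sub_self, norm_zero, mul_zero, ← two_mul, norm_mul, norm_mul,
      hσ, Complex.norm_real, norm_pow, norm_norm, Complex.norm_ofNat, one_mul] at h2
    have := norm_pos_iff.2 (sub_ne_zero.2 hne)
    have : 0 < ‖σ - τ‖ ^ 2 := by positivity
    linarith
  refine ⟨hd1, ?_⟩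
  have hd1' : (d : ℂ) - 1 ≠ 0 := by
    rw [← Complex.ofReal_one, ← Complex.ofReal_sub, Complex.ofReal_ne_zero]
    exact sub_ne_zero.2 hd1
  have hQ0 : σ * d - σ ≠ 0 := by
    have : σ * d - σ = σ * (d - 1) := by ring
    rw [this]
    exact mul_ne_zero hσ0 hd1'
  have h1 := hN.div hQ hQ0
  have h2 : (σ * ((‖σ - τ‖ ^ 2 : ℝ) : ℂ) + σ * ((‖σ - τ‖ ^ 2 : ℝ) : ℂ)) / (σ * d - σ) =
      ((2 * (‖σ - τ‖ ^ 2 / (d - 1)) : ℝ) : ℂ) := by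
    rw [div_eq_iff hQ0]
    push_cast
    field_simp
    ring
  rw [h2] at h1
  have h3 := (Complex.continuous_re.tendsto _).comp h1
  rw [Complex.ofReal_re] at h3
  refine h3.congr' ?_
  filter_upwards [hprod, hQ.eventually_ne hQ0] with ρ h4 h5
  rw [Function.comp_apply, Pi.div_apply, ← h4, mul_div_cancel_right₀ _ h5, Complex.re_ofReal_mul]

end DiskSemigroup

/-! ### The key inequality for generators of the class. -/

namespace DiskSemigroup

open Complex ComplexConjugate

lemma IsFlow.tendsto_slope {G : ℂ → ℂ} {φ : ℝ → ℂ → ℂ} (hφ : IsFlow G φ) {z : ℂ} (hz : z ∈ disk) :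
    Tendsto (fun t : ℝ => (φ t z - z) / t) (𝓝[>] 0) (𝓝 (G z)) := by
  have h1 := ((hφ z hz).2 0 le_rfl).2.mono Ioi_subset_Ici_self
  rw [hasDerivWithinAt_iff_tendsto_slope' self_notMem_Ioi] at h1
  simp only [(hφ z hz).1] at h1
  refine h1.congr fun t => ?_
  rw [slope_def_module, sub_zero, (hφ z hz).1, Complex.real_smul, Complex.ofReal_inv, div_eq_inv_mul]

lemma tendsto_exp_sub_one_div (l : ℝ) :
    Tendsto (fun t : ℝ => (Real.exp (l * t) - 1) / t) (𝓝[>] 0) (𝓝 l) := by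
  have h1 : HasDerivAt (fun t : ℝ => Real.exp (l * t)) l 0 := by
    have h2 : HasDerivAt (fun t : ℝ => l * t) l 0 := by
      simpa using (hasDerivAt_id (0 : ℝ)).const_mul l
    simpa using h2.exp
  rw [hasDerivAt_iff_tendsto_slope] at h1
  refine (h1.mono_left (nhdsWithin_mono _ fun t ht => ne_of_gt ht)).congr fun t => ?_
  rw [slope_def_field, mul_zero, Real.exp_zero, sub_zero]

lemma HasSpectralValue.isBRFPWith {φ : ℝ → ℂ → ℂ} {σ : ℂ} {l : ℝ} (hσ : ‖σ‖ = 1)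
    (h : HasSpectralValue φ σ l) {t : ℝ} (ht : 0 ≤ t) :
    IsBRFPWith (φ t) σ (Real.exp (-l * t) : ℝ) := by
  have := (h t ht).isBRFPWith hσ
  push_cast
  exact this

/-- The infinitesimal form of the Cowen-Pommerenke inequality. -/
lemma re_ge_of_generates {ι : Type*} [Fintype ι] {G : ℂ → ℂ} {φ : ℝ → ℂ → ℂ}
    (hG : Generates G φ) {τ : ℂ} (hτ : IsDWPointOf φ τ) {σ : ι → ℂ} (hσ : ∀ k, ‖σ k‖ = 1)
    (hinj : Function.Injective σ) (hne : ∀ k, σ k ≠ τ) {l : ι → ℝ} (hl : ∀ k, l k ≤ 0)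
    (hsp : ∀ k, HasSpectralValue φ (σ k) (l k)) {z : ℂ} (hz : z ∈ disk) (hGz : G z ≠ 0) :
    (∀ k, l k < 0) ∧ ∑ k, ‖σ k - τ‖ ^ 2 / (2 * |l k|) * (cayley (σ k) z).re ≤
      ((τ - z) * (1 - conj τ * z) / G z).re := by
  have hs := hG.isFlow.tendsto_slope hz
  have hev : ∀ᶠ t : ℝ in 𝓝[>] 0, 0 < t ∧ φ t z ≠ z := by
    filter_upwards [self_mem_nhdsWithin, hs.eventually_ne hGz] with t ht h2
    refine ⟨ht, fun h0 => h2 ?_⟩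
    rw [h0, sub_self, zero_div]
  have hH : ∀ t : ℝ, 0 < t ∧ φ t z ≠ z → ∃ H : ℂ → ℂ, DifferentiableOn ℂ H disk ∧
      (∀ z ∈ disk, 0 ≤ (H z).re) ∧ ∀ z ∈ disk, H z * (z - φ t z) =
        (z - τ) * (1 - conj τ * φ t z) + (φ t z - τ) * (1 - conj τ * z) := fun t ht =>
    exists_halfPlane (hG.semigroup.holo t ht.1.le) (hG.semigroup.mapsTo t ht.1.le)
      (hτ.2 t ht.1.le fun h => ht.2 (h hz))
  have hl0 : ∀ k, l k < 0 := by
    intro k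
    obtain ⟨t, ht⟩ := hev.exists
    obtain ⟨H, h1, h2, h3⟩ := hH t ht
    have h4 := (halfPlane_mass h1 h2 h3 (hne k) ((hsp k).isBRFPWith (hσ k) ht.1.le)).1
    refine lt_of_le_of_ne (hl k) fun h0 => h4 ?_
    simp [h0]
  refine ⟨hl0, ?_⟩
  have hφz : Tendsto (fun t : ℝ => φ t z) (𝓝[>] 0) (𝓝 z) := hG.semigroup.cont z hz
  -- This quotient is `t * H z` for the half-plane function `H` of `φ t`.
  have hR : Tendsto (fun t : ℝ => ((z - τ) * (1 - conj τ * φ t z) + (φ t z - τ) * (1 - conj τ * z)) /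
      (-((φ t z - z) / t))) (𝓝[>] 0)
      (𝓝 (((z - τ) * (1 - conj τ * z) + (z - τ) * (1 - conj τ * z)) / (-(G z)))) := by
    refine Tendsto.div ?_ hs.neg (neg_ne_zero.2 hGz)
    exact (((hφz.const_mul _).const_sub 1).const_mul _).add ((hφz.sub_const τ).mul_const _)
  have hL : Tendsto (fun t : ℝ => ∑ k, ‖σ k - τ‖ ^ 2 / ((Real.exp (-l k * t) - 1) / t) *
      (cayley (σ k) z).re) (𝓝[>] 0) (𝓝 (∑ k, ‖σ k - τ‖ ^ 2 / (-l k) * (cayley (σ k) z).re)) := by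
    refine tendsto_finsetSum _ fun k _ => Tendsto.mul_const _ ?_
    exact tendsto_const_nhds.div (tendsto_exp_sub_one_div (-l k)) (by linarith [hl0 k])
  -- The point-mass inequality for `φ t`, multiplied by `t`: the masses involve `(exp (-l k * t) -
  -- 1) / t → -l k = |l k|`.
  have hle := le_of_tendsto_of_tendsto hL ((Complex.continuous_re.tendsto _).comp hR) (by
    filter_upwards [hev] with t ht
    obtain ⟨H, h1, h2, h3⟩ := hH t ht
    have h4 := re_ge_sum_of_tendsto_radius h1 h2 hσ hinj Finset.univ
      (fun k _ => (halfPlane_mass h1 h2 h3 (hne k) ((hsp k).isBRFPWith (hσ k) ht.1.le)).2) hz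
    have h5 : ((z - τ) * (1 - conj τ * φ t z) + (φ t z - τ) * (1 - conj τ * z)) /
      (-((φ t z - z) / t)) = (t : ℂ) * H z := by
      have ht0 : (t : ℂ) ≠ 0 := Complex.ofReal_ne_zero.2 ht.1.ne'
      have h6 : φ t z - z ≠ 0 := sub_ne_zero.2 ht.2
      rw [← h3 z hz, div_eq_iff (neg_ne_zero.2 (div_ne_zero h6 ht0))]
      field_simp
      ring
    rw [Function.comp_apply, h5, Complex.re_ofReal_mul]
    refine le_trans (le_of_eq ?_) (mul_le_mul_of_nonneg_left h4 ht.1.le)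
    rw [Finset.mul_sum]
    refine Finset.sum_congr rfl fun k _ => ?_
    rw [div_div_eq_mul_div]
    ring)
  have h7 : ((z - τ) * (1 - conj τ * z) + (z - τ) * (1 - conj τ * z)) / (-(G z)) =
      ((2 : ℝ) : ℂ) * ((τ - z) * (1 - conj τ * z) / G z) := by
    push_cast
    field_simp
    ring
  rw [h7, Complex.re_ofReal_mul] at hle
  have h8 : ∑ k, ‖σ k - τ‖ ^ 2 / (-l k) * (cayley (σ k) z).re =
      2 * ∑ k, ‖σ k - τ‖ ^ 2 / (2 * |l k|) * (cayley (σ k) z).re := by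
    rw [Finset.mul_sum]
    refine Finset.sum_congr rfl fun k _ => ?_
    have := hl0 k
    rw [abs_of_neg this]
    field_simp
  rw [h8] at hle
  linarith

variable {n : ℕ} {σ : Fin n → ℂ} {lam : Fin n → ℝ} {τ : ℂ}

lemma pZero_eq (z : ℂ) : pZero τ σ lam z = ∑ k, (alpha τ σ lam k : ℂ) * cayley (σ k) z := rfl

lemma pZero_re (z : ℂ) :
    (pZero τ σ lam z).re = ∑ k, alpha τ σ lam k * (cayley (σ k) z).re := by
  rw [pZero_eq, Complex.re_sum]
  simp only [Complex.re_ofReal_mul]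

lemma differentiableOn_pZero (hσ : ∀ k, ‖σ k‖ = 1) : DifferentiableOn ℂ (pZero τ σ lam) disk :=
  DifferentiableOn.fun_sum fun k _ => (differentiableOn_cayley (hσ k)).const_mul _

lemma alpha_pos (hlam : ∀ k, lam k < 0) (hne : ∀ k, τ ≠ σ k) (k : Fin n) : 0 < alpha τ σ lam k := by
  have h1 := norm_pos_iff.2 (sub_ne_zero.2 (hne k))
  have h2 := abs_pos.2 (hlam k).ne
  rw [alpha]
  positivity

lemma pZero_re_pos (hn : 0 < n) (hσ : ∀ k, ‖σ k‖ = 1) (hlam : ∀ k, lam k < 0)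
    (hne : ∀ k, τ ≠ σ k) {z : ℂ} (hz : z ∈ disk) : 0 < (pZero τ σ lam z).re := by
  rw [pZero_re]
  have : Nonempty (Fin n) := ⟨⟨0, hn⟩⟩
  exact Finset.sum_pos (fun k _ => mul_pos (alpha_pos hlam hne k) (cayley_re_pos (hσ k) hz))
    Finset.univ_nonempty

lemma radius_pos (hn : 0 < n) (hlam : ∀ k, lam k < 0) : 0 < radius lam := by
  have : Nonempty (Fin n) := ⟨⟨0, hn⟩⟩
  exact inv_pos.2 (Finset.sum_pos (fun k _ => inv_pos.2 (abs_pos.2 (hlam k).ne))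
    Finset.univ_nonempty)

lemma ne_of_norm_lt_one (hσ : ∀ k, ‖σ k‖ = 1) (hτ : τ ∈ disk) (k : Fin n) : τ ≠ σ k := by
  rintro rfl
  exact (mem_disk.1 hτ).ne (hσ k)

/-- The actual spectral values satisfy `|l k| ≤ |lam k|`, so the true weights are at least `alpha`,
and the kernels have positive real part. -/
lemma pZero_re_le_of_mem_Gen (hσ : ∀ k, ‖σ k‖ = 1) (hinj : Function.Injective σ)
    (hne : ∀ k, τ ≠ σ k) {G : ℂ → ℂ} (hG : G ∈ Gen τ σ lam) {z : ℂ} (hz : z ∈ disk)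
    (hGz : G z ≠ 0) : (pZero τ σ lam z).re ≤ ((τ - z) * (1 - conj τ * z) / G z).re := by
  obtain ⟨φ, hφ, h0 | hdw, hk⟩ := hG
  · exact absurd (h0 hz) hGz
  choose _ l hl hl0 hsp using hk
  obtain ⟨hneg, hle⟩ := re_ge_of_generates hφ hdw hσ hinj (fun k => (hne k).symm) hl0 hsp hz hGz
  refine le_trans ?_ hle
  rw [pZero_re]
  refine Finset.sum_le_sum fun k _ => ?_
  refine mul_le_mul_of_nonneg_right ?_ (cayley_re_pos (hσ k) hz).le
  rw [alpha, norm_sub_rev]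
  have h1 := hneg k
  have h2 := hl k
  rw [abs_of_neg h1, abs_of_neg (by linarith)]
  exact div_le_div_of_nonneg_left (sq_nonneg _) (by linarith) (by linarith)

end DiskSemigroup

/-! ### Spectral value at an interior Denjoy–Wolff point. -/

namespace DiskSemigroup

open Complex ComplexConjugate

variable {n : ℕ} {σ : Fin n → ℂ} {lam : Fin n → ℝ} {τ : ℂ}

lemma HasMultiplier.unique {f g : ℂ → ℂ} (hfg : EqOn f g disk) {d d' : ℂ}
    (h : HasMultiplier f τ d) (h' : HasMultiplier g τ d') : d = d' := by
  rcases h with ⟨hτ, -, h⟩ | h <;> rcases h' with ⟨hτ', -, h'⟩ | h'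
  · exact h.unique (h'.congr_of_eventuallyEq (hfg.eventuallyEq_of_mem (disk_mem_nhds hτ)))
  · exact absurd h'.norm_eq_one (mem_disk.1 hτ).ne
  · exact absurd h.norm_eq_one (mem_disk.1 hτ').ne
  · have hσ := h.norm_eq_one
    refine tendsto_nhds_unique (h.angular_deriv.radius hσ)
      ((h'.angular_deriv.radius hσ).congr' ?_)
    filter_upwards [Ioo_mem_nhdsLT_one] with ρ hρ
    rw [hfg (radius_mem_disk hσ hρ)]

/-- A single `t` determines `ω` only modulo `2πi/t`; differentiating `exp (-ω t)` at `t = 0` removes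
the ambiguity. -/
lemma IsSpectralValue.unique {G : ℂ → ℂ} {ω ω' : ℂ} (h : IsSpectralValue G τ ω)
    (h' : IsSpectralValue G τ ω') : ω = ω' := by
  obtain ⟨φ, hφ, hs⟩ := h
  obtain ⟨ψ, hψ, hs'⟩ := h'
  have heq : ∀ t : ℝ, 0 ≤ t → Complex.exp (-ω * t) = Complex.exp (-ω' * t) := fun t ht =>
    (hs t ht).unique (hφ.isFlow.eqOn hφ.holo hψ.isFlow ht) (hs' t ht)
  have hd : ∀ ω : ℂ, HasDerivWithinAt (fun t : ℝ => Complex.exp (-ω * t)) (-ω) (Ici 0) 0 := by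
    intro ω
    have h1 : HasDerivAt (fun t : ℝ => -ω * (t : ℂ)) (-ω) 0 := by
      simpa using (Complex.ofRealCLM.hasDerivAt (x := (0 : ℝ))).const_mul (-ω)
    simpa using h1.cexp.hasDerivWithinAt
  have h2 := (hd ω').congr (fun t ht => heq t ht) (heq 0 le_rfl)
  exact neg_injective ((uniqueDiffOn_Ici (0 : ℝ) 0 self_mem_Ici).eq_deriv _ (hd ω) h2)

/-- The spectral value at an interior fixed point is `-G' τ`. -/
lemma Generates.hasSpectralValue {G : ℂ → ℂ} {φ : ℝ → ℂ → ℂ} (hG : Generates G φ)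
    (hτ : τ ∈ disk) (h0 : G τ = 0) : HasSpectralValue φ τ (-deriv G τ) := by
  intro t ht
  have hfix := hG.isFlow.apply_eq_self hG.holo hτ h0 ht
  refine Or.inl ⟨hτ, hfix, ?_⟩
  have h1 := (hG.holo.differentiableAt (disk_mem_nhds hτ)).hasDerivAt
  have h2 : Tendsto (fun z => G z / (z - τ)) (𝓝[disk \ {τ}] τ) (𝓝 (deriv G τ)) := by
    rw [hasDerivAt_iff_tendsto_slope] at h1
    refine (h1.mono_left (nhdsWithin_mono _ fun z hz => hz.2)).congr fun z => ?_
    rw [slope_def_field, h0, sub_zero]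
  have h3 := hG.isFlow.tendsto_ratio_of_tendsto (fun _ => h0) h2 ht
  rw [neg_neg]
  have h4 : HasDerivWithinAt (φ t) (Complex.exp (deriv G τ * t)) disk τ := by
    rw [hasDerivWithinAt_iff_tendsto_slope]
    refine h3.congr fun z => ?_
    rw [slope_def_field, hfix]
  exact h4.hasDerivAt (disk_mem_nhds hτ)

lemma apply_eq_zero_of_mem_Gen (hτ : τ ∈ disk) {G : ℂ → ℂ} (hG : G ∈ Gen τ σ lam) : G τ = 0 := by
  obtain ⟨φ, hφ, h0 | hdw, -⟩ := hG
  · exact h0 hτ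
  · refine hφ.isFlow.eq_zero hτ fun t ht => ?_
    by_cases hid : EqOn (φ t) id disk
    · exact hid hτ
    · rcases (hdw.2 t ht hid).2 with h | ⟨-, d, -, h⟩
      · exact h.2
      · exact absurd h.norm_eq_one (mem_disk.1 hτ).ne

lemma existsUnique_spectralValue_of_mem_Gen (hτ : τ ∈ disk) {G : ℂ → ℂ} (hG : G ∈ Gen τ σ lam) :
    IsSpectralValue G τ (-deriv G τ) := by
  have h0 := apply_eq_zero_of_mem_Gen hτ hG
  obtain ⟨φ, hφ, -⟩ := hG
  exact ⟨φ, hφ, hφ.hasSpectralValue hτ h0⟩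

lemma re_inv_eq (q : ℂ) : (q⁻¹).re = q.re / ‖q‖ ^ 2 := by
  rw [Complex.inv_re, Complex.normSq_eq_norm_sq]

lemma factor_ne_zero (hτ : ‖τ‖ ≤ 1) {z : ℂ} (hz : z ∈ disk) (hne : z ≠ τ) :
    (τ - z) * (1 - conj τ * z) ≠ 0 :=
  mul_ne_zero (sub_ne_zero.2 hne.symm) (one_sub_conj_mul_ne_zero hτ (mem_disk.1 hz))

/-- The Berkson-Porta factorization of a generator in the class. -/
lemma exists_factor_of_mem_Gen (hσ : ∀ k, ‖σ k‖ = 1) (hinj : Function.Injective σ)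
    (hne : ∀ k, τ ≠ σ k) (hτ : ‖τ‖ ≤ 1) {G : ℂ → ℂ} (hG : G ∈ Gen τ σ lam) :
    ∃ q : ℂ → ℂ, DifferentiableOn ℂ q disk ∧
      (∀ z ∈ disk, G z = (τ - z) * (1 - conj τ * z) * q z) ∧
      ∀ z ∈ disk, (pZero τ σ lam z).re * ‖q z‖ ^ 2 ≤ (q z).re := by
  have hGd : DifferentiableOn ℂ G disk := by
    obtain ⟨φ, hφ, -⟩ := hG
    exact hφ.holo
  obtain ⟨q, hqd, hq⟩ : ∃ q : ℂ → ℂ, DifferentiableOn ℂ q disk ∧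
      ∀ z ∈ disk, G z = (τ - z) * (1 - conj τ * z) * q z := by
    by_cases hτd : τ ∈ disk
    · have h0 := apply_eq_zero_of_mem_Gen hτd hG
      have hDd : DifferentiableOn ℂ (dslope G τ) disk :=
        (Complex.differentiableOn_dslope (disk_mem_nhds hτd)).2 hGd
      refine ⟨fun z => -dslope G τ z / (1 - conj τ * z), DifferentiableOn.div hDd.neg
        (by fun_prop) fun z hz => one_sub_conj_mul_ne_zero hτ (mem_disk.1 hz), fun z hz => ?_⟩
      have h1 := one_sub_conj_mul_ne_zero hτ (mem_disk.1 hz)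
      have h2 : (z - τ) * dslope G τ z = G z := by simpa [h0] using sub_smul_dslope G τ z
      rw [mul_assoc, mul_div_cancel₀ _ h1, ← h2]
      ring
    · have h1 : ∀ z ∈ disk, (τ - z) * (1 - conj τ * z) ≠ 0 := fun z hz =>
        factor_ne_zero hτ hz (by rintro rfl; exact hτd hz)
      exact ⟨fun z => G z / ((τ - z) * (1 - conj τ * z)), hGd.div (by fun_prop) h1,
        fun z hz => (mul_div_cancel₀ _ (h1 z hz)).symm⟩
  refine ⟨q, hqd, hq, ?_⟩
  -- Multiplying out by `‖q z‖ ^ 2` keeps the inequality meaningful at zeros of `q`, hence for the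
  -- zero generator, and lets it extend to `z = τ` by continuity.
  have hoff : ∀ z ∈ disk, z ≠ τ → (pZero τ σ lam z).re * ‖q z‖ ^ 2 ≤ (q z).re := by
    intro z hz hzτ
    by_cases hq0 : q z = 0
    · simp [hq0]
    · have hf := factor_ne_zero hτ hz hzτ
      have hGz : G z ≠ 0 := by rw [hq z hz]; exact mul_ne_zero hf hq0
      have h1 := pZero_re_le_of_mem_Gen hσ hinj hne hG hz hGz
      rw [hq z hz, div_mul_cancel_left₀ hf, re_inv_eq] at h1
      rwa [le_div_iff₀ (by have := norm_pos_iff.2 hq0; positivity)] at h1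
  intro z hz
  by_cases hzτ : z = τ
  · subst hzτ
    have hnhds := disk_mem_nhds hz
    have hpd := (differentiableOn_pZero (τ := z) (lam := lam) hσ).continuousOn.continuousAt hnhds
    have hqc := hqd.continuousOn.continuousAt hnhds
    have h1 : ContinuousAt (fun w => (pZero z σ lam w).re * ‖q w‖ ^ 2) z :=
      (Complex.continuous_re.continuousAt.comp hpd).mul (hqc.norm.pow 2)
    have h2 : ContinuousAt (fun w => (q w).re) z := Complex.continuous_re.continuousAt.comp hqc
    refine le_of_tendsto_of_tendsto (b := 𝓝[≠] z) (h1.tendsto.mono_left nhdsWithin_le_nhds)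
      (h2.tendsto.mono_left nhdsWithin_le_nhds) ?_
    filter_upwards [self_mem_nhdsWithin, nhdsWithin_le_nhds hnhds] with x hx hxd using hoff x hxd hx
  · exact hoff z hz hzτ

lemma hasDerivAt_of_factor {G q : ℂ → ℂ} (hτ : τ ∈ disk) (hqd : DifferentiableOn ℂ q disk)
    (hq : ∀ z ∈ disk, G z = (τ - z) * (1 - conj τ * z) * q z) :
    HasDerivAt G (-((1 - ‖τ‖ ^ 2 : ℝ) * q τ)) τ := by
  have hqτ := (hqd.differentiableAt (disk_mem_nhds hτ)).hasDerivAt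
  have h1 : HasDerivAt (fun z : ℂ => τ - z) (-1) τ := (hasDerivAt_id τ).const_sub τ
  have h2 : HasDerivAt (fun z : ℂ => 1 - conj τ * z) (-conj τ) τ := by
    simpa using ((hasDerivAt_id τ).const_mul (conj τ)).const_sub 1
  have h3 := ((h1.mul h2).mul hqτ).congr_of_eventuallyEq
    ((show EqOn G _ disk from hq).eventuallyEq_of_mem (disk_mem_nhds hτ))
  refine h3.congr_deriv ?_
  rw [one_sub_norm_sq_eq]
  simp only [Pi.mul_apply, sub_self]
  ring

/-- `∑ |λ_k|⁻¹ Im (σ̄_k τ)`. -/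
noncomputable def shift {n : ℕ} (τ : ℂ) (σ : Fin n → ℂ) (lam : Fin n → ℝ) : ℝ :=
  ∑ k, |lam k|⁻¹ * (conj (σ k) * τ).im

/-- Writing `|τ - σ_k|² = (σ_k - τ) conj (σ_k - τ)` cancels the pole and leaves `(σ_k + τ) conj (σ_k
- τ) = 1 - |τ|² + 2i Im (σ̄_k τ)`. The real part produces `r`, the imaginary part the constant in
`GMax`. -/
lemma pZero_self (hσ : ∀ k, ‖σ k‖ = 1) (hne : ∀ k, τ ≠ σ k) (hlam : ∀ k, lam k < 0) :
    pZero τ σ lam τ = (((1 - ‖τ‖ ^ 2) / (2 * radius lam) : ℝ) : ℂ) + I * (shift τ σ lam : ℝ) := by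
  have h1 : ∀ k, (alpha τ σ lam k : ℂ) * cayley (σ k) τ =
      (((1 - ‖τ‖ ^ 2) / 2 * |lam k|⁻¹ : ℝ) : ℂ) +
        I * ((|lam k|⁻¹ * (conj (σ k) * τ).im : ℝ) : ℂ) := by
    intro k
    have h2 : σ k - τ ≠ 0 := sub_ne_zero.2 (hne k).symm
    have h3 : ((‖τ - σ k‖ ^ 2 : ℝ) : ℂ) = (σ k - τ) * conj (σ k - τ) := by
      rw [Complex.mul_conj, Complex.normSq_eq_norm_sq, norm_sub_rev]
    have h4 : ((|lam k| : ℝ) : ℂ) ≠ 0 := Complex.ofReal_ne_zero.2 (abs_pos.2 (hlam k).ne).ne'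
    have h5 : (2 : ℂ) * I * (((conj (σ k) * τ).im : ℝ) : ℂ) = conj (σ k) * τ - σ k * conj τ := by
      apply Complex.ext
      · simp
      · simp
        ring
    have h6 := mul_conj_of_norm_eq_one (hσ k)
    have h7 : (1 : ℂ) - (‖τ‖ : ℂ) ^ 2 = 1 - conj τ * τ := by
      rw [← one_sub_norm_sq_eq]; push_cast; rfl
    have h8 : (‖τ - σ k‖ : ℂ) ^ 2 = (σ k - τ) * conj (σ k - τ) := by
      rw [← h3]; push_cast; rfl
    rw [alpha, cayley]
    push_cast
    rw [h7, h8]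
    field_simp
    rw [mul_comm (conj (σ k)) τ] at h5
    rw [map_sub]
    linear_combination h6 - h5
  rw [pZero_eq, Finset.sum_congr rfl fun k _ => h1 k, Finset.sum_add_distrib, ← Finset.mul_sum,
    ← Complex.ofReal_sum, ← Complex.ofReal_sum, ← Finset.mul_sum, shift, radius]
  congr 2
  rw [mul_comm 2, ← div_div, div_inv_eq_mul]
  ring

lemma norm_sub_radius_sq (ω : ℂ) (r : ℝ) :
    ‖ω - (r : ℂ)‖ ^ 2 = ‖ω‖ ^ 2 - 2 * r * ω.re + r ^ 2 := by
  simp only [norm_sq_eq, sub_re, sub_im, ofReal_re, ofReal_im]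
  ring

/-- For `ω ≠ 0` and `r > 0` the right side is `Re (1/ω) ≥ 1/(2r)`, the form in which the key
inequality arrives at `τ`. -/
lemma norm_sub_radius_le_iff {r : ℝ} (hr : 0 ≤ r) (ω : ℂ) :
    ‖ω - (r : ℂ)‖ ≤ r ↔ ‖ω‖ ^ 2 ≤ 2 * r * ω.re := by
  rw [← sq_le_sq₀ (norm_nonneg _) hr, norm_sub_radius_sq]
  constructor <;> intro h <;> linarith

lemma norm_sub_radius_eq_iff {r : ℝ} (hr : 0 ≤ r) (ω : ℂ) :
    ‖ω - (r : ℂ)‖ = r ↔ ‖ω‖ ^ 2 = 2 * r * ω.re := by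
  rw [← sq_eq_sq₀ (norm_nonneg _) hr, norm_sub_radius_sq]
  constructor <;> intro h <;> linarith

/-- The generator `z ↦ (τ - z) (1 - τ̄ z) / (a + p₀(z))`. -/
noncomputable def genWith {n : ℕ} (τ : ℂ) (σ : Fin n → ℂ) (lam : Fin n → ℝ) (a z : ℂ) : ℂ :=
  (τ - z) * (1 - conj τ * z) / (a + pZero τ σ lam z)

/-- A function `q` satisfying the Cowen-Pommerenke inequality either vanishes identically or has
no zeros. -/
lemma eq_zero_of_apply_eq_zero {p q : ℂ → ℂ} (hq : DifferentiableOn ℂ q disk)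
    (hp : ∀ z ∈ disk, 0 ≤ (p z).re) (hpq : ∀ z ∈ disk, (p z).re * ‖q z‖ ^ 2 ≤ (q z).re)
    {w : ℂ} (hw : w ∈ disk) (h0 : q w = 0) : ∀ z ∈ disk, q z = 0 := by
  intro z hz
  rw [← h0]
  exact eqOn_const_of_re_eq_zero hq
    (fun z hz => (mul_nonneg (hp z hz) (sq_nonneg _)).trans (hpq z hz)) hw (by simp [h0]) z hz

lemma re_sub_nonneg_of_mul_sq_le {p q : ℂ} (h0 : q ≠ 0) (h : p.re * ‖q‖ ^ 2 ≤ q.re) :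
    0 ≤ (q⁻¹ - p).re := by
  have := norm_pos_iff.2 h0
  rw [sub_re, re_inv_eq, sub_nonneg, le_div_iff₀ (by positivity)]
  exact h

/-- The spectral value at an interior Denjoy-Wolff point. -/
lemma spectralValue_interior (hn : 0 < n) (hσ : ∀ k, ‖σ k‖ = 1) (hinj : Function.Injective σ)
    (hlam : ∀ k, lam k < 0) (hτ : τ ∈ disk) {G : ℂ → ℂ} (hG : G ∈ Gen τ σ lam) {ω : ℂ}
    (hω : IsSpectralValue G τ ω) :
    ‖ω - (radius lam : ℂ)‖ ≤ radius lam ∧ (‖ω - (radius lam : ℂ)‖ = radius lam →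
      (ω = 0 → EqOn G 0 disk) ∧ (ω ≠ 0 →
        EqOn G (genWith τ σ lam ((1 - ‖τ‖ ^ 2 : ℝ) / ω - pZero τ σ lam τ)) disk)) := by
  have hne := ne_of_norm_lt_one hσ hτ
  have hr := radius_pos hn hlam
  obtain ⟨q, hqd, hq, hre⟩ := exists_factor_of_mem_Gen hσ hinj hne (mem_disk.1 hτ).le hG
  have hp0 : ∀ z ∈ disk, 0 ≤ (pZero τ σ lam z).re := fun z hz =>
    (pZero_re_pos hn hσ hlam hne hz).le
  have hωq : ω = (1 - ‖τ‖ ^ 2 : ℝ) * q τ := by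
    rw [hω.unique (existsUnique_spectralValue_of_mem_Gen hτ hG),
      (hasDerivAt_of_factor hτ hqd hq).deriv, neg_neg]
  set e : ℝ := 1 - ‖τ‖ ^ 2 with he
  have he0 : 0 < e := by have := norm_sq_lt_one hτ; linarith
  have hωre : ω.re = e * (q τ).re := by rw [hωq, Complex.re_ofReal_mul]
  have hωn : ‖ω‖ ^ 2 = e ^ 2 * ‖q τ‖ ^ 2 := by
    rw [hωq, norm_mul, Complex.norm_real, mul_pow, Real.norm_of_nonneg he0.le]
  have hpτ : (pZero τ σ lam τ).re = e / (2 * radius lam) := by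
    rw [pZero_self hσ hne hlam, add_re, ofReal_re]
    simp [he]
  have h1 := hre τ hτ
  rw [hpτ] at h1
  have h2 : e * ‖q τ‖ ^ 2 ≤ 2 * radius lam * (q τ).re := by
    rw [div_mul_eq_mul_div, div_le_iff₀ (by positivity)] at h1
    linarith
  refine ⟨?_, fun heq => ⟨fun hω0 => ?_, fun hω0 => ?_⟩⟩
  · rw [norm_sub_radius_le_iff hr.le, hωre, hωn]
    nlinarith
  · have hqτ : q τ = 0 := by
      rw [hω0] at hωq
      exact (mul_eq_zero.1 hωq.symm).resolve_left (Complex.ofReal_ne_zero.2 he0.ne')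
    intro z hz
    rw [hq z hz, eq_zero_of_apply_eq_zero hqd hp0 hre hτ hqτ z hz, mul_zero]
    rfl
  · have hqτ : q τ ≠ 0 := by rintro h; rw [h, mul_zero] at hωq; exact hω0 hωq
    have hq0 : ∀ z ∈ disk, q z ≠ 0 := fun z hz h =>
      hqτ (eq_zero_of_apply_eq_zero hqd hp0 hre hz h τ hτ)
    have hinv : (e : ℂ) / ω = (q τ)⁻¹ := by
      have : (e : ℂ) ≠ 0 := Complex.ofReal_ne_zero.2 he0.ne'
      rw [hωq]
      field_simp
    -- On the circle the key inequality is an equality at `τ`, so `1/q - p₀` keeps its value at `τ`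
    -- throughout the disk.
    have h3 := eqOn_const_of_re_eq_zero (h := fun z => (q z)⁻¹ - pZero τ σ lam z)
      ((hqd.inv hq0).sub (differentiableOn_pZero hσ))
      (fun z hz => re_sub_nonneg_of_mul_sq_le (hq0 z hz) (hre z hz)) hτ (by
        have h4 := norm_pos_iff.2 hqτ
        rw [sub_re, re_inv_eq, hpτ, sub_eq_zero, div_eq_div_iff (by positivity) (by positivity)]
        rw [norm_sub_radius_eq_iff hr.le, hωre, hωn] at heq
        have h5 : e * (e * ‖q τ‖ ^ 2) = e * (2 * radius lam * (q τ).re) := by linarith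
        linarith [mul_left_cancel₀ he0.ne' h5])
    intro z hz
    rw [hq z hz, genWith, hinv, ← h3 z hz, sub_add_cancel, div_inv_eq_mul]

end DiskSemigroup

/-! ### The extremal generators belong to the class. -/

namespace DiskSemigroup

open Complex ComplexConjugate

variable {n : ℕ} {σ : Fin n → ℂ} {lam : Fin n → ℝ} {τ : ℂ}

lemma differentiableOn_genWith_inv (hn : 0 < n) (hσ : ∀ k, ‖σ k‖ = 1) (hlam : ∀ k, lam k < 0)
    (hne : ∀ k, τ ≠ σ k) {a : ℂ} (ha : 0 ≤ a.re) :
    (∀ z ∈ disk, a + pZero τ σ lam z ≠ 0) ∧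
    DifferentiableOn ℂ (fun z => (a + pZero τ σ lam z)⁻¹) disk ∧
      ∀ z ∈ disk, 0 < ((a + pZero τ σ lam z)⁻¹).re := by
  have hre : ∀ z ∈ disk, 0 < (a + pZero τ σ lam z).re := fun z hz => by
    have := pZero_re_pos hn hσ hlam hne hz
    rw [add_re]
    linarith
  have h0 : ∀ z ∈ disk, a + pZero τ σ lam z ≠ 0 := fun z hz h => by
    have := hre z hz
    rw [h] at this
    simp at this
  refine ⟨h0, ((differentiableOn_pZero hσ).const_add a).inv h0, fun z hz => ?_⟩
  rw [re_inv_eq]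
  have := norm_pos_iff.2 (h0 z hz)
  exact div_pos (hre z hz) (by positivity)

lemma exists_generates_genWith (hn : 0 < n) (hσ : ∀ k, ‖σ k‖ = 1) (hlam : ∀ k, lam k < 0)
    (hτ : ‖τ‖ ≤ 1) (hne : ∀ k, τ ≠ σ k) {a : ℂ} (ha : 0 ≤ a.re) :
    ∃ φ, Generates (genWith τ σ lam a) φ := by
  obtain ⟨-, hd, hre⟩ := differentiableOn_genWith_inv hn hσ hlam hne ha
  have hG : DifferentiableOn ℂ (genWith τ σ lam a) disk := by
    have : DifferentiableOn ℂ (fun z => (τ - z) * (1 - conj τ * z) * (a + pZero τ σ lam z)⁻¹) disk :=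
      DifferentiableOn.mul (by fun_prop) hd
    exact this
  obtain ⟨C, hC⟩ := exists_re_conj_mul_le hτ hd fun z hz => (hre z hz).le
  obtain ⟨φ, hφ⟩ := exists_isFlow hG hC
  exact ⟨φ, hφ.generates hG⟩

lemma notMem_disk (hτ : ‖τ‖ = 1) : τ ∉ disk := fun h => (mem_disk.1 h).ne hτ

lemma IsBRFPWith.of_tendsto {f : ℂ → ℂ} {s d : ℂ} (hs : ‖s‖ = 1)
    (h : Tendsto (fun z => (f z - s) / (z - s)) (𝓝[disk] s) (𝓝 d)) : IsBRFPWith f s d := by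
  refine ⟨hs, HasAngularLimit.of_tendsto ?_, HasAngularLimit.of_tendsto h⟩
  have h1 : Tendsto (fun z => z - s) (𝓝[disk] s) (𝓝 (s - s)) :=
    (Continuous.tendsto (by fun_prop) _).mono_left nhdsWithin_le_nhds
  have h2 := (h.mul h1).const_add s
  rw [sub_self, mul_zero, add_zero] at h2
  refine h2.congr' ?_
  filter_upwards [self_mem_nhdsWithin] with z hz
  rw [div_mul_cancel₀ _ (sub_ne_zero_of_norm_eq_one' hs hz)]
  ring

/-- A boundary zero of the generator with finite derivative is a boundary regular fixed point. -/
lemma Generates.hasSpectralValue_boundary {G : ℂ → ℂ} {φ : ℝ → ℂ → ℂ} (hG : Generates G φ) {s : ℂ}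
    (hs : ‖s‖ = 1) {l : ℂ} (h : Tendsto (fun z => G z / (z - s)) (𝓝[disk] s) (𝓝 (-l))) :
    HasSpectralValue φ s l := by
  intro t ht
  have hd : disk \ {s} = disk := sdiff_singleton_eq_self (notMem_disk hs)
  have h1 := hG.isFlow.tendsto_ratio_of_tendsto (p := s) (κ := -l)
    (fun h => absurd h (notMem_disk hs)) (by rwa [hd]) ht
  rw [hd] at h1
  exact Or.inr (IsBRFPWith.of_tendsto hs h1)

/-- Only the `k`-th kernel has a pole at `σ k`, with residue `-2 σ_k`; the constant `a` and the
other kernels disappear. -/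
lemma tendsto_sub_mul_pZero (hσ : ∀ k, ‖σ k‖ = 1) (hinj : Function.Injective σ) (a : ℂ)
    (k : Fin n) : Tendsto (fun z => (z - σ k) * (a + pZero τ σ lam z)) (𝓝[disk] σ k)
      (𝓝 (-(2 * alpha τ σ lam k * σ k))) := by
  have h0 : Tendsto (fun z => z - σ k) (𝓝[disk] σ k) (𝓝 (σ k - σ k)) :=
    (Continuous.tendsto (by fun_prop) _).mono_left nhdsWithin_le_nhds
  rw [sub_self] at h0
  have h1 : Tendsto (fun z => (z - σ k) * a + ∑ j, (alpha τ σ lam j : ℂ) *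
      ((z - σ k) * cayley (σ j) z)) (𝓝[disk] σ k)
      (𝓝 (0 * a + ∑ j, (alpha τ σ lam j : ℂ) * if j = k then -(2 * σ k) else 0)) := by
    refine (h0.mul_const a).add (tendsto_finsetSum _ fun j _ => Tendsto.const_mul _ ?_)
    by_cases hjk : j = k
    · subst hjk
      rw [if_pos rfl]
      have h2 : Tendsto (fun z => -(σ j + z)) (𝓝[disk] σ j) (𝓝 (-(σ j + σ j))) :=
        (Continuous.tendsto (by fun_prop) _).mono_left nhdsWithin_le_nhds
      rw [← two_mul] at h2
      refine h2.congr' ?_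
      filter_upwards [self_mem_nhdsWithin] with z hz
      have := sub_ne_zero_of_norm_eq_one (hσ j) hz
      rw [cayley]
      field_simp
      ring
    · rw [if_neg hjk]
      have h2 : ContinuousAt (cayley (σ j)) (σ k) := by
        refine ContinuousAt.div (by fun_prop) (by fun_prop) (sub_ne_zero.2 ?_)
        exact fun h => hjk (hinj h)
      have h3 : Tendsto (cayley (σ j)) (𝓝[disk] σ k) (𝓝 (cayley (σ j) (σ k))) :=
        h2.tendsto.mono_left nhdsWithin_le_nhds
      simpa using h0.mul h3
  have h2 : 0 * a + ∑ j, (alpha τ σ lam j : ℂ) * (if j = k then -(2 * σ k) else 0) =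
      -(2 * alpha τ σ lam k * σ k) := by
    simp only [mul_ite, mul_zero, Finset.sum_ite_eq', Finset.mem_univ, if_true, zero_mul, zero_add]
    ring
  rw [h2] at h1
  refine h1.congr fun z => ?_
  rw [mul_add, pZero_eq, Finset.mul_sum]
  congr 1
  exact Finset.sum_congr rfl fun j _ => by ring

/-- The limit does not depend on `a`: `alpha` is chosen so that `|τ - σ_k|² / (2 α_k) = |λ_k|`, and
every such generator has spectral value exactly `lam k` at `σ k`. -/
lemma tendsto_genWith_div (hσ : ∀ k, ‖σ k‖ = 1) (hinj : Function.Injective σ)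
    (hlam : ∀ k, lam k < 0) (hne : ∀ k, τ ≠ σ k) (a : ℂ) (k : Fin n) :
    Tendsto (fun z => genWith τ σ lam a z / (z - σ k)) (𝓝[disk] σ k) (𝓝 (-(lam k : ℂ))) := by
  have hσ0 := ne_zero_of_norm_eq_one (hσ k)
  have hα : (alpha τ σ lam k : ℂ) ≠ 0 := Complex.ofReal_ne_zero.2 (alpha_pos hlam hne k).ne'
  have h1 : Tendsto (fun z => (τ - z) * (1 - conj τ * z)) (𝓝[disk] σ k)
      (𝓝 ((τ - σ k) * (1 - conj τ * σ k))) :=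
    (Continuous.tendsto (by fun_prop) _).mono_left nhdsWithin_le_nhds
  have h2 := h1.div (tendsto_sub_mul_pZero (τ := τ) (lam := lam) hσ hinj a k)
    (neg_ne_zero.2 (mul_ne_zero (mul_ne_zero two_ne_zero hα) hσ0))
  have h3 : (τ - σ k) * (1 - conj τ * σ k) / -(2 * alpha τ σ lam k * σ k) = -(lam k : ℂ) := by
    have h4 := sub_mul_one_sub_conj (hσ k) τ
    have h5 : (τ - σ k) * (1 - conj τ * σ k) = -(σ k * ((‖σ k - τ‖ ^ 2 : ℝ) : ℂ)) := by
      rw [← h4]; ring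
    have h6 : alpha τ σ lam k * (2 * -lam k) = ‖σ k - τ‖ ^ 2 := by
      rw [alpha, abs_of_neg (hlam k), norm_sub_rev]
      have := (hlam k).ne
      field_simp
    have h7 : ((‖σ k - τ‖ ^ 2 : ℝ) : ℂ) = alpha τ σ lam k * (2 * -lam k) := by
      rw [← h6]; push_cast; ring
    rw [h5, h7]
    field_simp
  rw [h3] at h2
  refine h2.congr fun z => ?_
  rw [Pi.div_apply, genWith, div_div, mul_comm (z - σ k)]

lemma genWith_ne_zero (hn : 0 < n) (hσ : ∀ k, ‖σ k‖ = 1) (hlam : ∀ k, lam k < 0)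
    (hτ : ‖τ‖ ≤ 1) (hne : ∀ k, τ ≠ σ k) {a : ℂ} (ha : 0 ≤ a.re) {z : ℂ} (hz : z ∈ disk)
    (hzτ : z ≠ τ) : genWith τ σ lam a z ≠ 0 :=
  div_ne_zero (factor_ne_zero hτ hz hzτ) ((differentiableOn_genWith_inv hn hσ hlam hne ha).1 z hz)

lemma exists_mem_disk_ne (τ : ℂ) : ∃ z ∈ disk, z ≠ τ := by
  by_cases h : (0 : ℂ) = τ
  · refine ⟨1 / 2, by rw [mem_disk]; norm_num, ?_⟩
    rw [← h]
    norm_num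
  · exact ⟨0, zero_mem_disk, h⟩

lemma IsFlow.exists_not_eqOn_id {G : ℂ → ℂ} {φ : ℝ → ℂ → ℂ} (hφ : IsFlow G φ) {z : ℂ}
    (hz : z ∈ disk) (h : G z ≠ 0) : ∃ t : ℝ, 0 ≤ t ∧ ¬ EqOn (φ t) id disk := by
  by_contra! hc
  exact h (hφ.eq_zero hz fun t ht => hc t ht hz)

lemma genWith_mem_Gen (hn : 0 < n) (hσ : ∀ k, ‖σ k‖ = 1) (hinj : Function.Injective σ)
    (hlam : ∀ k, lam k < 0) (hτ : τ ∈ disk) {a : ℂ} (ha : 0 ≤ a.re) :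
    genWith τ σ lam a ∈ Gen τ σ lam ∧
      IsSpectralValue (genWith τ σ lam a) τ ((1 - ‖τ‖ ^ 2 : ℝ) / (a + pZero τ σ lam τ)) := by
  have hne := ne_of_norm_lt_one hσ hτ
  obtain ⟨φ, hφ⟩ := exists_generates_genWith hn hσ hlam (mem_disk.1 hτ).le hne ha
  have h0 : genWith τ σ lam a τ = 0 := by simp [genWith]
  obtain ⟨w, hw, hwτ⟩ := exists_mem_disk_ne τ
  refine ⟨⟨φ, hφ, Or.inr ⟨hφ.isFlow.exists_not_eqOn_id hw (genWith_ne_zero hn hσ hlam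
    (mem_disk.1 hτ).le hne ha hw hwτ), fun t ht hid => ⟨hid, Or.inl ⟨hτ, ?_⟩⟩⟩, fun k =>
    ⟨hσ k, lam k, le_rfl, (hlam k).le, ?_⟩⟩, φ, hφ, ?_⟩
  · exact hφ.isFlow.apply_eq_self hφ.holo hτ h0 ht
  · exact hφ.hasSpectralValue_boundary (hσ k) (tendsto_genWith_div hσ hinj hlam hne a k)
  · have h1 := hφ.hasSpectralValue hτ h0
    rw [(hasDerivAt_of_factor (G := genWith τ σ lam a) hτ (differentiableOn_genWith_inv hn hσ hlam hne ha).2.1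
      (fun z _ => div_eq_mul_inv _ _)).deriv, neg_neg, ← div_eq_mul_inv] at h1
    exact h1

lemma generates_zero {G : ℂ → ℂ} (hG : EqOn G 0 disk) : Generates G fun _ z => z := by
  have hd : DifferentiableOn ℂ G disk := (differentiableOn_const (0 : ℂ)).congr hG
  refine IsFlow.generates hd fun z hz => ⟨rfl, fun t _ => ⟨hz, ?_⟩⟩
  rw [hG hz]
  exact hasDerivWithinAt_const _ _ _

lemma isBRFPWith_id {f : ℂ → ℂ} (hf : EqOn f id disk) {s : ℂ} (hs : ‖s‖ = 1) :
    IsBRFPWith f s 1 := by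
  refine IsBRFPWith.of_tendsto hs (tendsto_const_nhds.congr' ?_)
  filter_upwards [self_mem_nhdsWithin] with z hz
  rw [hf hz, id, div_self (sub_ne_zero_of_norm_eq_one' hs hz)]

lemma zero_mem_Gen (hσ : ∀ k, ‖σ k‖ = 1) (hlam : ∀ k, lam k < 0) (hτ : τ ∈ disk) :
    (0 : ℂ → ℂ) ∈ Gen τ σ lam ∧ IsSpectralValue 0 τ 0 := by
  have hg := generates_zero (G := 0) (fun _ _ => rfl)
  refine ⟨⟨_, hg, Or.inl fun _ _ => rfl, fun k => ⟨hσ k, 0, (hlam k).le, le_rfl, fun t _ => ?_⟩⟩,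
    _, hg, fun t _ => ?_⟩
  · refine Or.inr ?_
    simpa using isBRFPWith_id (f := fun z => z) (fun _ _ => rfl) (hσ k)
  · refine Or.inl ⟨hτ, rfl, ?_⟩
    simpa using! hasDerivAt_id τ

/-- Along the flow, the half-plane coordinate at the boundary point `τ` has derivative `2 q`. -/
lemma IsFlow.hasDerivWithinAt_cayley {G q : ℂ → ℂ} {φ : ℝ → ℂ → ℂ} (hφ : IsFlow G φ)
    (hτ : ‖τ‖ = 1) (hq : ∀ z ∈ disk, G z = (τ - z) * (1 - conj τ * z) * q z) {z : ℂ}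
    (hz : z ∈ disk) {t : ℝ} (ht : 0 ≤ t) :
    HasDerivWithinAt (fun t => (cayley τ (φ t z)).re) (2 * (q (φ t z)).re) (Ici 0) t := by
  obtain ⟨hd, hf⟩ := (hφ z hz).2 t ht
  have h1 := sub_ne_zero_of_norm_eq_one hτ hd
  have h2 := (hf.const_add τ).div (hf.const_sub τ) h1
  have h3 := Complex.reCLM.hasFDerivAt.comp_hasDerivWithinAt t h2
  refine h3.congr_deriv ?_
  rw [Complex.reCLM_apply]
  have h4 : (G (φ t z) * (τ - φ t z) - (τ + φ t z) * -G (φ t z)) / (τ - φ t z) ^ 2 =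
      ((2 : ℝ) : ℂ) * q (φ t z) := by
    rw [hq _ hd, div_eq_iff (pow_ne_zero 2 h1)]
    push_cast
    linear_combination (2 * (τ - φ t z) * q (φ t z) * (- φ t z)) * mul_conj_of_norm_eq_one hτ
  rw [h4, Complex.re_ofReal_mul]

/-- `Re (cayley τ)` increases strictly along trajectories, so none returns to its starting point. -/
lemma IsFlow.no_fixed_point {G q : ℂ → ℂ} {φ : ℝ → ℂ → ℂ} (hφ : IsFlow G φ)
    (hτ : ‖τ‖ = 1) (hq : ∀ z ∈ disk, G z = (τ - z) * (1 - conj τ * z) * q z)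
    (hpos : ∀ z ∈ disk, 0 < (q z).re) {z : ℂ} (hz : z ∈ disk) {t : ℝ} (ht : 0 < t) :
    φ t z ≠ z := by
  have hmono : StrictMonoOn (fun t => (cayley τ (φ t z)).re) (Ici 0) := by
    refine strictMonoOn_of_hasDerivWithinAt_pos (convex_Ici 0)
      (fun s hs => (hφ.hasDerivWithinAt_cayley hτ hq hz hs).continuousWithinAt)
      (f' := fun s => 2 * (q (φ s z)).re) (fun s hs => ?_) fun s hs => ?_
    · exact (hφ.hasDerivWithinAt_cayley hτ hq hz (interior_subset hs)).mono interior_subset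
    · have := hpos _ ((hφ z hz).2 s (interior_subset hs)).1
      linarith
  have := hmono self_mem_Ici (mem_Ici.2 ht.le) ht
  simp only [(hφ z hz).1] at this
  intro h
  rw [h] at this
  exact lt_irrefl _ this

/-- `p₀` is regular at `τ`, and since `|τ| = |σ_k| = 1`, `|τ - σ_k|²` is `-σ̄_k τ̄ (σ_k - τ)²`,
which cancels the double pole of the kernel's derivative. -/
lemma hasDerivAt_pZero_boundary (hσ : ∀ k, ‖σ k‖ = 1) (hlam : ∀ k, lam k < 0)
    (hτ : ‖τ‖ = 1) (hne : ∀ k, τ ≠ σ k) :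
    HasDerivAt (pZero τ σ lam) (-(conj τ / radius lam)) τ := by
  have hk : ∀ k, HasDerivAt (fun z => (alpha τ σ lam k : ℂ) * ((σ k + z) / (σ k - z)))
      (-(conj τ * ((|lam k|⁻¹ : ℝ) : ℂ))) τ := by
    intro k
    have h1 : σ k - τ ≠ 0 := sub_ne_zero.2 (hne k).symm
    have h2 := (((hasDerivAt_id τ).const_add (σ k)).div ((hasDerivAt_id τ).const_sub (σ k))
      h1).const_mul (alpha τ σ lam k : ℂ)
    refine h2.congr_deriv ?_
    have h3 : ((‖τ - σ k‖ ^ 2 : ℝ) : ℂ) = (σ k - τ) * conj (σ k - τ) := by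
      rw [Complex.mul_conj, Complex.normSq_eq_norm_sq, norm_sub_rev]
    have h4 : ((|lam k| : ℝ) : ℂ) ≠ 0 := Complex.ofReal_ne_zero.2 (abs_pos.2 (hlam k).ne).ne'
    have h8 : (‖τ - σ k‖ : ℂ) ^ 2 = (σ k - τ) * conj (σ k - τ) := by
      rw [← h3]; push_cast; rfl
    have h5 := mul_conj_of_norm_eq_one (hσ k)
    have h6 := mul_conj_of_norm_eq_one hτ
    rw [alpha]
    push_cast
    rw [h8, map_sub]
    simp only [id]
    field_simp
    linear_combination 2 * h5 - 2 * h6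
  have h := HasDerivAt.fun_sum (u := Finset.univ) fun k _ => hk k
  refine h.congr_deriv ?_
  rw [Finset.sum_neg_distrib, ← Finset.mul_sum, ← Complex.ofReal_sum, radius, Complex.ofReal_inv,
    div_inv_eq_mul]

/-- The imaginary constant makes the denominator vanish at `τ`. It then has a simple zero with slope
`-τ̄/r` against the double zero `τ̄ (z - τ)²` of the numerator. -/
lemma tendsto_genWith_boundary (hn : 0 < n) (hσ : ∀ k, ‖σ k‖ = 1) (hlam : ∀ k, lam k < 0)
    (hτ : ‖τ‖ = 1) (hne : ∀ k, τ ≠ σ k) :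
    Tendsto (fun z => genWith τ σ lam (-(I * (shift τ σ lam : ℝ))) z / (z - τ)) (𝓝[disk] τ)
      (𝓝 (-(radius lam : ℂ))) := by
  have hr := radius_pos hn hlam
  have hr0 : (radius lam : ℂ) ≠ 0 := Complex.ofReal_ne_zero.2 hr.ne'
  have hτ0 : conj τ ≠ 0 := by simpa using ne_zero_of_norm_eq_one hτ
  have h1 := hasDerivAt_pZero_boundary (lam := lam) hσ hlam hτ hne
  rw [hasDerivAt_iff_tendsto_slope] at h1
  have h2 := h1.mono_left (nhdsWithin_mono τ (s := disk) fun z hz => by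
    rintro rfl; exact notMem_disk hτ hz)
  have h3 := (tendsto_const_nhds (x := conj τ)).div h2 (neg_ne_zero.2 (div_ne_zero hτ0 hr0))
  have h4 : conj τ / -(conj τ / radius lam) = -(radius lam : ℂ) := by field_simp
  rw [h4] at h3
  refine h3.congr' ?_
  filter_upwards [self_mem_nhdsWithin] with z hz
  have hz' := sub_ne_zero_of_norm_eq_one' hτ hz
  have h5 := (differentiableOn_genWith_inv hn hσ hlam hne
    (a := -(I * (shift τ σ lam : ℝ))) (by simp)).1 z hz
  have h6 : -(I * (shift τ σ lam : ℝ)) + pZero τ σ lam z = pZero τ σ lam z - pZero τ σ lam τ := by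
    rw [pZero_self hσ hne hlam, hτ]
    simp
    ring
  rw [Pi.div_apply, slope_def_field, genWith, h6]
  rw [h6] at h5
  field_simp
  linear_combination (τ - z) * mul_conj_of_norm_eq_one hτ

lemma genWith_mem_Gen_boundary (hn : 0 < n) (hσ : ∀ k, ‖σ k‖ = 1) (hinj : Function.Injective σ)
    (hlam : ∀ k, lam k < 0) (hτ : ‖τ‖ = 1) (hne : ∀ k, τ ≠ σ k) :
    genWith τ σ lam (-(I * (shift τ σ lam : ℝ))) ∈ Gen τ σ lam ∧
      IsSpectralValue (genWith τ σ lam (-(I * (shift τ σ lam : ℝ)))) τ (radius lam) := by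
  have ha : 0 ≤ (-(I * (shift τ σ lam : ℝ))).re := by simp
  obtain ⟨φ, hφ⟩ := exists_generates_genWith hn hσ hlam hτ.le hne ha
  have hsp := hφ.hasSpectralValue_boundary hτ (tendsto_genWith_boundary hn hσ hlam hτ hne)
  have hτd := notMem_disk hτ
  refine ⟨⟨φ, hφ, Or.inr ⟨hφ.isFlow.exists_not_eqOn_id zero_mem_disk (genWith_ne_zero hn hσ hlam
    hτ.le hne ha zero_mem_disk (by rintro rfl; exact hτd zero_mem_disk)), fun t ht hid =>
    ⟨hid, Or.inr ⟨fun z hz => ?_, Real.exp (-radius lam * t), ?_, hsp.isBRFPWith hτ ht⟩⟩⟩, fun k =>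
    ⟨hσ k, lam k, le_rfl, (hlam k).le, ?_⟩⟩, φ, hφ, hsp⟩
  · have ht0 : 0 < t := by
      refine lt_of_le_of_ne ht fun h => hid fun z hz => ?_
      rw [← h, (hφ.isFlow z hz).1]
      rfl
    exact hφ.isFlow.no_fixed_point hτ (fun z _ => div_eq_mul_inv _ _)
      (differentiableOn_genWith_inv hn hσ hlam hne ha).2.2 hz ht0
  · have := radius_pos hn hlam
    rw [Real.exp_le_one_iff]
    nlinarith
  · exact hφ.hasSpectralValue_boundary (hσ k) (tendsto_genWith_div hσ hinj hlam hne _ k)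

end DiskSemigroup

/-! ### Spectral value at a boundary Denjoy–Wolff point. -/

namespace DiskSemigroup

open Complex ComplexConjugate

variable {n : ℕ} {σ : Fin n → ℂ} {lam : Fin n → ℝ} {τ : ℂ}

/-- Self-maps map radii into Stolz regions at boundary regular fixed points. -/
lemma IsBRFPWith.tendsto_stolz {f : ℂ → ℂ} (hf : DifferentiableOn ℂ f disk)
    (hm : MapsTo f disk disk) {d : ℝ} (h : IsBRFPWith f τ d) :
    Tendsto (fun ρ : ℝ => f (ρ * τ)) (𝓝[<] 1) (𝓝[stolz τ 4] τ) := by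
  have hτ := h.norm_eq_one
  obtain ⟨hd, hj⟩ := julia hf hm h
  refine tendsto_nhdsWithin_iff.2 ⟨h.fixed.radius hτ, ?_⟩
  have h1 := h.tendsto_sub_div.norm
  rw [norm_mul, hτ, one_mul, Complex.norm_real, Real.norm_of_nonneg hd.le] at h1
  -- Near the boundary `d (1 - ρ) ≤ 2|τ - f|`. Inserted in Julia's inequality, this gives `|τ - f| ≤
  -- 4 (1 - |f|)`, hence the aperture 4.
  filter_upwards [h1.eventually_const_lt (half_lt_self hd), Ioo_mem_nhdsLT_one] with ρ h2 hρ
  have hz := radius_mem_disk hτ hρ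
  refine ⟨hm hz, ?_⟩
  have h4 : 0 < 1 - ρ := by linarith [hρ.2]
  have h3 := hj _ hz
  have h5 := norm_pos_iff.2 (sub_ne_zero_of_norm_eq_one hτ (hm hz))
  have h6 : ‖τ - ρ * τ‖ = 1 - ρ := by
    rw [norm_sub_rev, ofReal_sub_one_mul, norm_neg, norm_ofReal_mul hτ h4.le]
  rw [norm_div, Complex.norm_real, Real.norm_of_nonneg h4.le, lt_div_iff₀ h4] at h2
  rw [cayley_re' hτ, cayley_re' hτ, h6, norm_ofReal_mul hτ hρ.1.le, mul_div_assoc',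
    div_le_div_iff₀ (by positivity) (by positivity)] at h3
  rw [norm_sub_rev]
  set x := ‖τ - f (ρ * τ)‖
  set y := ‖f (ρ * τ)‖
  have hy : y < 1 := mem_disk.1 (hm hz)
  have hy0 : 0 ≤ y := norm_nonneg _
  have h7 : (1 + ρ) * x ^ 2 ≤ d * (1 - y ^ 2) * (1 - ρ) := by
    refine le_of_mul_le_mul_left ?_ h4
    linarith
  have h8 : d * (1 - y ^ 2) * (1 - ρ) ≤ 4 * x * (1 - y) := by
    have h9 : 1 - y ^ 2 = (1 - y) * (1 + y) := by ring
    rw [h9]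
    have h10 : d * (1 - ρ) ≤ 2 * x := by linarith
    have h11 : d * (1 - ρ) * ((1 - y) * (1 + y)) ≤ 2 * x * ((1 - y) * 2) := by
      apply mul_le_mul h10 _ (by nlinarith) (by positivity)
      exact mul_le_mul_of_nonneg_left (by linarith) (by linarith)
    linarith
  refine le_of_mul_le_mul_left ?_ h5
  nlinarith [hρ.1, sq_nonneg x]

/-- The chain rule along the radius: `g` maps it into a Stolz region, where the angular derivative
of `f` may be evaluated. -/
lemma IsBRFPWith.comp_eq {f g fg : ℂ → ℂ} (hg : DifferentiableOn ℂ g disk)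
    (hm : MapsTo g disk disk) {a b c : ℝ} (hf : IsBRFPWith f τ a) (hgb : IsBRFPWith g τ b)
    (hfg : IsBRFPWith fg τ c) (heq : ∀ z ∈ disk, fg z = f (g z)) : c = a * b := by
  have hτ := hf.norm_eq_one
  have h1 := ((hf.angular_deriv 4).comp (hgb.tendsto_stolz hg hm)).mul
    (hgb.angular_deriv.radius hτ)
  have h2 := hfg.angular_deriv.radius hτ
  have h3 := tendsto_nhds_unique_of_eventuallyEq h2 h1 (by
    filter_upwards [Ioo_mem_nhdsLT_one] with ρ hρ
    have hz := radius_mem_disk hτ hρ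
    rw [Function.comp_apply, div_mul_div_cancel₀ (sub_ne_zero_of_norm_eq_one' hτ (hm hz)),
      heq _ hz])
  exact_mod_cast h3

/-- A multiplicative function on `[0, ∞)` with values in `(0, 1]` is exponential. -/
lemma exists_eq_exp_of_multiplicative {d : ℝ → ℝ} (hpos : ∀ t, 0 ≤ t → 0 < d t)
    (hle : ∀ t, 0 ≤ t → d t ≤ 1) (hmul : ∀ s t, 0 ≤ s → 0 ≤ t → d (s + t) = d s * d t) :
    ∃ l : ℝ, ∀ t, 0 ≤ t → d t = Real.exp (-l * t) := by
  set f : ℝ → ℝ := fun t => -Real.log (d t) with hf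
  have hf0 : ∀ t, 0 ≤ t → 0 ≤ f t := fun t ht =>
    neg_nonneg.2 (Real.log_nonpos (hpos t ht).le (hle t ht))
  have hadd : ∀ s t, 0 ≤ s → 0 ≤ t → f (s + t) = f s + f t := fun s t hs ht => by
    simp only [hf]
    rw [hmul s t hs ht, Real.log_mul (hpos s hs).ne' (hpos t ht).ne']
    ring
  have hmono : ∀ s t, 0 ≤ s → s ≤ t → f s ≤ f t := fun s t hs hst => by
    have h1 := hadd s (t - s) hs (by linarith)
    rw [add_sub_cancel] at h1
    linarith [hf0 (t - s) (by linarith)]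
  have hnat : ∀ m : ℕ, ∀ t, 0 ≤ t → f (m * t) = m * f t := by
    intro m t ht
    induction m with
    | zero =>
      have := hadd 0 0 le_rfl le_rfl
      simp only [Nat.cast_zero, zero_mul]
      rw [add_zero] at this
      linarith
    | succ m ih =>
      push_cast
      rw [add_mul, one_mul, hadd _ _ (by positivity) ht, ih]
      ring
  have hlin : ∀ t, 0 ≤ t → f t = f 1 * t := by
    intro t ht
    -- Monotonicity replaces continuity: `f (m t) = m f t` lies between `f` at the two integers
    -- around `m t`. Dividing by arbitrarily large `m` gives linearity.
    have hb : ∀ m : ℕ, m * |f t - f 1 * t| ≤ f 1 := by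
      intro m
      have hmt : 0 ≤ m * t := by positivity
      set k := ⌊(m : ℝ) * t⌋₊
      have h1 : (k : ℝ) ≤ m * t := Nat.floor_le hmt
      have h2 : m * t ≤ k + 1 := (Nat.lt_floor_add_one _).le
      have h3 := hmono k (m * t) (by positivity) h1
      have h4 := hmono (m * t) (k + 1) hmt h2
      have h5 := hnat k 1 zero_le_one
      have h6 := hnat (k + 1) 1 zero_le_one
      push_cast at h6
      rw [mul_one] at h5 h6
      rw [hnat m t ht] at h3 h4
      have h7 := hf0 1 zero_le_one
      have h8 : (m : ℝ) * |f t - f 1 * t| = |m * (f t - f 1 * t)| := by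
        rw [abs_mul, Nat.abs_cast]
      rw [h8, abs_le]
      constructor <;> nlinarith
    by_contra hne
    have h1 : 0 < |f t - f 1 * t| := abs_pos.2 (sub_ne_zero.2 hne)
    obtain ⟨m, hm⟩ := exists_nat_gt (f 1 / |f t - f 1 * t|)
    rw [div_lt_iff₀ h1] at hm
    linarith [hb m]
  refine ⟨f 1, fun t ht => ?_⟩
  rw [neg_mul, ← hlin t ht]
  simp only [hf, neg_neg]
  exact (Real.exp_log (hpos t ht)).symm

lemma eqOn_id_of_eqOn_zero {G : ℂ → ℂ} {φ : ℝ → ℂ → ℂ} (hφ : Generates G φ) (h0 : EqOn G 0 disk)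
    {t : ℝ} (ht : 0 ≤ t) : EqOn (φ t) id disk :=
  fun _ hz => hφ.isFlow.apply_eq_self hφ.holo hz (h0 hz) ht

/-- The multipliers at a boundary Denjoy-Wolff point are exponential. -/
lemma exists_spectralValue_boundary (hτ : ‖τ‖ = 1) {G : ℂ → ℂ} {φ : ℝ → ℂ → ℂ}
    (hφ : Generates G φ) (h : EqOn G 0 disk ∨ IsDWPointOf φ τ) :
    ∃ l : ℝ, HasSpectralValue φ τ l := by
  have hex : ∀ t : ℝ, ∃ d : ℝ, 0 ≤ t → d ≤ 1 ∧ IsBRFPWith (φ t) τ d := by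
    intro t
    by_cases ht : 0 ≤ t
    · by_cases hid : EqOn (φ t) id disk
      · exact ⟨1, fun _ => ⟨le_rfl, by simpa using isBRFPWith_id hid hτ⟩⟩
      · rcases h with h0 | hdw
        · exact absurd (eqOn_id_of_eqOn_zero hφ h0 ht) hid
        · rcases (hdw.2 t ht hid).2 with h1 | ⟨-, d, hd, hb⟩
          · exact absurd h1.1 (notMem_disk hτ)
          · exact ⟨d, fun _ => ⟨hd, hb⟩⟩
    · exact ⟨0, fun h => absurd h ht⟩
  choose d hd using hex
  obtain ⟨l, hl⟩ := exists_eq_exp_of_multiplicative (d := d)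
    (fun t ht => (julia (hφ.semigroup.holo t ht) (hφ.semigroup.mapsTo t ht) (hd t ht).2).1)
    (fun t ht => (hd t ht).1) fun s t hs ht =>
      (hd s hs).2.comp_eq (hφ.semigroup.holo t ht) (hφ.semigroup.mapsTo t ht) (hd t ht).2
        (hd (s + t) (by linarith)).2 fun z hz => hφ.semigroup.add s t hs ht z hz
  refine ⟨l, fun t ht => Or.inr ?_⟩
  have h1 := (hd t ht).2
  rw [hl t ht] at h1
  push_cast at h1
  exact h1

/-- The infinitesimal form of Julia's lemma at the Denjoy-Wolff point. -/
lemma julia_generator (hτ : ‖τ‖ = 1) {G q : ℂ → ℂ} {φ : ℝ → ℂ → ℂ} (hφ : Generates G φ) {l : ℝ}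
    (hl : HasSpectralValue φ τ l) (hq : ∀ z ∈ disk, G z = (τ - z) * (1 - conj τ * z) * q z)
    {z : ℂ} (hz : z ∈ disk) : l * (cayley τ z).re ≤ 2 * (q z).re := by
  have h1 := (hφ.isFlow.hasDerivWithinAt_cayley hτ hq hz le_rfl).mono Ioi_subset_Ici_self
  rw [hasDerivWithinAt_iff_tendsto_slope' self_notMem_Ioi] at h1
  simp only [(hφ.isFlow z hz).1] at h1
  -- Julia's lemma for `φ t`, divided by `t` and taken to the limit `t → 0⁺`.
  refine le_of_tendsto_of_tendsto ((tendsto_exp_sub_one_div l).mul_const _) h1 ?_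
  filter_upwards [self_mem_nhdsWithin] with t ht
  have ht : 0 < t := ht
  have h2 := (julia (hφ.semigroup.holo t ht.le) (hφ.semigroup.mapsTo t ht.le)
    (hl.isBRFPWith hτ ht.le)).2 z hz
  rw [slope_def_field, (hφ.isFlow z hz).1, sub_zero, div_mul_eq_mul_div,
    div_le_div_iff_of_pos_right ht, sub_mul, one_mul]
  have h3 := mul_le_mul_of_nonneg_left h2 (Real.exp_pos (l * t)).le
  rw [← mul_assoc, ← Real.exp_add] at h3
  simp only [neg_mul, add_neg_cancel, Real.exp_zero, one_mul] at h3
  linarith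

/-- The spectral value at a boundary Denjoy-Wolff point. -/
lemma spectralValue_boundary (hn : 0 < n) (hσ : ∀ k, ‖σ k‖ = 1) (hinj : Function.Injective σ)
    (hlam : ∀ k, lam k < 0) (hτ : ‖τ‖ = 1) (hne : ∀ k, τ ≠ σ k) {G : ℂ → ℂ}
    (hG : G ∈ Gen τ σ lam) :
    ∃ l : ℝ, IsSpectralValue G τ l ∧ l ≤ radius lam ∧
      (l = radius lam → EqOn G (genWith τ σ lam (-(I * (shift τ σ lam : ℝ)))) disk) := by
  have hr := radius_pos hn hlam
  obtain ⟨q, hqd, hq, hre⟩ := exists_factor_of_mem_Gen hσ hinj hne hτ.le hG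
  obtain ⟨φ, hφ, hdw, -⟩ := hG
  obtain ⟨l, hl⟩ := exists_spectralValue_boundary hτ hφ hdw
  refine ⟨l, ⟨φ, hφ, hl⟩, ?_⟩
  rcases le_or_gt l 0 with hl0 | hl0
  · exact ⟨hl0.trans hr.le, fun h => absurd h (by linarith)⟩
  have hju : ∀ z ∈ disk, l * (cayley τ z).re ≤ 2 * (q z).re := fun z hz =>
    julia_generator hτ hφ hl hq hz
  have hqpos : ∀ z ∈ disk, 0 < (q z).re := fun z hz => by
    have := mul_pos hl0 (cayley_re_pos hτ hz)
    linarith [hju z hz]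
  have hq0 : ∀ z ∈ disk, q z ≠ 0 := fun z hz h => by
    have := hqpos z hz
    rw [h] at this
    simp at this
  have hcay : ∀ ρ ∈ Ioo (0 : ℝ) 1, (cayley τ (ρ * τ)).re = (1 + ρ) / (1 - ρ) := by
    intro ρ hρ
    have h4 : 0 < 1 - ρ := by linarith [hρ.2]
    have h6 : ‖τ - ρ * τ‖ = 1 - ρ := by
      rw [norm_sub_rev, ofReal_sub_one_mul, norm_neg, norm_ofReal_mul hτ h4.le]
    rw [cayley_re' hτ, h6, norm_ofReal_mul hτ hρ.1.le]
    field_simp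
    ring
  -- Julia's lower bound for `Re q` is an upper bound for `|1/q|`; the right side tends to `1/l`, to
  -- be compared with the limit `1/r` of `Re p₀ / (1 - ρ)`.
  have hbound : ∀ ρ ∈ Ioo (0 : ℝ) 1, ‖(q (ρ * τ))⁻¹‖ / (1 - ρ) ≤ 2 / (l * (1 + ρ)) := by
    intro ρ hρ
    have hz := radius_mem_disk hτ hρ
    have h4 : 0 < 1 - ρ := by linarith [hρ.2]
    have h5 : 0 < 1 + ρ := by linarith [hρ.1]
    have h1 := hju _ hz
    have h2 := Complex.re_le_norm (q (ρ * τ))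
    have h3 := norm_pos_iff.2 (hq0 _ hz)
    rw [hcay ρ hρ, mul_div_assoc', div_le_iff₀ h4] at h1
    rw [norm_inv, inv_eq_one_div, div_div, div_le_div_iff₀ (by positivity) (by positivity)]
    nlinarith
  have hpc : ContinuousAt (pZero τ σ lam) τ :=
    (hasDerivAt_pZero_boundary hσ hlam hτ hne).continuousAt
  have hp0 : Tendsto (fun ρ : ℝ => (pZero τ σ lam (ρ * τ)).re / (1 - ρ)) (𝓝[<] 1)
      (𝓝 (radius lam)⁻¹) := by
    have h1 : ∀ k, Tendsto (fun ρ : ℝ => alpha τ σ lam k * ((1 + ρ) / ‖σ k - ρ * τ‖ ^ 2)) (𝓝[<] 1)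
        (𝓝 (alpha τ σ lam k * ((1 + 1) / ‖σ k - τ‖ ^ 2))) := by
      intro k
      have h2 := norm_pos_iff.2 (sub_ne_zero.2 (hne k).symm)
      refine Tendsto.const_mul _ (Tendsto.div ?_ (((tendsto_radius τ).const_sub _).norm.pow 2)
        (by positivity))
      exact (Continuous.tendsto (by fun_prop) _).mono_left nhdsWithin_le_nhds
    have h2 := tendsto_finsetSum Finset.univ fun k _ => h1 k
    have h3 : ∑ k, alpha τ σ lam k * ((1 + 1) / ‖σ k - τ‖ ^ 2) = (radius lam)⁻¹ := by
      rw [radius, inv_inv]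
      refine Finset.sum_congr rfl fun k _ => ?_
      have h4 := norm_pos_iff.2 (sub_ne_zero.2 (hne k).symm)
      have h5 := abs_pos.2 (hlam k).ne
      rw [alpha, norm_sub_rev]
      field_simp
      norm_num
    rw [h3] at h2
    refine h2.congr' ?_
    filter_upwards [Ioo_mem_nhdsLT_one] with ρ hρ
    have h4 : 1 - ρ ≠ 0 := by linarith [hρ.2]
    rw [pZero_re, Finset.sum_div]
    refine Finset.sum_congr rfl fun k _ => ?_
    rw [cayley_re' (hσ k), norm_ofReal_mul hτ hρ.1.le]
    field_simp
    ring
  have hub : Tendsto (fun ρ : ℝ => 2 / (l * (1 + ρ))) (𝓝[<] 1) (𝓝 (2 / (l * (1 + 1)))) := by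
    have : ContinuousAt (fun ρ : ℝ => 2 / (l * (1 + ρ))) 1 := by
      refine ContinuousAt.div (by fun_prop) (by fun_prop) ?_
      positivity
    exact this.tendsto.mono_left nhdsWithin_le_nhds
  have hl1 : 2 / (l * (1 + 1)) = l⁻¹ := by field_simp; norm_num
  rw [hl1] at hub
  have hnn : ∀ z ∈ disk, 0 ≤ ((q z)⁻¹ - pZero τ σ lam z).re := fun z hz =>
    re_sub_nonneg_of_mul_sq_le (hq0 z hz) (hre z hz)
  have hle : (radius lam)⁻¹ ≤ l⁻¹ := by
    refine le_of_tendsto_of_tendsto hp0 hub ?_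
    filter_upwards [Ioo_mem_nhdsLT_one] with ρ hρ
    refine le_trans ?_ (hbound ρ hρ)
    have h1 := hnn _ (radius_mem_disk hτ hρ)
    rw [sub_re] at h1
    exact div_le_div_of_nonneg_right (by linarith [Complex.re_le_norm (q (ρ * τ))⁻¹])
      (by linarith [hρ.2])
  refine ⟨(inv_le_inv₀ hr hl0).1 hle, fun hlr => ?_⟩
  have hdiff : DifferentiableOn ℂ (fun z => (q z)⁻¹ - pZero τ σ lam z) disk :=
    (hqd.inv hq0).sub (differentiableOn_pZero hσ)
  -- A Hopf-type argument: for `l = r` the real part of `1/q - p₀` is `o(1 - ρ)` on the radius,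
  -- while Harnack bounds it below by a multiple of `(1 - ρ)` times its value at 0.
  have hzero : ((q 0)⁻¹ - pZero τ σ lam 0).re ≤ 0 := by
    have h1 := (hub.sub hp0).const_mul 4
    rw [hlr, sub_self, mul_zero] at h1
    refine ge_of_tendsto h1 ?_
    filter_upwards [Ioo_mem_nhdsLT_one] with ρ hρ
    have hz := radius_mem_disk hτ hρ
    have h4 : 0 < 1 - ρ := by linarith [hρ.2]
    have h2 := harnack hdiff hnn hz zero_mem_disk
    have h3 := hbound ρ hρ
    rw [hlr] at h3
    simp only [map_zero, zero_mul, sub_zero, norm_one, one_pow, mul_one, norm_zero, ne_eq,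
      OfNat.ofNat_ne_zero, not_false_eq_true, zero_pow] at h2
    rw [norm_ofReal_mul hτ hρ.1.le] at h2
    have h5 := Complex.re_le_norm (q (ρ * τ))⁻¹
    have h6 : ((q (ρ * τ))⁻¹ - pZero τ σ lam (ρ * τ)).re / (1 - ρ) ≤
        2 / (radius lam * (1 + ρ)) - (pZero τ σ lam (ρ * τ)).re / (1 - ρ) := by
      rw [sub_re, sub_div]
      exact sub_le_sub_right ((div_le_div_of_nonneg_right h5 h4.le).trans h3) _
    refine le_trans ?_ (mul_le_mul_of_nonneg_left h6 (by norm_num : (0 : ℝ) ≤ 4))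
    rw [mul_div_assoc', le_div_iff₀ h4]
    have h7 := hnn 0 zero_mem_disk
    have h8 : 1 - ρ ≤ 1 - ρ ^ 2 := by nlinarith [hρ.1, hρ.2]
    nlinarith [mul_le_mul_of_nonneg_right h8 h7]
  have hconst := eqOn_const_of_re_eq_zero hdiff hnn zero_mem_disk
    (le_antisymm hzero (hnn 0 zero_mem_disk))
  set a := (q 0)⁻¹ - pZero τ σ lam 0
  -- The constant is read off at `τ`, where `1/q → 0` radially and `p₀` tends to `i` times `shift`.
  have ha : a = -(I * (shift τ σ lam : ℝ)) := by
    have h1 : Tendsto (fun ρ : ℝ => (q (ρ * τ))⁻¹) (𝓝[<] 1) (𝓝 0) := by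
      rw [tendsto_zero_iff_norm_tendsto_zero]
      have h2 : Tendsto (fun ρ : ℝ => 2 / (l * (1 + ρ)) * (1 - ρ)) (𝓝[<] 1) (𝓝 (l⁻¹ * (1 - 1))) :=
        hub.mul ((Continuous.tendsto (by fun_prop) _).mono_left nhdsWithin_le_nhds)
      rw [sub_self, mul_zero] at h2
      refine squeeze_zero' (Eventually.of_forall fun _ => norm_nonneg _) ?_ h2
      filter_upwards [Ioo_mem_nhdsLT_one] with ρ hρ
      have h4 : 0 < 1 - ρ := by linarith [hρ.2]
      exact (div_le_iff₀ h4).1 (hbound ρ hρ)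
    have h2 : Tendsto (fun ρ : ℝ => pZero τ σ lam (ρ * τ)) (𝓝[<] 1) (𝓝 (pZero τ σ lam τ)) :=
      hpc.tendsto.comp (tendsto_radius τ)
    have h3 := tendsto_nhds_unique_of_eventuallyEq (tendsto_const_nhds (x := a)) (h1.sub h2) (by
      filter_upwards [Ioo_mem_nhdsLT_one] with ρ hρ
      exact (hconst _ (radius_mem_disk hτ hρ)).symm)
    rw [h3, pZero_self hσ hne hlam, hτ]
    simp
  intro z hz
  rw [hq z hz, genWith, ← ha, ← hconst z hz, sub_add_cancel, div_inv_eq_mul]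

end DiskSemigroup

/-! ### The families of extremal generators and the main theorem. -/

namespace DiskSemigroup

open Complex ComplexConjugate

variable {n : ℕ} {σ : Fin n → ℂ} {lam : Fin n → ℝ} {τ : ℂ}

lemma GMax_eq : GMax τ σ lam = genWith τ σ lam (-(I * (shift τ σ lam : ℝ))) := by
  funext z
  rw [GMax, genWith, shift]
  congr 1
  ring

lemma genOf_eq (c : ℝ) : genOf τ σ lam c = genWith τ σ lam (I * c) := rfl

lemma pZero_self_re (hσ : ∀ k, ‖σ k‖ = 1) (hne : ∀ k, τ ≠ σ k) (hlam : ∀ k, lam k < 0) :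
    (pZero τ σ lam τ).re = (1 - ‖τ‖ ^ 2) / (2 * radius lam) := by
  rw [pZero_self hσ hne hlam, add_re, ofReal_re]
  simp

/-- The generators `genWith` deliver all nonzero points of the disk `|ω - r| ≤ r`. -/
lemma genWith_realizes (hn : 0 < n) (hσ : ∀ k, ‖σ k‖ = 1) (hinj : Function.Injective σ)
    (hlam : ∀ k, lam k < 0) (hτ : τ ∈ disk) {ω : ℂ} (hω0 : ω ≠ 0)
    (hω : ‖ω - (radius lam : ℂ)‖ ≤ radius lam) :
    genWith τ σ lam ((1 - ‖τ‖ ^ 2 : ℝ) / ω - pZero τ σ lam τ) ∈ Gen τ σ lam ∧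
      IsSpectralValue (genWith τ σ lam ((1 - ‖τ‖ ^ 2 : ℝ) / ω - pZero τ σ lam τ)) τ ω ∧
      (‖ω - (radius lam : ℂ)‖ = radius lam →
        ((1 - ‖τ‖ ^ 2 : ℝ) / ω - pZero τ σ lam τ).re = 0) := by
  have hne := ne_of_norm_lt_one hσ hτ
  have hr := radius_pos hn hlam
  set e : ℝ := 1 - ‖τ‖ ^ 2 with he
  have he0 : 0 < e := by have := norm_sq_lt_one hτ; linarith
  have hω2 := norm_pos_iff.2 hω0
  -- The parameter solves `e / (a + p₀(τ)) = ω`; its real part is nonnegative exactly when `ω` lies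
  -- in the disk, and zero exactly on the circle.
  have hre : ((e : ℂ) / ω - pZero τ σ lam τ).re = e * ω.re / ‖ω‖ ^ 2 - e / (2 * radius lam) := by
    rw [sub_re, pZero_self_re hσ hne hlam, div_eq_mul_inv, Complex.re_ofReal_mul, re_inv_eq,
      mul_div_assoc]
  have ha : 0 ≤ ((e : ℂ) / ω - pZero τ σ lam τ).re := by
    rw [norm_sub_radius_le_iff hr.le] at hω
    rw [hre, sub_nonneg, div_le_div_iff₀ (by positivity) (by positivity)]
    nlinarith
  obtain ⟨h1, h2⟩ := genWith_mem_Gen hn hσ hinj hlam hτ ha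
  refine ⟨h1, ?_, fun heq => ?_⟩
  · rw [sub_add_cancel] at h2
    rwa [div_div_cancel₀ (Complex.ofReal_ne_zero.2 he0.ne')] at h2
  · rw [norm_sub_radius_eq_iff hr.le] at heq
    rw [hre, sub_eq_zero, div_eq_div_iff (by positivity) (by positivity), heq]
    ring

lemma eq_I_mul_im {a : ℂ} (h : a.re = 0) : a = I * (a.im : ℂ) := by
  apply Complex.ext <;> simp [h]

/-- With an imaginary parameter, `1/ω = (a + p₀(τ)) / (1 - |τ|²)` has real part `1/(2r)`, which
places `ω` on the circle. -/
lemma genWith_imaginary (hn : 0 < n) (hσ : ∀ k, ‖σ k‖ = 1) (hinj : Function.Injective σ)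
    (hlam : ∀ k, lam k < 0) (hτ : τ ∈ disk) (c : ℝ) :
    genWith τ σ lam (I * c) ∈ Gen τ σ lam ∧
      ∃ ω : ℂ, ‖ω - (radius lam : ℂ)‖ = radius lam ∧
        IsSpectralValue (genWith τ σ lam (I * c)) τ ω := by
  have hne := ne_of_norm_lt_one hσ hτ
  have hr := radius_pos hn hlam
  obtain ⟨h1, h2⟩ := genWith_mem_Gen (a := I * c) hn hσ hinj hlam hτ (by simp)
  refine ⟨h1, _, ?_, h2⟩
  have h3 := (differentiableOn_genWith_inv (a := I * c) hn hσ hlam hne (by simp)).1 τ hτ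
  have hre : (I * c + pZero τ σ lam τ).re = (1 - ‖τ‖ ^ 2) / (2 * radius lam) := by
    rw [add_re, pZero_self_re hσ hne hlam]
    simp
  have h4 := norm_pos_iff.2 h3
  rw [norm_sub_radius_eq_iff hr.le, div_eq_mul_inv, Complex.re_ofReal_mul, re_inv_eq, hre, norm_mul,
    norm_inv, Complex.norm_real, mul_pow, Real.norm_eq_abs, sq_abs]
  field_simp

lemma sum_alpha_pos (hn : 0 < n) (hlam : ∀ k, lam k < 0) (hne : ∀ k, τ ≠ σ k) :
    0 < ∑ k, alpha τ σ lam k := by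
  have : Nonempty (Fin n) := ⟨⟨0, hn⟩⟩
  exact Finset.sum_pos (fun k _ => alpha_pos hlam hne k) Finset.univ_nonempty

lemma mem_frontier_Z (hn : 0 < n) (hlam : ∀ k, lam k < 0) (hne : ∀ k, τ ≠ σ k) (hτ0 : τ ≠ 0)
    (ζ : ℂ) : ζ ∈ frontier (Z τ σ lam) ↔
      ‖(2 * τ⁻¹ * ∑ k, (alpha τ σ lam k : ℂ)) * ζ - 1‖ = 1 := by
  have hA : (∑ k, (alpha τ σ lam k : ℂ)) ≠ 0 := by
    rw [← Complex.ofReal_sum]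
    exact Complex.ofReal_ne_zero.2 (sum_alpha_pos hn hlam hne).ne'
  have hc : 2 * τ⁻¹ * ∑ k, (alpha τ σ lam k : ℂ) ≠ 0 :=
    mul_ne_zero (mul_ne_zero two_ne_zero (inv_ne_zero hτ0)) hA
  have h1 : Z τ σ lam = Homeomorph.mulLeft₀ _ hc ⁻¹' Metric.closedBall (1 : ℂ) 1 := by
    ext ζ
    simp [Z, dist_eq_norm]
  rw [h1, ← Homeomorph.preimage_frontier, frontier_closedBall _ one_ne_zero]
  simp

/-- Extremal generators belong to the family `GZeta`. -/
lemma exists_eqOn_GZeta (hn : 0 < n) (hσ : ∀ k, ‖σ k‖ = 1) (hinj : Function.Injective σ)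
    (hlam : ∀ k, lam k < 0) (hτ : τ ∈ disk) (hτ0 : τ ≠ 0) {G : ℂ → ℂ} (hG : G ∈ Gen τ σ lam) {ω : ℂ}
    (hω : ‖ω - (radius lam : ℂ)‖ = radius lam) (h : IsSpectralValue G τ ω) :
    ∃ ζ ∈ frontier (Z τ σ lam), EqOn G (GZeta τ σ lam ζ) disk := by
  have hne := ne_of_norm_lt_one hσ hτ
  obtain ⟨h1, h2⟩ := (spectralValue_interior hn hσ hinj hlam hτ hG h).2 hω
  rcases eq_or_ne ω 0 with hω0 | hω0
  · refine ⟨0, (mem_frontier_Z hn hlam hne hτ0 0).2 (by simp), ?_⟩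
    rw [GZeta, if_pos rfl]
    exact h1 hω0
  have hG' := h2 hω0
  rw [eq_I_mul_im ((genWith_realizes hn hσ hinj hlam hτ hω0 hω.le).2.2 hω), ← genOf_eq] at hG'
  set c := ((1 - ‖τ‖ ^ 2 : ℝ) / ω - pZero τ σ lam τ).im
  have hA := sum_alpha_pos hn hlam hne
  set A := ∑ k, alpha τ σ lam k with hAdef
  have hAc : (∑ k, (alpha τ σ lam k : ℂ)) = A := by rw [hAdef, Complex.ofReal_sum]
  have hw : (A + I * c : ℂ) ≠ 0 := by
    intro h0
    have := congrArg Complex.re h0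
    simp at this
    exact hA.ne' this
  -- This `ζ` is the solution of `ℓ_ζ = i c`. It lies on the boundary of `Z` because `2A/w - 1 =
  -- w̄/w` is unimodular for `w = A + i c`.
  have hζ0 : τ / (A + I * c) ≠ 0 := div_ne_zero hτ0 hw
  refine ⟨τ / (A + I * c), (mem_frontier_Z hn hlam hne hτ0 _).2 ?_, ?_⟩
  · have : 2 * τ⁻¹ * (A : ℂ) * (τ / (A + I * c)) - 1 = conj (A + I * c : ℂ) / (A + I * c) := by
      simp only [map_add, map_mul, conj_ofReal, conj_I]
      field_simp
      ring
    rw [hAc, this, norm_div, Complex.norm_conj, div_self (norm_ne_zero_iff.2 hw)]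
  · have hl : ell τ σ lam (τ / (A + I * c)) = I * c := by
      rw [ell, hAc, div_div_cancel₀ hτ0]
      ring
    rw [GZeta, if_neg hζ0, hl]
    simpa using hG'

lemma zero_realizes (hn : 0 < n) (hσ : ∀ k, ‖σ k‖ = 1) (hlam : ∀ k, lam k < 0) (hτ : τ ∈ disk) :
    (0 : ℂ → ℂ) ∈ Gen τ σ lam ∧ ∃ ω : ℂ, ‖ω - (radius lam : ℂ)‖ = radius lam ∧
      IsSpectralValue 0 τ ω := by
  obtain ⟨h1, h2⟩ := zero_mem_Gen (τ := τ) hσ hlam hτ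
  refine ⟨h1, 0, ?_, h2⟩
  rw [zero_sub, norm_neg, Complex.norm_real, Real.norm_of_nonneg (radius_pos hn hlam).le]

lemma GHat_eq (hσ : ∀ k, ‖σ k‖ = 1) (hlam : ∀ k, lam k < 0) {ω : ℂ} (hω0 : ω ≠ 0)
    (h : ((1 - ‖(0 : ℂ)‖ ^ 2 : ℝ) / ω - pZero 0 σ lam 0).re = 0) :
    GHat σ lam ω = genWith 0 σ lam ((1 - ‖(0 : ℂ)‖ ^ 2 : ℝ) / ω - pZero 0 σ lam 0) := by
  have hne : ∀ k, (0 : ℂ) ≠ σ k := ne_of_norm_lt_one hσ (mem_disk.2 (by simp))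
  have him : ((1 - ‖(0 : ℂ)‖ ^ 2 : ℝ) / ω - pZero 0 σ lam 0).im =
      (1 / ω - (1 / 2 : ℂ) * ∑ k, ((|lam k|⁻¹ : ℝ) : ℂ)).im := by
    rw [pZero_self hσ hne hlam, ← Complex.ofReal_sum]
    simp [shift]
  rw [eq_I_mul_im h, him]
  funext z
  rw [GHat, if_neg hω0, genWith]
  simp

/-- `GMax` is the extremal generator for `ω = 2r`, the rightmost point of the disk: the real part of
`p₀(τ)` cancels. -/
lemma parameter_two_radius (hσ : ∀ k, ‖σ k‖ = 1) (hlam : ∀ k, lam k < 0)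
    (hne : ∀ k, τ ≠ σ k) :
    ((1 - ‖τ‖ ^ 2 : ℝ) : ℂ) / ((2 * radius lam : ℝ) : ℂ) - pZero τ σ lam τ =
      -(I * (shift τ σ lam : ℝ)) := by
  rw [pZero_self hσ hne hlam, ← Complex.ofReal_div]
  ring

lemma norm_two_radius_sub (hn : 0 < n) (hlam : ∀ k, lam k < 0) :
    ‖((2 * radius lam : ℝ) : ℂ) - (radius lam : ℂ)‖ = radius lam := by
  rw [← Complex.ofReal_sub, Complex.norm_real, two_mul, add_sub_cancel_right,
    Real.norm_of_nonneg (radius_pos hn hlam).le]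

lemma eq_two_radius_of_re_eq {r : ℝ} {ω : ℂ} (h : ‖ω‖ ^ 2 ≤ 2 * r * ω.re) (hre : ω.re = 2 * r) :
    ω = ((2 * r : ℝ) : ℂ) := by
  rw [Complex.sq_norm, Complex.normSq_apply, hre] at h
  apply Complex.ext
  · rw [hre, ofReal_re]
  · rw [ofReal_im]
    nlinarith [mul_self_nonneg ω.im]

lemma re_le_two_radius {r : ℝ} (hr : 0 < r) {ω : ℂ} (h : ‖ω‖ ^ 2 ≤ 2 * r * ω.re) :
    ω.re ≤ 2 * r := by
  rw [Complex.sq_norm, Complex.normSq_apply] at h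
  nlinarith [mul_self_nonneg ω.im, mul_self_nonneg (ω.re - 2 * r)]

end DiskSemigroup

open DiskSemigroup in
theorem mainTheorem7 {n : ℕ} (hn : 0 < n) (σ : Fin n → ℂ) (hσ : ∀ k, ‖σ k‖ = 1)
    (hinj : Function.Injective σ) (lam : Fin n → ℝ) (hlam : ∀ k, lam k < 0) :
    -- interior Denjoy-Wolff point
    (∀ τ : ℂ, ‖τ‖ < 1 →
      -- the functional is well defined on the class
      (∀ G ∈ DiskSemigroup.Gen τ σ lam, ∃! ω : ℂ, DiskSemigroup.IsSpectralValue G τ ω) ∧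
      -- its range
      {ω : ℂ | ∃ G ∈ DiskSemigroup.Gen τ σ lam, DiskSemigroup.IsSpectralValue G τ ω}
        = {ω : ℂ | ‖ω - (DiskSemigroup.radius lam : ℂ)‖ ≤ DiskSemigroup.radius lam} ∧
      -- every boundary point is delivered by exactly one generator
      (∀ ω : ℂ, ‖ω - (DiskSemigroup.radius lam : ℂ)‖ = DiskSemigroup.radius lam →
        ∃ G ∈ DiskSemigroup.Gen τ σ lam, DiskSemigroup.IsSpectralValue G τ ω ∧
          ∀ G' ∈ DiskSemigroup.Gen τ σ lam, DiskSemigroup.IsSpectralValue G' τ ω →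
            EqOn G' G DiskSemigroup.disk) ∧
      -- the family of these generators, for `τ ≠ 0`
      (τ ≠ 0 →
        (∀ G ∈ DiskSemigroup.Gen τ σ lam, ∀ ω : ℂ,
          ‖ω - (DiskSemigroup.radius lam : ℂ)‖ = DiskSemigroup.radius lam →
          DiskSemigroup.IsSpectralValue G τ ω →
            ∃ ζ ∈ frontier (DiskSemigroup.Z τ σ lam),
              EqOn G (DiskSemigroup.GZeta τ σ lam ζ) DiskSemigroup.disk) ∧
        (∀ ζ ∈ frontier (DiskSemigroup.Z τ σ lam),
          DiskSemigroup.GZeta τ σ lam ζ ∈ DiskSemigroup.Gen τ σ lam ∧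
          ∃ ω : ℂ, ‖ω - (DiskSemigroup.radius lam : ℂ)‖ = DiskSemigroup.radius lam ∧
            DiskSemigroup.IsSpectralValue (DiskSemigroup.GZeta τ σ lam ζ) τ ω)) ∧
      -- the family of these generators, for `τ = 0`
      (τ = 0 → ∀ ω : ℂ, ‖ω - (DiskSemigroup.radius lam : ℂ)‖ = DiskSemigroup.radius lam →
        DiskSemigroup.GHat σ lam ω ∈ DiskSemigroup.Gen τ σ lam ∧
        DiskSemigroup.IsSpectralValue (DiskSemigroup.GHat σ lam ω) τ ω) ∧
      -- the sharp estimate of the real part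
      (∀ G ∈ DiskSemigroup.Gen τ σ lam, ∀ ω : ℂ, DiskSemigroup.IsSpectralValue G τ ω →
        ω.re ≤ 2 * DiskSemigroup.radius lam ∧
        (ω.re = 2 * DiskSemigroup.radius lam →
          EqOn G (DiskSemigroup.GMax τ σ lam) DiskSemigroup.disk)) ∧
      DiskSemigroup.GMax τ σ lam ∈ DiskSemigroup.Gen τ σ lam ∧
      DiskSemigroup.IsSpectralValue (DiskSemigroup.GMax τ σ lam) τ
        ((2 * DiskSemigroup.radius lam : ℝ) : ℂ)) ∧
    -- boundary Denjoy-Wolff point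
    (∀ τ : ℂ, ‖τ‖ = 1 → (∀ k, τ ≠ σ k) →
      -- the functional is well defined and real on the class
      (∀ G ∈ DiskSemigroup.Gen τ σ lam,
        (∃! ω : ℂ, DiskSemigroup.IsSpectralValue G τ ω) ∧
        ∃ l : ℝ, DiskSemigroup.IsSpectralValue G τ (l : ℂ) ∧ l ≤ DiskSemigroup.radius lam ∧
          (l = DiskSemigroup.radius lam →
            EqOn G (DiskSemigroup.GMax τ σ lam) DiskSemigroup.disk)) ∧
      DiskSemigroup.GMax τ σ lam ∈ DiskSemigroup.Gen τ σ lam ∧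
      DiskSemigroup.IsSpectralValue (DiskSemigroup.GMax τ σ lam) τ
        (DiskSemigroup.radius lam : ℂ)) := by
  have hr := radius_pos hn hlam
  refine ⟨fun τ hτ1 => ?_, fun τ hτ1 hne => ?_⟩
  · have hτ : τ ∈ disk := mem_disk.2 hτ1
    have hne := ne_of_norm_lt_one hσ hτ
    have h2r0 : ((2 * radius lam : ℝ) : ℂ) ≠ 0 := Complex.ofReal_ne_zero.2 (by positivity)
    have h2r := norm_two_radius_sub hn hlam
    have hpar := parameter_two_radius hσ hlam hne
    have hmax := genWith_realizes hn hσ hinj hlam hτ h2r0 h2r.le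
    rw [hpar, ← GMax_eq] at hmax
    refine ⟨fun G hG => ?_, ?_, fun ω hω => ?_, fun hτ0 => ⟨fun G hG ω hω h => ?_, fun ζ hζ => ?_⟩,
      ?_, fun G hG ω h => ?_, hmax.1, hmax.2.1⟩
    · have h := existsUnique_spectralValue_of_mem_Gen hτ hG
      exact ⟨_, h, fun _ h' => h'.unique h⟩
    · ext ω
      refine ⟨?_, fun hω => ?_⟩
      · rintro ⟨G, hG, h⟩
        exact (spectralValue_interior hn hσ hinj hlam hτ hG h).1
      · rcases eq_or_ne ω 0 with rfl | hω0
        · exact ⟨0, zero_mem_Gen hσ hlam hτ⟩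
        · have h := genWith_realizes hn hσ hinj hlam hτ hω0 hω
          exact ⟨_, h.1, h.2.1⟩
    · rcases eq_or_ne ω 0 with rfl | hω0
      · have h := zero_mem_Gen (τ := τ) hσ hlam hτ
        exact ⟨0, h.1, h.2, fun G' hG' h' =>
          ((spectralValue_interior hn hσ hinj hlam hτ hG' h').2 hω).1 rfl⟩
      · have h := genWith_realizes hn hσ hinj hlam hτ hω0 hω.le
        exact ⟨_, h.1, h.2.1, fun G' hG' h' =>
          ((spectralValue_interior hn hσ hinj hlam hτ hG' h').2 hω).2 hω0⟩
    · exact exists_eqOn_GZeta hn hσ hinj hlam hτ hτ0 hG hω h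
    · rw [GZeta]
      split_ifs with hζ0
      · exact zero_realizes hn hσ hlam hτ
      · exact genWith_imaginary hn hσ hinj hlam hτ _
    · rintro rfl ω hω
      rcases eq_or_ne ω 0 with rfl | hω0
      · rw [GHat, if_pos rfl]
        exact zero_mem_Gen hσ hlam hτ
      · have h := genWith_realizes hn hσ hinj hlam hτ hω0 hω.le
        rw [GHat_eq hσ hlam hω0 (h.2.2 hω)]
        exact ⟨h.1, h.2.1⟩
    · have hI := spectralValue_interior hn hσ hinj hlam hτ hG h
      have hle := (norm_sub_radius_le_iff hr.le ω).1 hI.1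
      refine ⟨re_le_two_radius hr hle, fun hre => ?_⟩
      obtain rfl := eq_two_radius_of_re_eq hle hre
      have hE := (hI.2 h2r).2 h2r0
      rwa [hpar, ← GMax_eq] at hE
  · have hmax := genWith_mem_Gen_boundary hn hσ hinj hlam hτ1 hne
    rw [← GMax_eq] at hmax
    refine ⟨fun G hG => ?_, hmax⟩
    obtain ⟨l, h, hle, hE⟩ := spectralValue_boundary hn hσ hinj hlam hτ1 hne hG
    rw [← GMax_eq] at hE
    exact ⟨⟨_, h, fun _ h' => h'.unique h⟩, l, h, hle, hE⟩
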